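/- Let $M$ be a connected real-analytic manifold (finite-dimensional, Hausdorff, second countable, without boundary) and let $\nabla$ be a real-analytic connection on $M$, i.e. on $TM$ (not necessarily torsion-free). Let $W\subseteq T^*M\otimes T^*M$ be the bundle of symmetric covariant two-tensors with the induced connection $(\nabla_v h)(Y,Z)=v(h(Y,Z))-h(\nabla_vY,Z)-h(Y,\nabla_vZ)$ and curvature $R$. For a subset $V\subseteq W$ let $\mathcal S(V)$ be the set of those $v\in V$ that lie on a smooth local section of $W$ with values in $V$. For a subset $W'\subseteq W$ let $\ker\alpha_{W'}$ (the kernel of the second fundamental 1-form of $W'$) be the set of all $w\in W'$, over a point $x$ say, for which there is a smooth local section $X$ near $x$ with values in $W'$, $X(x)=w$ and $\nabla_vX\in W'_x$ for all $v\in T_xM$. Define the derived flag by $$V^{(0)}=\{w\in W: R(\cdot,\cdot)(w)=0\},\qquad W^{(i)}=\mathcal S(V^{(i)}),\qquad V^{(i+1)}=\ker\alpha_{W^{(i)}},$$ and let $\widetilde W=\bigcap_i W^{(i)}$. Then: 1. The flag stabilizes: there is a $k$ with $W^{(l)}=\widetilde W$ for all $l\ge k$. Moreover $\widetilde W$ is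 a (real-analytic) vector subbundle of $W$ over $M$, of some rank $r=\operatorname{rank}\widetilde W$; that is, $\nabla$ is regular. 2. If moreover $M$ is simply connected and $\nabla$ is locally metric (every point has an open neighbourhood carrying a smooth Riemannian metric $g$ with $\nabla g=0$), then $\nabla$ is metric: there is a (real-analytic) Riemannian metric $g$ on all of $M$ with $\nabla g=0$. Furthermore, there exist $r=\operatorname{rank}\widetilde W$ parallel (real-analytic) Riemannian metrics on $M$ that are linearly independent (at every point of $M$). -/

import Mathlib

open Bundle
open scoped Manifold ContDiff

namespace MetricConnection

/-! ## The derived flag of a connection on a vector bundle -/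

section Flag

variable {E : Type*} [NormedAddCommGroup E] [NormedSpace ℝ E]
  {H : Type*} [TopologicalSpace H] {I : ModelWithCorners ℝ E H}
  {M : Type*} [TopologicalSpace M] [ChartedSpace H M]
  {F : Type*} [NormedAddCommGroup F] [NormedSpace ℝ F]
  {V : M → Type*} [TopologicalSpace (TotalSpace F V)]
  [∀ x, AddCommGroup (V x)] [∀ x, Module ℝ (V x)]
  [∀ x : M, TopologicalSpace (V x)]
  [∀ x, IsTopologicalAddGroup (V x)] [∀ x, ContinuousSMul ℝ (V x)]
  [FiberBundle F V]

/-- A connection is analytic if it sends analytic local sections, over any open set, to analytic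
local sections. -/
def IsAnalytic [IsManifold I 1 M] [VectorBundle ℝ F V] (D : CovariantDerivative I F V) : Prop :=
  ∀ U : Set M, IsOpen U → ContMDiffCovariantDerivativeOn F ω D.toFun U

/-- `R(X, Y)σ = ∇_X ∇_Y σ - ∇_Y ∇_X σ - ∇_[X, Y] σ` at the point `x`. -/
noncomputable def curvatureAux (D : CovariantDerivative I F V)
    (X Y : Π y : M, TangentSpace I y) (σ : Π y : M, V y) (x : M) : V x :=
  D (fun y => D σ y (Y y)) x (X x) - D (fun y => D σ y (X y)) x (Y x)
    - D σ x (VectorField.mlieBracket I X Y x)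

/-- The curvature tensor `R(u, v)w` at `x`, computed with local extensions of `u`, `v`, `w` to
sections that are smooth near `x` (the result is independent of the extensions when the connection
is smooth). -/
noncomputable def curvature [IsManifold I 1 M] (D : CovariantDerivative I F V) (x : M)
    (u v : TangentSpace I x) (w : V x) : V x :=
  curvatureAux D (FiberBundle.extend E u) (FiberBundle.extend E v) (FiberBundle.extend F w) x

variable (I F) in
/-- `X` is a smooth local section over the open neighbourhood `U` of `x`, with values in the
subset `A` of the bundle. -/
structure IsLocalSection (A : Π y : M, Set (V y)) (U : Set M) (x : M) (X : Π y : M, V y) :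
    Prop where
  isOpen : IsOpen U
  mem : x ∈ U
  contMDiffOn : ContMDiffOn I (I.prod 𝓘(ℝ, F)) ∞ (fun y => TotalSpace.mk' F y (X y)) U
  mapsTo : ∀ y ∈ U, X y ∈ A y

variable (I F) in
/-- `𝒮(A)`: the elements of `A` that lie on a smooth local section with values in `A`. -/
def sectionPart (A : Π y : M, Set (V y)) (x : M) : Set (V x) :=
  {w | ∃ U X, IsLocalSection I F A U x X ∧ X x = w}

/-- The kernel of the second fundamental 1-form of `A`, that is of the map `A → (V / A) ⊗ T*M`
induced by `X ↦ ∇X mod A` on the local sections `X` of `A`. -/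
def kerSecondFundamentalForm (D : CovariantDerivative I F V) (A : Π y : M, Set (V y)) (x : M) :
    Set (V x) :=
  {w | ∃ U X, IsLocalSection I F A U x X ∧ X x = w ∧ ∀ v : TangentSpace I x, D X x v ∈ A x}

/-- The sets `V⁽ⁱ⁾` of the derived flag of the subbundle `W` (preserved by `D`):
`V⁽⁰⁾ = {w ∈ W | R(·,·)w = 0}` and `V⁽ⁱ⁺¹⁾ = ker α_{W⁽ⁱ⁾}` with `W⁽ⁱ⁾ = 𝒮(V⁽ⁱ⁾)`. -/
def preFlag [IsManifold I 1 M] (D : CovariantDerivative I F V) (W : Π y : M, Set (V y)) :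
    ℕ → Π y : M, Set (V y)
  | 0 => fun x => {w | w ∈ W x ∧ ∀ u v : TangentSpace I x, curvature D x u v w = 0}
  | i + 1 => kerSecondFundamentalForm D (sectionPart I F (preFlag D W i))

/-- The sets `W⁽ⁱ⁾ = 𝒮(V⁽ⁱ⁾)` of the derived flag. -/
def derivedFlag [IsManifold I 1 M] (D : CovariantDerivative I F V) (W : Π y : M, Set (V y))
    (i : ℕ) : Π y : M, Set (V y) :=
  sectionPart I F (preFlag D W i)

/-- The terminal subset of the derived flag. The flag is decreasing, so this is `W⁽ᵏ⁾` whenever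
`W⁽ˡ⁾ = W⁽ᵏ⁾` for all `l ≥ k`. -/
def flagTerminal [IsManifold I 1 M] (D : CovariantDerivative I F V) (W : Π y : M, Set (V y))
    (x : M) : Set (V x) :=
  ⋂ i : ℕ, derivedFlag D W i x

variable (I F) in
/-- The subset `A` of the bundle is a rank `r` vector subbundle of class `C^n`: locally it is
spanned fibrewise by a frame of `r` pointwise independent sections of class `C^n`. -/
def IsVectorSubbundle (n : ℕ∞ω) (A : Π y : M, Set (V y)) (r : ℕ) : Prop :=
  ∀ x : M, ∃ U : Set M, IsOpen U ∧ x ∈ U ∧ ∃ s : Fin r → Π y : M, V y,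
    (∀ i, ContMDiffOn I (I.prod 𝓘(ℝ, F)) n (fun y => TotalSpace.mk' F y (s i y)) U) ∧
    ∀ y ∈ U, LinearIndependent ℝ (fun i => s i y) ∧
      (Submodule.span ℝ (Set.range fun i => s i y) : Set (V y)) = A y

end Flag

/-! ## The connection induced on covariant two-tensors -/

section Shortcuts

/-! Shortcuts for instance search on spaces of linear forms and bilinear forms. -/

variable {E : Type*} [NormedAddCommGroup E] [NormedSpace ℝ E]
  {H : Type*} [TopologicalSpace H] {I : ModelWithCorners ℝ E H}
  {M : Type*} [TopologicalSpace M] [ChartedSpace H M]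

instance instIsTopologicalAddGroupForm (x : M) :
    IsTopologicalAddGroup (TangentSpace I x →L[ℝ] ℝ) := inferInstance

instance instContinuousAddForm (x : M) : ContinuousAdd (TangentSpace I x →L[ℝ] ℝ) :=
  (instIsTopologicalAddGroupForm x).toContinuousAdd

instance instContinuousSMulForm (x : M) : ContinuousSMul ℝ (TangentSpace I x →L[ℝ] ℝ) :=
  inferInstance

noncomputable instance instAddCommGroupBilinForm (x : M) :
    AddCommGroup (TangentSpace I x →L[ℝ] TangentSpace I x →L[ℝ] ℝ) :=
  ContinuousLinearMap.addCommGroup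

noncomputable instance instModuleBilinForm (x : M) :
    Module ℝ (TangentSpace I x →L[ℝ] TangentSpace I x →L[ℝ] ℝ) :=
  ContinuousLinearMap.module

instance instIsTopologicalAddGroupBilinForm (x : M) :
    IsTopologicalAddGroup (TangentSpace I x →L[ℝ] TangentSpace I x →L[ℝ] ℝ) := inferInstance

instance instContinuousSMulBilinForm (x : M) :
    ContinuousSMul ℝ (TangentSpace I x →L[ℝ] TangentSpace I x →L[ℝ] ℝ) := inferInstance

end Shortcuts

section TwoTensors

variable {E : Type*} [NormedAddCommGroup E] [NormedSpace ℝ E]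
  {H : Type*} [TopologicalSpace H] {I : ModelWithCorners ℝ E H}
  {M : Type*} [TopologicalSpace M] [ChartedSpace H M]

variable (I) in
/-- The fibre of `T*M ⊗ T*M` at `x`: bilinear forms on the tangent space. -/
abbrev TwoTensor (x : M) : Type _ := TangentSpace I x →L[ℝ] TangentSpace I x →L[ℝ] ℝ

variable [IsManifold I 2 M]

/-- The 1-form `d(h(Y, Z)) - h(∇Y, Z) - h(Y, ∇Z)` at `x`. -/
noncomputable def covDerivAux (D : CovariantDerivative I E (TangentSpace I : M → Type _))
    (h : Π y : M, TwoTensor I y) (Y Z : Π y : M, TangentSpace I y) (x : M)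
    (v : TangentSpace I x) : ℝ :=
  d% (fun y => h y (Y y) (Z y)) x v - h x (D Y x v) (Z x) - h x (Y x) (D Z x v)

theorem mdifferentiableAt_eval {h : Π y : M, TwoTensor I y} {Y Z : Π y : M, TangentSpace I y}
    {x : M}
    (hh : MDifferentiableAt I (I.prod 𝓘(ℝ, E →L[ℝ] E →L[ℝ] ℝ))
      (fun y => TotalSpace.mk' (E →L[ℝ] E →L[ℝ] ℝ) y (h y)) x)
    (hY : MDiffAt (T% Y) x) (hZ : MDiffAt (T% Z) x) :
    MDiffAt (fun y => h y (Y y) (Z y)) x := by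
  have : MDifferentiableAt I (I.prod 𝓘(ℝ))
      (fun m ↦ TotalSpace.mk' ℝ (E := Bundle.Trivial M ℝ) m (h m (Y m) (Z m))) x :=
    MDifferentiableAt.clm_bundle_apply₂ (F₁ := E) (F₂ := E) hh hY hZ
  simp only [mdifferentiableAt_totalSpace] at this
  exact this.2

theorem tensorial_covDerivAux₁ (D : CovariantDerivative I E (TangentSpace I : M → Type _))
    {h : Π y : M, TwoTensor I y} {x : M}
    (hh : MDifferentiableAt I (I.prod 𝓘(ℝ, E →L[ℝ] E →L[ℝ] ℝ))
      (fun y => TotalSpace.mk' (E →L[ℝ] E →L[ℝ] ℝ) y (h y)) x)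
    (v : TangentSpace I x) (Z : Π y : M, TangentSpace I y) (hZ : MDiffAt (T% Z) x) :
    TensorialAt I E (fun Y => covDerivAux D h Y Z x v) x where
  smul hf hY := by
    simp [covDerivAux, mvfderiv_fun_mul hf (mdifferentiableAt_eval hh hY hZ),
      D.isCovariantDerivativeOn.leibniz hY hf]
    ring
  add hY hY' := by
    simp [covDerivAux, mvfderiv_fun_add (mdifferentiableAt_eval hh hY hZ)
      (mdifferentiableAt_eval hh hY' hZ), D.isCovariantDerivativeOn.add hY hY']
    ring

theorem tensorial_covDerivAux₂ (D : CovariantDerivative I E (TangentSpace I : M → Type _))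
    {h : Π y : M, TwoTensor I y} {x : M}
    (hh : MDifferentiableAt I (I.prod 𝓘(ℝ, E →L[ℝ] E →L[ℝ] ℝ))
      (fun y => TotalSpace.mk' (E →L[ℝ] E →L[ℝ] ℝ) y (h y)) x)
    (v : TangentSpace I x) (Y : Π y : M, TangentSpace I y) (hY : MDiffAt (T% Y) x) :
    TensorialAt I E (fun Z => covDerivAux D h Y Z x v) x where
  smul hf hZ := by
    simp [covDerivAux, mvfderiv_fun_mul hf (mdifferentiableAt_eval hh hY hZ),
      D.isCovariantDerivativeOn.leibniz hZ hf]
    ring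
  add hZ hZ' := by
    simp [covDerivAux, mvfderiv_fun_add (mdifferentiableAt_eval hh hY hZ)
      (mdifferentiableAt_eval hh hY hZ'), D.isCovariantDerivativeOn.add hZ hZ']
    ring

variable [FiniteDimensional ℝ E]

open Classical in
/-- The covariant derivative `∇h` of a two-tensor:
`(∇_v h)(Y, Z) = v(h(Y, Z)) - h(∇_v Y, Z) - h(Y, ∇_v Z)` at points where `h` is differentiable
(and `0` elsewhere). -/
noncomputable def covDeriv (D : CovariantDerivative I E (TangentSpace I : M → Type _))
    (h : Π y : M, TwoTensor I y) (x : M) : TangentSpace I x →L[ℝ] TwoTensor I x :=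
  if hh : MDifferentiableAt I (I.prod 𝓘(ℝ, E →L[ℝ] E →L[ℝ] ℝ))
      (fun y => TotalSpace.mk' (E →L[ℝ] E →L[ℝ] ℝ) y (h y)) x then
    have : FiniteDimensional ℝ (TangentSpace I x) := inferInstanceAs (FiniteDimensional ℝ E)
    have : T2Space (TangentSpace I x) := inferInstanceAs (T2Space E)
    LinearMap.toContinuousLinearMap
      { toFun := fun v => TensorialAt.mkHom₂ (fun Y Z => covDerivAux D h Y Z x v) x
          (tensorial_covDerivAux₁ D hh v) (tensorial_covDerivAux₂ D hh v)
        map_add' := fun v w => by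
          ext a b
          simp only [TensorialAt.mkHom₂_apply_eq_extend, covDerivAux,
            add_apply, map_add]
          ring
        map_smul' := fun c v => by
          ext a b
          simp only [TensorialAt.mkHom₂_apply_eq_extend, covDerivAux,
            smul_apply, map_smul, RingHom.id_apply, smul_eq_mul]
          ring }
  else 0

theorem covDeriv_apply (D : CovariantDerivative I E (TangentSpace I : M → Type _))
    {h : Π y : M, TwoTensor I y} {Y Z : Π y : M, TangentSpace I y} {x : M}
    (hh : MDifferentiableAt I (I.prod 𝓘(ℝ, E →L[ℝ] E →L[ℝ] ℝ))
      (fun y => TotalSpace.mk' (E →L[ℝ] E →L[ℝ] ℝ) y (h y)) x)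
    (hY : MDiffAt (T% Y) x) (hZ : MDiffAt (T% Z) x) (v : TangentSpace I x) :
    covDeriv D h x v (Y x) (Z x) =
      d% (fun y => h y (Y y) (Z y)) x v - h x (D Y x v) (Z x) - h x (Y x) (D Z x v) := by
  rw [covDeriv, dif_pos hh]
  exact TensorialAt.mkHom₂_apply (tensorial_covDerivAux₁ D hh v) (tensorial_covDerivAux₂ D hh v)
    hY hZ

set_option synthInstance.maxHeartbeats 200000 in
/-- The connection on `T*M ⊗ T*M` induced by a connection on `M`. -/
noncomputable def inducedConnection (D : CovariantDerivative I E (TangentSpace I : M → Type _)) :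
    CovariantDerivative I (E →L[ℝ] E →L[ℝ] ℝ) (fun x : M => TwoTensor I x) where
  toFun := covDeriv D
  isCovariantDerivativeOnUniv :=
    { add := by
        intro h h' x hh hh' _
        have hs := mdifferentiableAt_add_section hh hh'
        ext v a b
        obtain ⟨Y, hY, rfl⟩ : ∃ Y : Π y : M, TangentSpace I y, MDiffAt (T% Y) x ∧ Y x = a :=
          ⟨FiberBundle.extend E a, FiberBundle.mdifferentiableAt_extend .., by simp⟩
        obtain ⟨Z, hZ, rfl⟩ : ∃ Z : Π y : M, TangentSpace I y, MDiffAt (T% Z) x ∧ Z x = b :=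
          ⟨FiberBundle.extend E b, FiberBundle.mdifferentiableAt_extend .., by simp⟩
        simp only [add_apply]
        rw [covDeriv_apply D hs hY hZ, covDeriv_apply D hh hY hZ, covDeriv_apply D hh' hY hZ]
        simp [mvfderiv_fun_add (mdifferentiableAt_eval hh hY hZ)
          (mdifferentiableAt_eval hh' hY hZ)]
        ring
      leibniz := by
        intro h f x hh hf _
        have hs := hf.smul_section hh
        ext v a b
        obtain ⟨Y, hY, rfl⟩ : ∃ Y : Π y : M, TangentSpace I y, MDiffAt (T% Y) x ∧ Y x = a :=
          ⟨FiberBundle.extend E a, FiberBundle.mdifferentiableAt_extend .., by simp⟩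
        obtain ⟨Z, hZ, rfl⟩ : ∃ Z : Π y : M, TangentSpace I y, MDiffAt (T% Z) x ∧ Z x = b :=
          ⟨FiberBundle.extend E b, FiberBundle.mdifferentiableAt_extend .., by simp⟩
        simp only [add_apply, smul_apply]
        rw [covDeriv_apply D hs hY hZ, covDeriv_apply D hh hY hZ]
        simp [mvfderiv_fun_mul hf (mdifferentiableAt_eval hh hY hZ)]
        ring }

/-! ## Parallel metrics -/

variable (I) in
/-- The bundle of symmetric elements of `T*M ⊗ T*M`. -/
def symTwoTensors (x : M) : Set (TwoTensor I x) :=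
  {h | ∀ a b : TangentSpace I x, h a b = h b a}

/-- The terminal subset `W̃` of the derived flag of the bundle of symmetric two-tensors. -/
def Wtilde (D : CovariantDerivative I E (TangentSpace I : M → Type _)) (x : M) :
    Set (TwoTensor I x) :=
  flagTerminal (inducedConnection D) (symTwoTensors I) x

/-- `g` restricts to a parallel (Riemannian) metric of class `C^n` on the open set `U`. -/
structure IsParallelMetricOn (n : ℕ∞ω) (D : CovariantDerivative I E (TangentSpace I : M → Type _))
    (U : Set M) (g : Π y : M, TwoTensor I y) : Prop where
  contMDiffOn : ContMDiffOn I (I.prod 𝓘(ℝ, E →L[ℝ] E →L[ℝ] ℝ)) n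
    (fun y => TotalSpace.mk' (E →L[ℝ] E →L[ℝ] ℝ) y (g y)) U
  symm : ∀ y ∈ U, g y ∈ symTwoTensors I y
  pos : ∀ y ∈ U, ∀ a : TangentSpace I y, a ≠ 0 → 0 < g y a a
  parallel : ∀ y ∈ U, inducedConnection D g y = 0

/-- A connection on `M` is metric if there is a global parallel metric (of class `C^n`). -/
def IsMetric (n : ℕ∞ω) (D : CovariantDerivative I E (TangentSpace I : M → Type _)) : Prop :=
  ∃ g : Π y : M, TwoTensor I y, IsParallelMetricOn n D Set.univ g

/-- A connection on `M` is locally metric if every point has an open neighbourhood with a parallel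
metric (of class `C^n`). -/
def IsLocallyMetric (n : ℕ∞ω) (D : CovariantDerivative I E (TangentSpace I : M → Type _)) : Prop :=
  ∀ x : M, ∃ U : Set M, IsOpen U ∧ x ∈ U ∧
    ∃ g : Π y : M, TwoTensor I y, IsParallelMetricOn n D U g

end TwoTensors

end MetricConnection

open MetricConnection

namespace MetricConnection

set_option linter.unusedSectionVars false

open Set Filter Topology

/-! ### Analytic solutions of the parallel transport equation along rays. -/

section RadialTransport

/-! Everything except the last globalization happens in a chart. There the induced connection is `d
+ Γ` with `Γ` analytic, and `V⁽⁰⁾` is the common kernel of a set `A` of analytic fields of linear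
forms: constant forms expressing symmetry, and the components of the curvature. Differentiating
these forms with the dual connection adds linear conditions. Let `limitKer` be the common kernel of
the covariant derivatives of all orders. The core of the argument is that `W̃` is `limitKer` read in
the chart (`IsFlagChart.mem_flagTerminal_iff`).

One inclusion uses parallel sections (`IsFlagSystem.exists_parallel`). An element of `limitKer` is
transported along rays, which yields an analytic section `σ`. For each form `L`, all derivatives of
`L(σ)` along a ray vanish at the centre, so `L(σ) = 0` by analyticity, and `σ` stays in `limitKer`.
The curvature therefore kills `σ`, and an ODE argument upgrades radial parallelism to parallelism in
every direction. Such a section survives every step of the flag.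

For the other inclusion, the product rule shows that `V⁽ⁱ⁾` satisfies all conditions of order at
most `i`. The generic dimensions of the successive kernels do not increase and start at most at `dim
F`, so two consecutive ones agree at some order `k ≤ dim F`. There the kernels have stabilized on a
dense set (`IsFlagSystem.exists_dense`). A smooth section satisfying the conditions of order `dim F`
satisfies all of them on that dense set, hence everywhere by continuity. The index `dim F` does not
depend on the point, so the flag stabilizes globally. Parallel extension from a point to nearby
generic points makes the rank locally constant (`IsFlagSystem.finrank_limitKer_eq`); thus `W̃` is an
analytic bundle with local parallel frames.

For the second part, a parallel metric satisfies every differentiated condition and so lies in `W̃`.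
Transition coefficients between parallel frames are locally constant, so the coefficients form a
covering space; over a simply connected base it has a section through any prescribed value
(`exists_global_parallel`). Positivity propagates because parallel transport relates nearby values
of a parallel form by congruence. Finally, positive definite elements form a nonempty open cone in a
fibre of `W̃`, and such a cone contains a basis; its members extend to the required metrics. -/

theorem analyticAt_clm_apply {E F G : Type*} [NormedAddCommGroup E] [NormedSpace ℝ E]
    [NormedAddCommGroup F] [NormedSpace ℝ F] [NormedAddCommGroup G] [NormedSpace ℝ G]
    {f : E → F →L[ℝ] G} {g : E → F} {x : E} (hf : AnalyticAt ℝ f x) (hg : AnalyticAt ℝ g x) :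
    AnalyticAt ℝ (fun y => f y (g y)) x :=
  AnalyticAt.fun_comp (g := fun p : (F →L[ℝ] G) × F => p.1 p.2) (f := fun y => (f y, g y))
    ((ContinuousLinearMap.id ℝ (F →L[ℝ] G)).analyticAt_bilinear (f x, g x)) (hf.prod hg)

variable {E : Type*} [NormedAddCommGroup E] [NormedSpace ℝ E]
  {F : Type*} [NormedAddCommGroup F] [NormedSpace ℝ F]

theorem hasSum_clm_apply {E F : Type*} [NormedAddCommGroup E] [NormedSpace ℝ E]
    [NormedAddCommGroup F] [NormedSpace ℝ F] {f : ℕ → E →L[ℝ] F} {g : E →L[ℝ] F}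
    (h : HasSum f g) (a : E) : HasSum (fun n => f n a) (g a) := by
  have h1 := h.map (ContinuousLinearMap.apply ℝ F a) (ContinuousLinearMap.apply ℝ F a).continuous
  exact h1

/-- The Volterra operator `u ↦ (t ↦ ∫₀ᵗ u)` on `C([0, 1], F)`. -/
noncomputable def volterra (F : Type*) [NormedAddCommGroup F] [NormedSpace ℝ F] :
    C(unitInterval, F) →L[ℝ] C(unitInterval, F) :=
  LinearMap.mkContinuous
    { toFun := fun u =>
        ⟨fun t => ∫ s in (0 : ℝ)..t, u (projIcc 0 1 zero_le_one s),
          (intervalIntegral.continuous_primitive (fun a b => (u.continuous.comp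
            continuous_projIcc).intervalIntegrable a b) 0).comp continuous_subtype_val⟩
      map_add' := fun u v => by
        ext t
        simpa using intervalIntegral.integral_add
          ((u.continuous.comp continuous_projIcc).intervalIntegrable 0 (t : ℝ))
          ((v.continuous.comp continuous_projIcc).intervalIntegrable 0 (t : ℝ))
      map_smul' := fun c u => by
        ext t
        simp }
    1 (fun u => by
      rw [one_mul, ContinuousMap.norm_le _ (norm_nonneg u)]
      intro t
      have h := intervalIntegral.norm_integral_le_of_norm_le_const (a := 0) (b := (t : ℝ))
        (C := ‖u‖) (f := fun s => u (projIcc 0 1 zero_le_one s))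
        (fun s _ => u.norm_coe_le_norm _)
      refine h.trans ?_
      have h1 := t.2.1
      have h2 := t.2.2
      rw [sub_zero, abs_of_nonneg h1]
      exact mul_le_of_le_one_right (norm_nonneg u) h2)

theorem volterra_apply (u : C(unitInterval, F)) (t : unitInterval) :
    volterra F u t = ∫ s in (0 : ℝ)..t, u (projIcc 0 1 zero_le_one s) := rfl

/-- The operator `u ↦ (t ↦ tⁿ A(u(t)))` on `C([0, 1], F)`. -/
noncomputable def powMul (n : ℕ) (A : F →L[ℝ] F) : C(unitInterval, F) →L[ℝ] C(unitInterval, F) :=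
  LinearMap.mkContinuous
    { toFun := fun u => ⟨fun t => (t : ℝ) ^ n • A (u t), by fun_prop⟩
      map_add' := fun u v => by ext t; simp
      map_smul' := fun c u => by ext t; simp [smul_comm c] }
    ‖A‖ (fun u => by
      rw [ContinuousMap.norm_le _ (by positivity)]
      intro t
      have h1 := t.2.1
      have h2 := t.2.2
      have h3 : ‖(t : ℝ) ^ n‖ ≤ 1 := by
        rw [norm_pow, Real.norm_of_nonneg h1]
        exact pow_le_one₀ h1 h2
      calc ‖(t : ℝ) ^ n • A (u t)‖ = ‖(t : ℝ) ^ n‖ * ‖A (u t)‖ := norm_smul _ _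
        _ ≤ 1 * ‖A (u t)‖ := by gcongr
        _ ≤ ‖A‖ * ‖u t‖ := by rw [one_mul]; exact A.le_opNorm _
        _ ≤ ‖A‖ * ‖u‖ := by gcongr; exact u.norm_coe_le_norm _)

theorem norm_powMul_le (n : ℕ) (A : F →L[ℝ] F) : ‖powMul n A‖ ≤ ‖A‖ :=
  LinearMap.mkContinuous_norm_le _ (norm_nonneg _) _

@[simp] theorem powMul_apply (n : ℕ) (A : F →L[ℝ] F) (u : C(unitInterval, F))
    (t : unitInterval) : powMul n A u t = (t : ℝ) ^ n • A (u t) := rfl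

noncomputable instance instNormedAddCommGroupPathOperator :
    NormedAddCommGroup (C(unitInterval, F) →L[ℝ] C(unitInterval, F)) :=
  ContinuousLinearMap.toNormedAddCommGroup

noncomputable instance instNormedSpacePathOperator :
    NormedSpace ℝ (C(unitInterval, F) →L[ℝ] C(unitInterval, F)) :=
  ContinuousLinearMap.toNormedSpace

noncomputable instance instNormedRingPathOperator :
    NormedRing (C(unitInterval, F) →L[ℝ] C(unitInterval, F)) :=
  ContinuousLinearMap.toNormedRing

noncomputable instance instNormedAlgebraPathOperator :
    NormedAlgebra ℝ (C(unitInterval, F) →L[ℝ] C(unitInterval, F)) :=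
  ContinuousLinearMap.toNormedAlgebra

/-- `powMul`, with values in the operators on `C([0, 1], F)`, as a linear map. -/
noncomputable def powMulCLM (F : Type*) [NormedAddCommGroup F] [NormedSpace ℝ F] (n : ℕ) :
    (F →L[ℝ] F) →L[ℝ] (C(unitInterval, F) →L[ℝ] C(unitInterval, F)) :=
  LinearMap.mkContinuous
    { toFun := powMul n
      map_add' := fun A B => by ext u t; simp
      map_smul' := fun c A => by ext u t; simp [smul_comm c] }
    1 (fun A => by rw [one_mul]; exact norm_powMul_le n A)

@[simp] theorem powMulCLM_apply (n : ℕ) (A : F →L[ℝ] F) : powMulCLM F n A = powMul n A := rfl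

theorem norm_powMulCLM_le (n : ℕ) : ‖powMulCLM F n‖ ≤ 1 :=
  LinearMap.mkContinuous_norm_le _ zero_le_one _

/-- Applying contractions to the terms of a power series gives a power series. -/
theorem exists_analyticAt_hasSum_contraction {Z Y : Type*} [NormedAddCommGroup Z]
    [NormedSpace ℝ Z] [NormedAddCommGroup Y] [NormedSpace ℝ Y] [CompleteSpace Y]
    {f : E → Z} {p : FormalMultilinearSeries ℝ E Z} {r : ENNReal}
    (hp : HasFPowerSeriesOnBall f p 0 r) (ι : ℕ → Z →L[ℝ] Y) (hι : ∀ n, ‖ι n‖ ≤ 1) :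
    ∃ N : E → Y, AnalyticAt ℝ N 0 ∧
      ∀ v ∈ Metric.eball (0 : E) r, HasSum (fun n => ι n (p n fun _ => v)) (N v) := by
  let q : FormalMultilinearSeries ℝ E Y := fun n => (ι n).compContinuousMultilinearMap (p n)
  have hle : ∀ n, ‖q n‖ ≤ ‖p n‖ := by
    intro n
    refine ContinuousMultilinearMap.opNorm_le_bound (norm_nonneg _) fun m => ?_
    calc ‖ι n (p n m)‖ ≤ ‖ι n‖ * ‖p n m‖ := (ι n).le_opNorm _
      _ ≤ 1 * ‖p n m‖ := by gcongr; exact hι n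
      _ ≤ ‖p n‖ * ∏ i, ‖m i‖ := by rw [one_mul]; exact (p n).le_opNorm m
  have hrad : r ≤ q.radius := hp.r_le.trans (FormalMultilinearSeries.radius_le_of_le hle)
  have hfp := (q.hasFPowerSeriesOnBall (hp.r_pos.trans_le hrad)).mono hp.r_pos hrad
  refine ⟨q.sum, ⟨q, r, hfp⟩, fun v hv => ?_⟩
  have h1 := hfp.hasSum hv
  rw [zero_add] at h1
  exact h1

/-- The terms of a power series of linear maps, composed with contractions. -/
theorem exists_analyticAt_hasSum_comp {Z W : Type*} [NormedAddCommGroup Z]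
    [NormedSpace ℝ Z] [NormedAddCommGroup W] [NormedSpace ℝ W] [CompleteSpace W]
    {f : E → E →L[ℝ] Z} {p : FormalMultilinearSeries ℝ E (E →L[ℝ] Z)} {r : ENNReal}
    (hp : HasFPowerSeriesOnBall f p 0 r) (ι : ℕ → Z →L[ℝ] W) (hι : ∀ n, ‖ι n‖ ≤ 1) :
    ∃ N : E → E →L[ℝ] W, AnalyticAt ℝ N 0 ∧
      ∀ v ∈ Metric.eball (0 : E) r, ∀ a, HasSum (fun n => ι n (p n (fun _ => v) a)) (N v a) := by
  obtain ⟨N, hN, hsum⟩ := exists_analyticAt_hasSum_contraction hp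
    (fun n => ContinuousLinearMap.compL ℝ E Z W (ι n)) (fun n => by
      refine ContinuousLinearMap.opNorm_le_bound _ zero_le_one fun A => ?_
      exact (ContinuousLinearMap.opNorm_comp_le _ _).trans
        (mul_le_mul_of_nonneg_right (hι n) (norm_nonneg _)))
  exact ⟨N, hN, fun v hv a => by
    have h := hasSum_clm_apply (hsum v hv) a
    exact h⟩

/-- Pointwise multiplication by the restrictions of an analytic function to rays is analytic. -/
theorem exists_analyticAt_rayMul [CompleteSpace F] {G : E → E →L[ℝ] F →L[ℝ] F}
    (hG : AnalyticAt ℝ G 0) :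
    ∃ N : E → E →L[ℝ] (C(unitInterval, F) →L[ℝ] C(unitInterval, F)), AnalyticAt ℝ N 0 ∧
      ∀ᶠ v in 𝓝 (0 : E), ∀ a u t, N v a u t = G ((t : ℝ) • v) a (u t) := by
  obtain ⟨p, r, hp⟩ := hG
  obtain ⟨N, hN, hsum⟩ := exists_analyticAt_hasSum_comp hp (powMulCLM F) norm_powMulCLM_le
  refine ⟨N, hN, ?_⟩
  filter_upwards [Metric.eball_mem_nhds (0 : E) hp.r_pos] with v hv a u t
  have h1b : HasSum (fun n => powMulCLM F n (p n (fun _ => v) a) u) (N v a u) :=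
    hasSum_clm_apply (hsum v hv a) u
  have h2 : HasSum (fun n => powMulCLM F n (p n (fun _ => v) a) u t) (N v a u t) :=
    ContinuousMap.hasSum_apply h1b t
  have hv' : (t : ℝ) • v ∈ Metric.eball (0 : E) r := by
    rw [Metric.mem_eball, edist_zero_right] at hv ⊢
    refine lt_of_le_of_lt ?_ hv
    rw [enorm_smul]
    refine mul_le_of_le_one_left (by positivity) ?_
    rw [← ofReal_norm, Real.norm_of_nonneg t.2.1]
    exact ENNReal.ofReal_le_one.2 t.2.2
  have h3 := hp.hasSum hv'
  rw [zero_add] at h3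
  have h3a : HasSum (fun n => p n (fun _ => (t : ℝ) • v) a) (G ((t : ℝ) • v) a) :=
    hasSum_clm_apply h3 a
  have h4 : HasSum (fun n => p n (fun _ => (t : ℝ) • v) a (u t)) (G ((t : ℝ) • v) a (u t)) :=
    hasSum_clm_apply h3a (u t)
  -- Homogeneity: the `n`-th term of the series at `t • v` is `tⁿ` times the term at `v`. This is
  -- why the `n`-th contraction multiplies by `tⁿ`.
  refine h2.unique (h4.congr_fun fun n => ?_)
  rw [powMulCLM_apply, powMul_apply, (p n).map_smul_univ (fun _ => (t : ℝ)) (fun _ => v)]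
  simp

/-- Radial parallel transport: a connection `d + Γ` that is analytic near `x` has, for each initial
value at `x`, an analytic solution of the radial part of the equation of parallel sections. -/
theorem exists_analyticAt_radial [CompleteSpace F] {Γ : E → E →L[ℝ] F →L[ℝ] F} {x : E}
    (hΓ : AnalyticAt ℝ Γ x) (w : F) :
    ∃ S : E → F, AnalyticAt ℝ S 0 ∧ S 0 = w ∧
      ∀ᶠ v in 𝓝 (0 : E), fderiv ℝ S v v + Γ (x + v) v (S v) = 0 := by
  have hG : AnalyticAt ℝ (fun v => Γ (x + v)) 0 := by
    refine AnalyticAt.fun_comp (g := Γ) (by simpa using hΓ) (by fun_prop)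
  obtain ⟨N, hN, hNe⟩ := exists_analyticAt_rayMul hG
  -- Transport of `w` along the ray of `v` is the integral equation `(1 + K v) u = w` in the space
  -- of paths. Since `K 0 = 0`, the operator is invertible for small `v` with inverse analytic in
  -- `v`, so no separate theorem on analytic dependence of ODE solutions is needed.
  set K : E → C(unitInterval, F) →L[ℝ] C(unitInterval, F) := fun v => (volterra F).comp (N v v)
    with hK
  have hKa : AnalyticAt ℝ K 0 := by
    have h1 : AnalyticAt ℝ (fun v => N v v) 0 := analyticAt_clm_apply hN analyticAt_id
    exact ((ContinuousLinearMap.compL ℝ C(unitInterval, F) C(unitInterval, F) C(unitInterval, F)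
      (volterra F)).analyticAt _).fun_comp h1
  have hK0 : K 0 = 0 := by simp [hK]
  have hia : AnalyticAt ℝ (fun v => Ring.inverse (1 + K v)) 0 := by
    refine AnalyticAt.fun_comp (g := Ring.inverse) ?_ (analyticAt_const.add hKa)
    simpa [hK0] using analyticAt_inverse (𝕜 := ℝ)
      (1 : (C(unitInterval, F) →L[ℝ] C(unitInterval, F))ˣ)
  have hunit : ∀ᶠ v in 𝓝 (0 : E), IsUnit (1 + K v) := by
    have h1 : ContinuousAt (fun v => 1 + K v) 0 := continuousAt_const.add hKa.continuousAt
    have h2 : {a : C(unitInterval, F) →L[ℝ] C(unitInterval, F) | IsUnit a} ∈ 𝓝 (1 + K 0) :=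
      Units.isOpen.mem_nhds (by simp [hK0])
    exact h1 h2
  set u : E → C(unitInterval, F) := fun v =>
    Ring.inverse (1 + K v) (ContinuousMap.const unitInterval w) with hu
  have hua : AnalyticAt ℝ u 0 := analyticAt_clm_apply hia analyticAt_const
  set S : E → F := fun v => u v 1 with hS
  have hSa : AnalyticAt ℝ S 0 :=
    ((ContinuousMap.evalCLM ℝ (1 : unitInterval)).analyticAt _).fun_comp hua
  refine ⟨S, hSa, by simp [hS, hu, hK0], ?_⟩
  obtain ⟨ε, hε, hball⟩ := Metric.eventually_nhds_iff.1
    ((hNe.and hunit).and ((isOpen_analyticAt ℝ S).mem_nhds hSa))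
  have heq : ∀ v, dist v 0 < ε → ∀ t : unitInterval, u v t +
      ∫ s in (0 : ℝ)..t, Γ (x + (projIcc 0 1 zero_le_one s : ℝ) • v) v
        (u v (projIcc 0 1 zero_le_one s)) = w := by
    intro v hv t
    have h1 : (1 + K v) (u v) = ContinuousMap.const unitInterval w := by
      change ((1 + K v) * Ring.inverse (1 + K v)) _ = _
      rw [Ring.mul_inverse_cancel _ (hball hv).1.2]
      rfl
    have h2 := congrArg (fun f : C(unitInterval, F) => f t) h1
    simp only [hK, add_apply, one_apply_eq_self, ContinuousMap.add_apply,
      ContinuousLinearMap.comp_apply, volterra_apply, ContinuousMap.const_apply] at h2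
    rw [← h2]
    congr 1
    refine intervalIntegral.integral_congr fun s _ => ?_
    exact ((hball hv).1.1 v (u v) _).symm
  -- The reparametrized path `s ↦ u v (t * s)` solves the integral equation of `t • v`;
  -- invertibility of `1 + K (t • v)` gives uniqueness. Thus the endpoint map `S` restricted to a
  -- ray is the solution along that ray.
  have hray : ∀ v, dist v 0 < ε → ∀ t : unitInterval, S ((t : ℝ) • v) = u v t := by
    intro v hv t
    have htv : dist ((t : ℝ) • v) 0 < ε := by
      rw [dist_zero_right] at hv ⊢
      rw [norm_smul, Real.norm_of_nonneg t.2.1]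
      exact (mul_le_of_le_one_left (norm_nonneg _) t.2.2).trans_lt hv
    let u' : C(unitInterval, F) := (u v).comp ⟨fun s => t * s, by fun_prop⟩
    have h1 : (1 + K ((t : ℝ) • v)) u' = ContinuousMap.const unitInterval w := by
      ext s
      simp only [hK, add_apply, one_apply_eq_self, ContinuousMap.add_apply,
        ContinuousLinearMap.comp_apply, volterra_apply, ContinuousMap.const_apply]
      rw [← heq v hv (t * s)]
      congr 1
      have h2 := intervalIntegral.smul_integral_comp_mul_left (a := 0) (b := (s : ℝ))
        (fun s => Γ (x + (projIcc (0 : ℝ) 1 zero_le_one s : ℝ) • v) v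
          (u v (projIcc 0 1 zero_le_one s))) (t : ℝ)
      rw [mul_zero] at h2
      rw [show ((t * s : unitInterval) : ℝ) = (t : ℝ) * s from rfl, ← h2,
        ← intervalIntegral.integral_smul]
      refine intervalIntegral.integral_congr fun z hz => ?_
      rw [uIcc_of_le s.2.1] at hz
      have hz1 : z ∈ Icc (0 : ℝ) 1 := ⟨hz.1, hz.2.trans s.2.2⟩
      have hz2 : (t : ℝ) * z ∈ Icc (0 : ℝ) 1 := unitInterval.mul_mem t.2 hz1
      rw [(hball htv).1.1, projIcc_of_mem _ hz1, projIcc_of_mem _ hz2]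
      simp only [map_smul, smul_apply, smul_smul]
      rw [mul_comm z (t : ℝ)]
      rfl
    have h3 : u ((t : ℝ) • v) = u' := by
      change Ring.inverse (1 + K ((t : ℝ) • v)) (ContinuousMap.const unitInterval w) = u'
      rw [← h1]
      change (Ring.inverse (1 + K ((t : ℝ) • v)) * (1 + K ((t : ℝ) • v))) u' = u'
      rw [Ring.inverse_mul_cancel _ (hball htv).1.2]
      rfl
    change u ((t : ℝ) • v) 1 = u v t
    rw [h3]
    change u v (t * 1) = u v t
    rw [mul_one]
  rw [Metric.eventually_nhds_iff]
  -- The ray of `2 • v` is differentiated at `t = 1 / 2`, an interior point of the parameter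
  -- interval, where two-sided derivatives are available. Halving `ε` keeps `2 • v` in the ball.
  refine ⟨ε / 2, by positivity, fun v hv => ?_⟩
  have hv2 : dist ((2 : ℝ) • v) 0 < ε := by
    rw [dist_zero_right] at hv ⊢
    rw [norm_smul, Real.norm_of_nonneg zero_le_two]
    linarith
  have hv1 : dist v 0 < ε := hv.trans (by linarith)
  have hd1 : HasDerivAt (fun t : ℝ => S (t • ((2 : ℝ) • v))) (fderiv ℝ S v ((2 : ℝ) • v))
      (1 / 2 : ℝ) := by
    have h1 : HasFDerivAt S (fderiv ℝ S v) ((1 / 2 : ℝ) • ((2 : ℝ) • v)) := by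
      have : (1 / 2 : ℝ) • ((2 : ℝ) • v) = v := by rw [smul_smul]; norm_num
      rw [this]
      exact (hball hv1).2.differentiableAt.hasFDerivAt
    have h2 : HasDerivAt (fun t : ℝ => t • ((2 : ℝ) • v)) ((2 : ℝ) • v) (1 / 2 : ℝ) := by
      simpa using (hasDerivAt_id (1 / 2 : ℝ)).smul_const ((2 : ℝ) • v)
    exact h1.comp_hasDerivAt _ h2
  set f : ℝ → F := fun s => N ((2 : ℝ) • v) ((2 : ℝ) • v) (u ((2 : ℝ) • v))
    (projIcc 0 1 zero_le_one s) with hf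
  have hfc : Continuous f := (ContinuousMap.continuous _).comp continuous_projIcc
  have hd2 : HasDerivAt (fun t : ℝ => w - ∫ s in (0 : ℝ)..t, f s) (- f (1 / 2)) (1 / 2 : ℝ) := by
    simpa using (hfc.integral_hasStrictDerivAt 0 (1 / 2)).hasDerivAt.const_sub w
  have hd3 : HasDerivAt (fun t : ℝ => S (t • ((2 : ℝ) • v))) (- f (1 / 2)) (1 / 2 : ℝ) := by
    refine hd2.congr_of_eventuallyEq ?_
    filter_upwards [Ioo_mem_nhds (show (0 : ℝ) < 1 / 2 by norm_num)
      (show (1 / 2 : ℝ) < 1 by norm_num)] with t ht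
    rw [hray _ hv2 ⟨t, ht.1.le, ht.2.le⟩, ← heq _ hv2 ⟨t, ht.1.le, ht.2.le⟩, eq_sub_iff_add_eq]
    congr 1
    refine intervalIntegral.integral_congr fun s _ => ?_
    exact (hball hv2).1.1 _ _ _
  have h5 := hd1.unique hd3
  have hhalf : (1 / 2 : ℝ) ∈ Icc (0 : ℝ) 1 := by constructor <;> norm_num
  have h6 : f (1 / 2) = (2 : ℝ) • Γ (x + v) v (S v) := by
    have h7 := hray _ hv2 ⟨1 / 2, hhalf⟩
    have h8 : (1 / 2 : ℝ) • ((2 : ℝ) • v) = v := by rw [smul_smul]; norm_num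
    simp only [h8] at h7
    simp only [hf]
    rw [(hball hv2).1.1, projIcc_of_mem _ hhalf]
    simp only [h8]
    rw [h7]
    simp
  rw [h6, map_smul, ← smul_neg] at h5
  have h9 := smul_right_injective F (two_ne_zero (α := ℝ)) h5
  rw [h9]
  simp

/-- A solution of a linear differential inequality that vanishes initially vanishes. -/
theorem eq_zero_of_hasDerivAt_linear {f : ℝ → F} {A : ℝ → F →L[ℝ] F}
    (hA : ContinuousOn A (Icc 0 1)) (hf : ∀ t ∈ Icc (0 : ℝ) 1, HasDerivAt f (A t (f t)) t)
    (h0 : f 0 = 0) : ∀ t ∈ Icc (0 : ℝ) 1, f t = 0 := by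
  obtain ⟨C, hC⟩ := isCompact_Icc.exists_bound_of_continuousOn hA
  refine eq_zero_of_abs_deriv_le_mul_abs_self_of_eq_zero_right (K := C)
    (f' := fun t => A t (f t)) (fun t ht => (hf t ht).continuousAt.continuousWithinAt)
    (fun t ht => (hf t (Ico_subset_Icc_self ht)).hasDerivWithinAt) h0 fun t ht => ?_
  exact (A t).le_of_opNorm_le (hC t (Ico_subset_Icc_self ht)) _

end RadialTransport

/-! ### Prolongation of linear conditions by covariant differentiation. -/

section LocalTheory

variable {E : Type*} [NormedAddCommGroup E] [NormedSpace ℝ E]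
  {F : Type*} [NormedAddCommGroup F] [NormedSpace ℝ F]

set_option synthInstance.maxHeartbeats 200000 in
theorem analyticAt_clm_comp {E F G H : Type*} [NormedAddCommGroup E] [NormedSpace ℝ E]
    [NormedAddCommGroup F] [NormedSpace ℝ F] [NormedAddCommGroup G] [NormedSpace ℝ G]
    [NormedAddCommGroup H] [NormedSpace ℝ H] {f : E → G →L[ℝ] H} {g : E → F →L[ℝ] G} {x : E}
    (hf : AnalyticAt ℝ f x) (hg : AnalyticAt ℝ g x) :
    AnalyticAt ℝ (fun y => (f y).comp (g y)) x :=
  AnalyticAt.fun_comp (g := fun p : (G →L[ℝ] H) × (F →L[ℝ] G) => p.1.comp p.2)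
    (f := fun y => (f y, g y))
    ((ContinuousLinearMap.compL ℝ F G H).analyticAt_bilinear (f x, g x)) (hf.prod hg)

/-- The covariant derivative in the direction `v`, for the dual of the connection `d + Γ`, of the
field `L` of linear forms. -/
noncomputable def dualDeriv (Γ : E → E →L[ℝ] F →L[ℝ] F) (v : E) (L : E → F →L[ℝ] ℝ) :
    E → F →L[ℝ] ℝ :=
  fun y => fderiv ℝ L y v - (L y).comp (Γ y v)

/-- The covariant derivatives of order at most `k` of the members of the set `A` of fields of
linear forms. -/
def derivLevel (Γ : E → E →L[ℝ] F →L[ℝ] F) (A : Set (E → F →L[ℝ] ℝ)) :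
    ℕ → Set (E → F →L[ℝ] ℝ)
  | 0 => A
  | k + 1 => derivLevel Γ A k ∪ {L | ∃ v, ∃ L' ∈ derivLevel Γ A k, L = dualDeriv Γ v L'}

/-- The common kernel at `y` of a set of fields of linear forms. -/
def commonKer (A : Set (E → F →L[ℝ] ℝ)) (y : E) : Submodule ℝ F where
  carrier := {w | ∀ L ∈ A, L y w = 0}
  add_mem' := fun ha hb L hL => by rw [map_add, ha L hL, hb L hL, add_zero]
  zero_mem' := fun L _ => map_zero _
  smul_mem' := fun c w hw L hL => by rw [map_smul, hw L hL, smul_zero]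

theorem mem_commonKer {A : Set (E → F →L[ℝ] ℝ)} {y : E} {w : F} :
    w ∈ commonKer A y ↔ ∀ L ∈ A, L y w = 0 := Iff.rfl

/-- The curvature of the connection `d + Γ`. -/
noncomputable def coordCurvature (Γ : E → E →L[ℝ] F →L[ℝ] F) (y a b : E) (w : F) : F :=
  fderiv ℝ Γ y a b w - fderiv ℝ Γ y b a w + (Γ y a (Γ y b w) - Γ y b (Γ y a w))

/-- Analytic data on an open connected set: a connection `d + Γ` and a set of fields of linear
forms whose common kernel is killed by the curvature. -/
structure IsFlagSystem (Γ : E → E →L[ℝ] F →L[ℝ] F) (A : Set (E → F →L[ℝ] ℝ)) (B : Set E) :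
    Prop where
  isOpen : IsOpen B
  isPreconnected : IsPreconnected B
  analytic : AnalyticOnNhd ℝ Γ B
  analytic_forms : ∀ L ∈ A, AnalyticOnNhd ℝ L B
  curvature_eq_zero : ∀ y ∈ B, ∀ w ∈ commonKer A y, ∀ a b, coordCurvature Γ y a b w = 0

/-- The common kernel of the members of `A` and of all their covariant derivatives. -/
def limitKer (Γ : E → E →L[ℝ] F →L[ℝ] F) (A : Set (E → F →L[ℝ] ℝ)) (y : E) : Submodule ℝ F :=
  commonKer (⋃ k, derivLevel Γ A k) y

theorem mem_limitKer {Γ : E → E →L[ℝ] F →L[ℝ] F} {A : Set (E → F →L[ℝ] ℝ)} {y : E} {w : F} :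
    w ∈ limitKer Γ A y ↔ ∀ k, w ∈ commonKer (derivLevel Γ A k) y := by
  simp only [limitKer, mem_commonKer, mem_iUnion]
  exact ⟨fun h k L hL => h L ⟨k, hL⟩, fun h L ⟨k, hL⟩ => h k L hL⟩

theorem derivLevel_mono (Γ : E → E →L[ℝ] F →L[ℝ] F) (A : Set (E → F →L[ℝ] ℝ)) :
    Monotone (derivLevel Γ A) :=
  monotone_nat_of_le_succ fun _ => subset_union_left

theorem commonKer_anti {A A' : Set (E → F →L[ℝ] ℝ)} (h : A ⊆ A') (y : E) :
    commonKer A' y ≤ commonKer A y :=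
  fun _ hw L hL => hw L (h hL)

theorem limitKer_le (Γ : E → E →L[ℝ] F →L[ℝ] F) (A : Set (E → F →L[ℝ] ℝ)) (y : E) (k : ℕ) :
    limitKer Γ A y ≤ commonKer (derivLevel Γ A k) y :=
  fun _ hw => mem_limitKer.1 hw k

theorem IsFlagSystem.analytic_derivLevel {Γ : E → E →L[ℝ] F →L[ℝ] F}
    {A : Set (E → F →L[ℝ] ℝ)} {B : Set E} (h : IsFlagSystem Γ A B) (k : ℕ) :
    ∀ L ∈ derivLevel Γ A k, AnalyticOnNhd ℝ L B := by
  induction k with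
  | zero => exact h.analytic_forms
  | succ k ih =>
    rintro L (hL | ⟨v, L', hL', rfl⟩)
    · exact ih L hL
    · intro y hy
      have h1 : AnalyticAt ℝ (fun y => fderiv ℝ L' y v) y :=
        analyticAt_clm_apply ((ih L' hL').fderiv y hy) analyticAt_const
      have h2 : AnalyticAt ℝ (fun y => Γ y v) y :=
        analyticAt_clm_apply (h.analytic y hy) analyticAt_const
      exact h1.sub (analyticAt_clm_comp (ih L' hL' y hy) h2)

/-- The product rule for the pairing of a connection with its dual; the two `Γ`-terms cancel. It
turns conditions on a section and its covariant derivatives into conditions by differentiated forms,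
and conversely. -/
theorem fderiv_form_apply {Γ : E → E →L[ℝ] F →L[ℝ] F} {L : E → F →L[ℝ] ℝ} {σ : E → F} {y : E}
    (hL : DifferentiableAt ℝ L y) (hσ : DifferentiableAt ℝ σ y) (v : E) :
    fderiv ℝ (fun z => L z (σ z)) y v =
      dualDeriv Γ v L y (σ y) + L y (fderiv ℝ σ y v + Γ y v (σ y)) := by
  rw [fderiv_clm_apply hL hσ]
  simp [dualDeriv]
  ring

/-- A section with values in the `k`-th kernel has its value at `y` in the next one if its covariant
derivatives at `y` are in the `k`-th kernel. -/
theorem IsFlagSystem.mem_succ {Γ : E → E →L[ℝ] F →L[ℝ] F} {A : Set (E → F →L[ℝ] ℝ)} {B : Set E}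
    (h : IsFlagSystem Γ A B) {k : ℕ} {y : E} (hy : y ∈ B) {σ : E → F}
    (hσ : DifferentiableAt ℝ σ y) (hmem : ∀ᶠ z in 𝓝 y, σ z ∈ commonKer (derivLevel Γ A k) z)
    (hd : ∀ v, fderiv ℝ σ y v + Γ y v (σ y) ∈ commonKer (derivLevel Γ A k) y) :
    σ y ∈ commonKer (derivLevel Γ A (k + 1)) y := by
  rintro L (hL | ⟨v, L', hL', rfl⟩)
  · exact hmem.self_of_nhds L hL
  · have h1 := fderiv_form_apply (Γ := Γ)
      (h.analytic_derivLevel k L' hL' y hy).differentiableAt hσ v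
    have h2 : (fun z => L' z (σ z)) =ᶠ[𝓝 y] fun _ => 0 := hmem.mono fun z hz => hz L' hL'
    rw [h2.fderiv_eq, hd v L' hL'] at h1
    simpa using h1.symm

theorem analyticAt_det {m : ℕ} {M : E → Matrix (Fin m) (Fin m) ℝ} {y : E}
    (hM : ∀ i j, AnalyticAt ℝ (fun z => M z i j) y) : AnalyticAt ℝ (fun z => (M z).det) y := by
  simp only [Matrix.det_apply']
  exact Finset.analyticAt_fun_sum _ fun s _ => analyticAt_const.mul
    (Finset.analyticAt_fun_prod _ fun i _ => hM _ _)

/-- On a dense open subset, the common kernel of a set of analytic fields of linear forms is cut out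
by finitely many independent members; it has the smallest dimension there. -/
theorem exists_generic [FiniteDimensional ℝ F] {A : Set (E → F →L[ℝ] ℝ)} {B : Set E}
    (hB : IsOpen B) (hBc : IsPreconnected B) (hBn : B.Nonempty)
    (hA : ∀ L ∈ A, AnalyticOnNhd ℝ L B) :
    ∃ (d m : ℕ) (L : Fin m → E → F →L[ℝ] ℝ) (u : Fin m → F) (U : Set E), (∀ i, L i ∈ A) ∧
      IsOpen U ∧ U ⊆ B ∧ B ⊆ closure U ∧
      (∀ y ∈ U, (Matrix.of fun i j => L i y (u j)).det ≠ 0 ∧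
        commonKer A y = commonKer (range L) y ∧ Module.finrank ℝ (commonKer A y) = d) ∧
      ∀ y ∈ B, d ≤ Module.finrank ℝ (commonKer A y) := by
  obtain ⟨y₀, hy₀, hmin⟩ : ∃ y₀ ∈ B, ∀ y ∈ B,
      Module.finrank ℝ (commonKer A y₀) ≤ Module.finrank ℝ (commonKer A y) := by
    obtain ⟨y₀, hy₀⟩ := exists_minimalFor_of_wellFoundedLT (fun y => y ∈ B)
      (fun y => Module.finrank ℝ (commonKer A y)) hBn
    refine ⟨y₀, hy₀.1, fun y hy => ?_⟩
    rcases le_total (Module.finrank ℝ (commonKer A y₀)) (Module.finrank ℝ (commonKer A y))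
      with h | h
    · exact h
    · exact hy₀.2 hy h
  -- a maximal independent family of values at `y₀`
  obtain ⟨m, L, hLA, hLi, hLs⟩ : ∃ (m : ℕ) (L : Fin m → E → F →L[ℝ] ℝ), (∀ i, L i ∈ A) ∧
      LinearIndependent ℝ (fun i => L i y₀) ∧
      ∀ L' ∈ A, L' y₀ ∈ Submodule.span ℝ (range fun i => L i y₀) := by
    obtain ⟨b, hb, hbs, hbi⟩ := exists_linearIndependent ℝ ((fun L : E → F →L[ℝ] ℝ => L y₀) '' A)
    have : Finite b := hbi.finite
    obtain ⟨m, ⟨e⟩⟩ := Finite.exists_equiv_fin b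
    choose L hLA hLe using fun i : Fin m => hb (e.symm i).2
    refine ⟨m, L, hLA, ?_, fun L' hL' => ?_⟩
    · have : (fun i => L i y₀) = (fun i : b => (i : F →L[ℝ] ℝ)) ∘ e.symm := funext hLe
      rw [this]
      exact hbi.comp _ e.symm.injective
    · have h1 : (range fun i => L i y₀) = b := by
        have : (fun i => L i y₀) = (fun i : b => (i : F →L[ℝ] ℝ)) ∘ e.symm := funext hLe
        rw [this, e.symm.surjective.range_comp, Subtype.range_coe]
      rw [h1, hbs]
      exact Submodule.subset_span ⟨L', hL', rfl⟩
  have hfin : ∀ y, LinearIndependent ℝ (fun i => L i y) →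
      Module.finrank ℝ (commonKer (range L) y) + m = Module.finrank ℝ F := by
    intro y hi
    let T : F →ₗ[ℝ] (Fin m → ℝ) := LinearMap.pi fun i => (L i y : F →ₗ[ℝ] ℝ)
    have hker : commonKer (range L) y = LinearMap.ker T := by
      ext w
      simp only [mem_commonKer, forall_mem_range, LinearMap.mem_ker]
      exact ⟨fun h => funext h, fun h i => congrFun h i⟩
    have hsurj : Function.Surjective T := by
      rw [← LinearMap.range_eq_top]
      by_contra hne
      obtain ⟨f, hf, hf0⟩ := Submodule.exists_le_ker_of_lt_top _ (lt_top_iff_ne_top.2 hne)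
      apply hf
      have h1 : ∑ i, f (Pi.single i 1) • L i y = 0 := by
        ext w
        have h2 : f (T w) = 0 := hf0 ⟨w, rfl⟩
        have h3 := LinearMap.pi_apply_eq_sum_univ f (T w)
        rw [h2] at h3
        simp only [sum_apply, smul_apply, smul_eq_mul, zero_apply]
        rw [h3]
        refine Finset.sum_congr rfl fun i _ => ?_
        rw [smul_eq_mul, mul_comm]
        have h4 : (fun j => if i = j then (1 : ℝ) else 0) = Pi.single i 1 := by
          ext j
          simp [Pi.single_apply, eq_comm]
        rw [h4]
        rfl
      have h4 := Fintype.linearIndependent_iff.1 hi _ h1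
      refine LinearMap.pi_ext' fun i => LinearMap.ext_ring ?_
      simpa using h4 i
    have h5 := T.finrank_range_add_finrank_ker
    rw [LinearMap.range_eq_top.2 hsurj, finrank_top, Module.finrank_fin_fun] at h5
    rw [hker]
    omega
  -- dual vectors
  obtain ⟨u, hu⟩ : ∃ u : Fin m → F, ∀ i j, L i y₀ (u j) = if i = j then 1 else 0 := by
    let T : F →ₗ[ℝ] (Fin m → ℝ) := LinearMap.pi fun i => (L i y₀ : F →ₗ[ℝ] ℝ)
    have hker : commonKer (range L) y₀ = LinearMap.ker T := by
      ext w
      simp only [mem_commonKer, forall_mem_range, LinearMap.mem_ker]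
      exact ⟨fun h => funext h, fun h i => congrFun h i⟩
    have hsurj : Function.Surjective T := by
      rw [← LinearMap.range_eq_top]
      apply Submodule.eq_top_of_finrank_eq
      have h5 := T.finrank_range_add_finrank_ker
      have h6 := hfin y₀ hLi
      rw [hker] at h6
      rw [Module.finrank_fin_fun]
      omega
    choose u hu using fun j : Fin m => hsurj (Pi.single j 1)
    refine ⟨u, fun i j => ?_⟩
    have := congrFun (hu j) i
    rw [Pi.single_apply] at this
    exact this
  -- This minor equals `1` at `y₀`, so by the identity theorem on the connected set `B` it vanishes
  -- on no nonempty open subset. Where it is nonzero, the chosen forms have kernel of the minimal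
  -- dimension, which leaves no room between it and `commonKer A y`.
  set f : E → ℝ := fun y => (Matrix.of fun i j => L i y (u j)).det with hf
  have hfa : AnalyticOnNhd ℝ f B := fun y hy => analyticAt_det fun i j =>
    analyticAt_clm_apply (hA _ (hLA i) y hy) analyticAt_const
  have hf0 : f y₀ = 1 := by
    have : (Matrix.of fun i j => L i y₀ (u j)) = 1 := by
      ext i j
      simp [hu, Matrix.one_apply]
    simp [hf, this]
  have hindep : ∀ y, f y ≠ 0 → LinearIndependent ℝ (fun i => L i y) := by
    intro y hy
    have h1 : LinearIndependent ℝ (fun i => (Matrix.of fun i j => L i y (u j)).row i) :=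
      Matrix.linearIndependent_rows_of_isUnit
        ((Matrix.isUnit_iff_isUnit_det _).2 (isUnit_iff_ne_zero.2 hy))
    let ev : (F →L[ℝ] ℝ) →ₗ[ℝ] (Fin m → ℝ) :=
      { toFun := fun l j => l (u j)
        map_add' := fun _ _ => rfl
        map_smul' := fun _ _ => rfl }
    exact LinearIndependent.of_comp ev h1
  have hle : ∀ y, commonKer A y ≤ commonKer (range L) y := fun y => commonKer_anti
    (range_subset_iff.2 hLA) y
  have hy₀k : commonKer A y₀ = commonKer (range L) y₀ := by
    refine le_antisymm (hle y₀) fun w hw L' hL' => ?_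
    have h1 : Submodule.span ℝ (range fun i => L i y₀) ≤
        LinearMap.ker (ContinuousLinearMap.apply ℝ ℝ w : (F →L[ℝ] ℝ) →ₗ[ℝ] ℝ) := by
      rw [Submodule.span_le]
      rintro _ ⟨i, rfl⟩
      exact hw (L i) ⟨i, rfl⟩
    exact h1 (hLs L' hL')
  refine ⟨Module.finrank ℝ (commonKer A y₀), m, L, u, B ∩ {y | f y ≠ 0}, hLA, ?_,
    inter_subset_left, ?_, ?_, hmin⟩
  · exact hfa.continuousOn.isOpen_inter_preimage hB isOpen_compl_singleton
  · intro y hy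
    by_contra hcl
    rw [mem_closure_iff_frequently, not_frequently] at hcl
    have h1 : f =ᶠ[𝓝 y] 0 := by
      filter_upwards [hcl, hB.mem_nhds hy] with z hz hzB
      by_contra h
      exact hz ⟨hzB, h⟩
    have h2 := hfa.eqOn_zero_of_preconnected_of_eventuallyEq_zero hBc hy h1 hy₀
    rw [hf0] at h2
    exact one_ne_zero h2
  · rintro y ⟨hy, hfy⟩
    have h1 := hfin y (hindep y hfy)
    have h2 := hfin y₀ hLi
    rw [← hy₀k] at h2
    have h3 : Module.finrank ℝ (commonKer (range L) y) =
      Module.finrank ℝ (commonKer A y₀) := by omega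
    have h4 : commonKer A y = commonKer (range L) y :=
      Submodule.eq_of_le_of_finrank_le (hle y) (by rw [h3]; exact hmin y hy)
    exact ⟨hfy, h4, by rw [h4, h3]⟩

theorem subset_closure_inter {X : Type*} [TopologicalSpace X] {B U U' : Set X} (hU : IsOpen U)
    (hUB : U ⊆ B) (h : B ⊆ closure U) (h' : B ⊆ closure U') : B ⊆ closure (U ∩ U') := by
  refine h.trans (closure_minimal ?_ isClosed_closure)
  intro y hy
  exact hU.inter_closure ⟨hy, h' (hUB hy)⟩

/-- On an open set where the `k`-th kernel is cut out by independent analytic forms, and agrees with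
the next one, it agrees with the limit. -/
theorem IsFlagSystem.commonKer_eq_limitKer {Γ : E → E →L[ℝ] F →L[ℝ] F}
    {A : Set (E → F →L[ℝ] ℝ)} {B : Set E} (h : IsFlagSystem Γ A B) {k m : ℕ}
    {L : Fin m → E → F →L[ℝ] ℝ} {u : Fin m → F} {U : Set E} (hL : ∀ i, L i ∈ derivLevel Γ A k)
    (hU : IsOpen U) (hUB : U ⊆ B)
    (hdet : ∀ y ∈ U, (Matrix.of fun i j => L i y (u j)).det ≠ 0)
    (hker : ∀ y ∈ U, commonKer (derivLevel Γ A k) y = commonKer (range L) y)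
    (hstab : ∀ y ∈ U, commonKer (derivLevel Γ A k) y = commonKer (derivLevel Γ A (k + 1)) y) :
    ∀ y ∈ U, commonKer (derivLevel Γ A k) y = limitKer Γ A y := by
  suffices hj : ∀ j, ∀ y ∈ U, commonKer (derivLevel Γ A k) y ≤ commonKer (derivLevel Γ A j) y from
    fun y hy => le_antisymm (fun w hw => mem_limitKer.2 fun j => hj j y hy hw)
      (limitKer_le Γ A y k)
  intro j
  rcases le_or_gt j k with hjk | hjk
  · exact fun y _ => commonKer_anti (derivLevel_mono Γ A hjk) y
  induction j, hjk using Nat.le_induction with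
  | base => exact fun y hy => (hstab y hy).le
  | succ j hj ih =>
    intro y hy w hw
    -- The vector `w` is extended to a section of the `k`-th kernel by subtracting a correction in
    -- the span of the `u j`. Cramer's rule multiplied through by the determinant keeps the
    -- coefficients polynomial in analytic functions; the price is the value `det • w` at `y`,
    -- harmless since the determinant is nonzero there.
    set M : E → Matrix (Fin m) (Fin m) ℝ := fun z => Matrix.of fun i j => L i z (u j) with hM
    set c : E → Fin m → ℝ := fun z => Matrix.cramer (M z) (fun i => L i z w) with hc
    set σ : E → F := fun z => (M z).det • w - ∑ j, c z j • u j with hσ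
    have hLa : ∀ i (x : F), AnalyticAt ℝ (fun z => L i z x) y := fun i x =>
      analyticAt_clm_apply (h.analytic_derivLevel k _ (hL i) y (hUB hy)) analyticAt_const
    have hca : ∀ j, AnalyticAt ℝ (fun z => c z j) y := by
      intro j
      simp only [hc, Matrix.cramer_apply]
      refine analyticAt_det fun i l => ?_
      rcases eq_or_ne l j with rfl | hlj
      · simpa [Matrix.updateCol_apply] using hLa i w
      · simpa [Matrix.updateCol_apply, hlj, hM] using hLa i (u l)
    have hσa : AnalyticAt ℝ σ y :=
      ((analyticAt_det fun i l => hLa i (u l)).smul analyticAt_const).sub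
        (Finset.analyticAt_fun_sum _ fun l _ => (hca l).smul analyticAt_const)
    have hσk : ∀ z, σ z ∈ commonKer (range L) z := by
      rintro z _ ⟨i, rfl⟩
      have h1 := congrFun (Matrix.mulVec_cramer (M z) (fun i => L i z w)) i
      simp only [Matrix.mulVec, dotProduct, hM, Matrix.of_apply, Pi.smul_apply,
        smul_eq_mul] at h1
      simp only [hσ, map_sub, map_smul, map_sum, smul_eq_mul]
      rw [← h1, sub_eq_zero]
      exact Finset.sum_congr rfl fun l _ => mul_comm _ _
    have hσU : ∀ᶠ z in 𝓝 y, σ z ∈ commonKer (derivLevel Γ A k) z := by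
      filter_upwards [hU.mem_nhds hy] with z hz
      rw [hker z hz]
      exact hσk z
    have hσy : σ y = (M y).det • w := by
      have h1 : (fun i => L i y w) = 0 := funext fun i => hw _ (hL i)
      simp [hσ, hc, h1]
    -- Equality of the kernels of orders `k` and `k + 1` means that covariant differentiation
    -- preserves sections of the `k`-th kernel.
    have hcov : ∀ v, fderiv ℝ σ y v + Γ y v (σ y) ∈ commonKer (derivLevel Γ A k) y := by
      intro v L' hL'
      have h1 := fderiv_form_apply (Γ := Γ)
        (h.analytic_derivLevel k L' hL' y (hUB hy)).differentiableAt hσa.differentiableAt v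
      have h2 : (fun z => L' z (σ z)) =ᶠ[𝓝 y] fun _ => 0 := hσU.mono fun z hz => hz L' hL'
      have h3 : σ y ∈ commonKer (derivLevel Γ A (k + 1)) y := by
        rw [← hstab y hy]
        exact hσU.self_of_nhds
      rw [h2.fderiv_eq, h3 _ (Or.inr ⟨v, L', hL', rfl⟩)] at h1
      simpa using h1.symm
    have h4 := h.mem_succ (hUB hy) hσa.differentiableAt
      (k := j) ((hU.eventually_mem hy).and hσU |>.mono fun z hz => ih z hz.1 hz.2)
      (fun v => ih y hy (hcov v))
    rw [hσy] at h4
    exact (Submodule.smul_mem_iff _ (hdet y hy)).1 h4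

end LocalTheory

/-! ### Stabilization on a dense set, and parallel sections through the limit kernel. -/

section LocalTheory

variable {E : Type*} [NormedAddCommGroup E] [NormedSpace ℝ E]
  {F : Type*} [NormedAddCommGroup F] [NormedSpace ℝ F]

/-- Uniformly in the data: at almost all points, the limit kernel is the kernel of level `dim F`. -/
theorem IsFlagSystem.exists_dense [FiniteDimensional ℝ F] {Γ : E → E →L[ℝ] F →L[ℝ] F}
    {A : Set (E → F →L[ℝ] ℝ)} {B : Set E} (h : IsFlagSystem Γ A B) (hB : B.Nonempty) :
    ∃ U : Set E, U ⊆ B ∧ B ⊆ closure U ∧ ∀ y ∈ U,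
      commonKer (derivLevel Γ A (Module.finrank ℝ F)) y = limitKer Γ A y := by
  choose d m L u U hL hU hUB hBU hUd hd using fun k =>
    exists_generic h.isOpen h.isPreconnected hB (h.analytic_derivLevel k)
  have hne : ∀ k, (U k).Nonempty := fun k => by
    rw [← closure_nonempty_iff]
    exact hB.mono (hBU k)
  have hanti : ∀ k, d (k + 1) ≤ d k := by
    intro k
    obtain ⟨y, hy⟩ := hne k
    rw [← (hUd k y hy).2.2]
    exact (hd (k + 1) y (hUB k hy)).trans
      (Submodule.finrank_mono (commonKer_anti (derivLevel_mono Γ A k.le_succ) y))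
  -- A strict drop at every `k ≤ dim F` would give `d k + k ≤ dim F` up to `k = dim F + 1`, which is
  -- impossible.
  obtain ⟨k, hk, hdk⟩ : ∃ k ≤ Module.finrank ℝ F, d k = d (k + 1) := by
    by_contra! hcon
    have h1 : ∀ k ≤ Module.finrank ℝ F + 1, d k + k ≤ Module.finrank ℝ F := by
      intro k
      induction k with
      | zero =>
        intro _
        obtain ⟨y, hy⟩ := hne 0
        rw [add_zero, ← (hUd 0 y hy).2.2]
        exact Submodule.finrank_le _
      | succ k ih =>
        intro hk
        have h2 := ih (by omega)
        have h3 := hcon k (by omega)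
        have h4 := hanti k
        omega
    have := h1 _ le_rfl
    omega
  refine ⟨U k ∩ U (k + 1), inter_subset_left.trans (hUB k),
    subset_closure_inter (hU k) (hUB k) (hBU k) (hBU (k + 1)), fun y hy => ?_⟩
  have h1 := h.commonKer_eq_limitKer (k := k) (hL k) ((hU k).inter (hU (k + 1)))
    (inter_subset_left.trans (hUB k)) (fun y hy => (hUd k y hy.1).1)
    (fun y hy => (hUd k y hy.1).2.1) (fun y hy =>
      (Submodule.eq_of_le_of_finrank_eq (commonKer_anti (derivLevel_mono Γ A k.le_succ) y)
        (by rw [(hUd k y hy.1).2.2, (hUd (k + 1) y hy.2).2.2, hdk])).symm) y hy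
  refine le_antisymm ?_ (limitKer_le Γ A y _)
  rw [← h1]
  exact commonKer_anti (derivLevel_mono Γ A hk) y

theorem IsFlagSystem.analytic_iUnion {Γ : E → E →L[ℝ] F →L[ℝ] F}
    {A : Set (E → F →L[ℝ] ℝ)} {B : Set E} (h : IsFlagSystem Γ A B) :
    ∀ L ∈ ⋃ k, derivLevel Γ A k, AnalyticOnNhd ℝ L B := by
  intro L hL
  obtain ⟨k, hk⟩ := mem_iUnion.1 hL
  exact h.analytic_derivLevel k L hk

/-- Finitely many conditions imply all of them on a dense set; each pairing `L z (σ z)` is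
continuous at `y`, so a nonzero value there would persist nearby and meet the dense set. This fails
for a single vector: the section through it is essential. -/
theorem IsFlagSystem.mem_limitKer_of_continuousAt [FiniteDimensional ℝ F]
    {Γ : E → E →L[ℝ] F →L[ℝ] F} {A : Set (E → F →L[ℝ] ℝ)} {B : Set E} (h : IsFlagSystem Γ A B)
    {y : E} (hy : y ∈ B) {σ : E → F} (hσ : ContinuousAt σ y)
    (hmem : ∀ᶠ z in 𝓝 y, σ z ∈ commonKer (derivLevel Γ A (Module.finrank ℝ F)) z) :
    σ y ∈ limitKer Γ A y := by
  obtain ⟨U, -, hBU, hUk⟩ := h.exists_dense ⟨y, hy⟩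
  intro L hL
  by_contra hne
  have hc : ContinuousAt (fun z => L z (σ z)) y :=
    (h.analytic_iUnion L hL y hy).continuousAt.clm_apply hσ
  have h1 := (hc.eventually_ne hne).and hmem
  obtain ⟨z, hzU, hz, hzk⟩ := ((mem_closure_iff_frequently.1 (hBU hy)).and_eventually h1).exists
  rw [hUk z hzU] at hzk
  exact hz (hzk L hL)

/-- The covariant derivative of `σ` for the connection `d + Γ`. -/
noncomputable def covD (Γ : E → E →L[ℝ] F →L[ℝ] F) (σ : E → F) (y u : E) : F :=
  fderiv ℝ σ y u + Γ y u (σ y)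

/-- The direction field is allowed to vary because the formula is needed for constant fields, for
the radial field `z - y`, and for the fields extending tangent vectors in the definition of the
curvature. -/
theorem hasFDerivAt_covD {Γ : E → E →L[ℝ] F →L[ℝ] F} {σ : E → F} {y : E}
    (hΓ : DifferentiableAt ℝ Γ y) (hσ : ContDiffAt ℝ 2 σ y) {X : E → E}
    (hX : DifferentiableAt ℝ X y) :
    DifferentiableAt ℝ (fun z => covD Γ σ z (X z)) y ∧
    ∀ v, fderiv ℝ (fun z => covD Γ σ z (X z)) y v =
      fderiv ℝ (fderiv ℝ σ) y v (X y) + fderiv ℝ Γ y v (X y) (σ y)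
        + Γ y (X y) (fderiv ℝ σ y v) + covD Γ σ y (fderiv ℝ X y v) := by
  have hσ1 : DifferentiableAt ℝ σ y := hσ.differentiableAt two_ne_zero
  have hσ2 : DifferentiableAt ℝ (fderiv ℝ σ) y :=
    (hσ.fderiv_right (m := 1) (by norm_num)).differentiableAt one_ne_zero
  have h1 := hσ2.hasFDerivAt.clm_apply hX.hasFDerivAt
  have h2 := (hΓ.hasFDerivAt.clm_apply hX.hasFDerivAt).clm_apply hσ1.hasFDerivAt
  have h3 := h1.add h2
  refine ⟨h3.differentiableAt, fun v => ?_⟩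
  have h4 : fderiv ℝ (fun z => covD Γ σ z (X z)) y = _ := h3.fderiv
  rw [h4]
  simp [covD]
  abel

/-- The Ricci identity in coordinates. The outer derivatives are ordinary ones, which accounts for
the two `Γ`-terms beside the curvature; second derivatives of `σ` cancel by symmetry. -/
theorem covD_comm {Γ : E → E →L[ℝ] F →L[ℝ] F} {σ : E → F} {y : E}
    (hΓ : DifferentiableAt ℝ Γ y) (hσ : ContDiffAt ℝ 2 σ y) (u v : E) :
    fderiv ℝ (fun z => covD Γ σ z u) y v - fderiv ℝ (fun z => covD Γ σ z v) y u =
      coordCurvature Γ y v u (σ y) + (Γ y u (covD Γ σ y v) - Γ y v (covD Γ σ y u)) := by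
  have hs : fderiv ℝ (fderiv ℝ σ) y v u = fderiv ℝ (fderiv ℝ σ) y u v :=
    (hσ.isSymmSndFDerivAt (by simp)) v u
  rw [(hasFDerivAt_covD hΓ hσ (differentiableAt_const u)).2,
    (hasFDerivAt_covD hΓ hσ (differentiableAt_const v)).2, hs]
  simp [covD, coordCurvature]
  abel

/-- Parallel sections are killed by the curvature. -/
theorem coordCurvature_eq_zero {Γ : E → E →L[ℝ] F →L[ℝ] F} {σ : E → F} {y : E}
    (hΓ : DifferentiableAt ℝ Γ y) (hσ : ContDiffAt ℝ 2 σ y)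
    (hp : ∀ᶠ z in 𝓝 y, ∀ u, covD Γ σ z u = 0) (u v : E) : coordCurvature Γ y u v (σ y) = 0 := by
  have h1 := covD_comm hΓ hσ v u
  have h2 : ∀ u, (fun z => covD Γ σ z u) =ᶠ[𝓝 y] fun _ => 0 := fun u => hp.mono fun z hz => hz u
  rw [(h2 v).fderiv_eq, (h2 u).fderiv_eq, hp.self_of_nhds, hp.self_of_nhds] at h1
  simpa using h1.symm

/-- A parallel section with values in the common kernel has values in the limit kernel. -/
theorem IsFlagSystem.mem_limitKer_of_parallel {Γ : E → E →L[ℝ] F →L[ℝ] F}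
    {A : Set (E → F →L[ℝ] ℝ)} {B : Set E} (h : IsFlagSystem Γ A B) {y : E} (hy : y ∈ B)
    {σ : E → F} (hσ : ∀ᶠ z in 𝓝 y, DifferentiableAt ℝ σ z)
    (hp : ∀ᶠ z in 𝓝 y, ∀ u, covD Γ σ z u = 0) (hA : ∀ᶠ z in 𝓝 y, σ z ∈ commonKer A z) :
    σ y ∈ limitKer Γ A y := by
  have h1 : ∀ k, ∀ᶠ z in 𝓝 y, σ z ∈ commonKer (derivLevel Γ A k) z := by
    intro k
    induction k with
    | zero => exact hA
    | succ k ih =>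
      filter_upwards [ih.eventually_nhds, hσ, hp, h.isOpen.mem_nhds hy] with z h1 h2 h3 h4
      refine h.mem_succ h4 h2 h1 fun v => ?_
      have := h3 v
      rw [covD] at this
      rw [this]
      exact Submodule.zero_mem _
  exact mem_limitKer.2 fun k => (h1 k).self_of_nhds

/-- A parallel section vanishing at a point vanishes nearby. -/
theorem eventually_eq_zero_of_parallel {Γ : E → E →L[ℝ] F →L[ℝ] F} {σ : E → F} {y : E}
    (hΓ : ∀ᶠ z in 𝓝 y, ContinuousAt Γ z) (hσ : ∀ᶠ z in 𝓝 y, DifferentiableAt ℝ σ z)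
    (hp : ∀ᶠ z in 𝓝 y, ∀ u, covD Γ σ z u = 0) (h0 : σ y = 0) : ∀ᶠ z in 𝓝 y, σ z = 0 := by
  obtain ⟨ε, hε, hball⟩ := Metric.eventually_nhds_iff.1 (hΓ.and (hσ.and hp))
  rw [Metric.eventually_nhds_iff]
  refine ⟨ε, hε, fun z hz => ?_⟩
  set v := z - y with hv
  have hmem : ∀ t ∈ Icc (0 : ℝ) 1, dist (y + t • v) y < ε := by
    intro t ht
    rw [dist_eq_norm, add_sub_cancel_left, norm_smul, Real.norm_of_nonneg ht.1]
    rw [dist_eq_norm] at hz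
    exact (mul_le_of_le_one_left (norm_nonneg _) ht.2).trans_lt hz
  have hline : ∀ t : ℝ, HasDerivAt (fun t : ℝ => y + t • v) v t := fun t => by
    simpa using ((hasDerivAt_id t).smul_const v).const_add y
  have h1 := eq_zero_of_hasDerivAt_linear (f := fun t : ℝ => σ (y + t • v))
    (A := fun t : ℝ => -(Γ (y + t • v) v)) ?_ ?_ (by simpa using h0) 1 ⟨zero_le_one, le_rfl⟩
  · simpa [hv] using h1
  · intro t ht
    have h2 : ContinuousAt (fun t : ℝ => Γ (y + t • v)) t :=
      ContinuousAt.comp' (hball (hmem t ht)).1 (hline t).continuousAt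
    exact (h2.clm_apply continuousAt_const).neg.continuousWithinAt
  · intro t ht
    have h2 := (hball (hmem t ht)).2.1.hasFDerivAt.comp_hasDerivAt t (hline t)
    have h3 := (hball (hmem t ht)).2.2 v
    rw [covD, add_eq_zero_iff_eq_neg] at h3
    rw [h3] at h2
    exact h2

/-- A radially parallel section is parallel along the rays, the center included. -/
theorem covD_eq_zero_of_radial {Γ : E → E →L[ℝ] F →L[ℝ] F} {σ : E → F} {y : E}
    (hΓ : ContinuousAt Γ y) (hσ : ContinuousAt (fderiv ℝ σ) y) (hσ' : ContinuousAt σ y)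
    (hrad : ∀ᶠ z in 𝓝 y, covD Γ σ z (z - y) = 0) (v : E) : covD Γ σ y v = 0 := by
  by_contra hne
  have hline : ContinuousAt (fun t : ℝ => y + t • v) 0 := by fun_prop
  have h0 : y + (0 : ℝ) • v = y := by simp
  have hc : ContinuousAt (fun z => covD Γ σ z v) y :=
    (hσ.clm_apply continuousAt_const).add ((hΓ.clm_apply continuousAt_const).clm_apply hσ')
  have h1 := (hc.eventually_ne hne).and hrad
  rw [← h0] at h1
  have h2 := hline.eventually h1
  obtain ⟨t, ⟨ht, ht'⟩, ht0⟩ := ((h2.filter_mono nhdsWithin_le_nhds).and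
    (self_mem_nhdsWithin : ∀ᶠ t in 𝓝[≠] (0 : ℝ), t ≠ 0)).exists
  apply ht
  rw [h0, add_sub_cancel_left] at ht'
  simp only [covD, map_smul, smul_apply, ← smul_add] at ht' ⊢
  exact (smul_eq_zero.1 ht').resolve_left ht0

/-- Through each element of the limit kernel there is an analytic parallel section with values in
the limit kernel. -/
theorem IsFlagSystem.exists_parallel [CompleteSpace F] {Γ : E → E →L[ℝ] F →L[ℝ] F}
    {A : Set (E → F →L[ℝ] ℝ)} {B : Set E} (h : IsFlagSystem Γ A B) {y : E} (hy : y ∈ B) {w : F}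
    (hw : w ∈ limitKer Γ A y) :
    ∃ σ : E → F, σ y = w ∧ ∀ᶠ z in 𝓝 y, AnalyticAt ℝ σ z ∧ (∀ u, covD Γ σ z u = 0) ∧
      σ z ∈ limitKer Γ A z := by
  obtain ⟨S, hS, hS0, hSr⟩ := exists_analyticAt_radial (h.analytic y hy) w
  set σ : E → F := fun z => S (z - y) with hσdef
  have hsub : ContinuousAt (fun z : E => z - y) y := by fun_prop
  have hσy : AnalyticAt ℝ σ y :=
    AnalyticAt.fun_comp (g := S) (by simpa using hS) (by fun_prop)
  have hrad : ∀ᶠ z in 𝓝 y, covD Γ σ z (z - y) = 0 := by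
    have h1 : Tendsto (fun z : E => z - y) (𝓝 y) (𝓝 0) := by simpa using hsub.tendsto
    filter_upwards [h1.eventually hSr, h1.eventually (hS.eventually_analyticAt)] with z hz hz'
    have h2 : fderiv ℝ σ z = fderiv ℝ S (z - y) := fderiv_comp_sub y
    rw [covD, h2]
    simpa using hz
  refine ⟨σ, by simp [hσdef, hS0], ?_⟩
  obtain ⟨ε, hε, hball⟩ := Metric.eventually_nhds_iff.1
    ((hrad.and hσy.eventually_analyticAt).and (h.isOpen.mem_nhds hy))
  have hmem : ∀ z, dist z y < ε → ∀ t ∈ Icc (0 : ℝ) 1, dist (y + t • (z - y)) y < ε := by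
    intro z hz t ht
    rw [dist_eq_norm, add_sub_cancel_left, norm_smul, Real.norm_of_nonneg ht.1]
    rw [dist_eq_norm] at hz
    exact (mul_le_of_le_one_left (norm_nonneg _) ht.2).trans_lt hz
  have hline : ∀ v : E, ∀ t : ℝ, HasDerivAt (fun t : ℝ => y + t • v) v t := fun v t => by
    simpa using ((hasDerivAt_id t).smul_const v).const_add y
  -- the covariant derivative in the radial direction vanishes along the rays
  have hray : ∀ v : E, ∀ t : ℝ, dist (y + t • v) y < ε → covD Γ σ (y + t • v) v = 0 := by
    intro v t ht
    rcases eq_or_ne t 0 with rfl | ht0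
    · rw [zero_smul, add_zero]
      exact covD_eq_zero_of_radial (h.analytic y hy).continuousAt hσy.fderiv.continuousAt
        hσy.continuousAt hrad v
    · have h1 := (hball ht).1.1
      rw [add_sub_cancel_left] at h1
      simp only [covD, map_smul, smul_apply, ← smul_add] at h1 ⊢
      exact (smul_eq_zero.1 h1).resolve_left ht0
  -- the section is in the limit kernel
  have hlim : ∀ z, dist z y < ε → σ z ∈ limitKer Γ A z := by
    intro z hz
    set v := z - y with hv
    set T : Set ℝ := {t | dist (y + t • v) y < ε} with hT
    have hTball : T = (fun t : ℝ => y + t • v) ⁻¹' Metric.ball y ε := rfl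
    have hTo : IsOpen T := by
      rw [hTball]
      exact Metric.isOpen_ball.preimage (by fun_prop)
    have hTc : IsPreconnected T := by
      have h1 : Convex ℝ T := by
        have h2 : (fun t : ℝ => y + t • v) = AffineMap.lineMap y z := by
          ext t
          rw [AffineMap.lineMap_apply_module', hv, add_comm]
        rw [hTball, h2]
        exact (convex_ball y ε).affine_preimage (AffineMap.lineMap y z)
      exact h1.isPreconnected
    have hT0 : (0 : ℝ) ∈ T := by simpa [hT] using hε
    have hT1 : (1 : ℝ) ∈ T := by
      change dist (y + (1 : ℝ) • v) y < ε
      rwa [one_smul, hv, add_sub_cancel]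
    have han : ∀ L ∈ ⋃ k, derivLevel Γ A k,
        AnalyticOnNhd ℝ (fun t : ℝ => L (y + t • v) (σ (y + t • v))) T := by
      intro L hL t ht
      have hl : AnalyticAt ℝ (fun t : ℝ => y + t • v) t := by fun_prop
      exact analyticAt_clm_apply
        (AnalyticAt.fun_comp (g := L) (h.analytic_iUnion L hL _ (hball ht).2) hl)
        (AnalyticAt.fun_comp (g := σ) (hball ht).1.2 hl)
    have hder : ∀ L ∈ ⋃ k, derivLevel Γ A k, ∀ t ∈ T,
        deriv (fun t : ℝ => L (y + t • v) (σ (y + t • v))) t =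
          dualDeriv Γ v L (y + t • v) (σ (y + t • v)) := by
      intro L hL t ht
      have hLd := (h.analytic_iUnion L hL _ (hball ht).2).differentiableAt
      have hσd := (hball ht).1.2.differentiableAt
      have h1 := (hLd.clm_apply hσd).hasFDerivAt.comp_hasDerivAt t (hline v t)
      rw [fderiv_form_apply (Γ := Γ) hLd hσd] at h1
      have h2 := hray v t ht
      rw [covD] at h2
      rw [h2, map_zero, add_zero] at h1
      exact h1.deriv
    have hstep : ∀ L ∈ ⋃ k, derivLevel Γ A k, dualDeriv Γ v L ∈ ⋃ k, derivLevel Γ A k := by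
      intro L hL
      obtain ⟨k, hk⟩ := mem_iUnion.1 hL
      exact mem_iUnion.2 ⟨k + 1, Or.inr ⟨v, L, hk, rfl⟩⟩
    -- Along the ray, the derivative of `L(σ)` is `L'(σ)` with `L'` the covariant derivative of `L`,
    -- since `σ` is radially parallel. The family of forms is closed under this operation and
    -- annihilates `w`, so every derivative vanishes at `0`.
    have hiter : ∀ n : ℕ, ∀ L ∈ ⋃ k, derivLevel Γ A k,
        iteratedDeriv n (fun t : ℝ => L (y + t • v) (σ (y + t • v))) 0 = 0 := by
      intro n
      induction n with
      | zero =>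
        intro L hL
        have h1 := hw L hL
        simpa [hσdef, hS0] using h1
      | succ n ih =>
        intro L hL
        have h1 : deriv (fun t : ℝ => L (y + t • v) (σ (y + t • v))) =ᶠ[𝓝 0]
            fun t : ℝ => dualDeriv Γ v L (y + t • v) (σ (y + t • v)) := by
          filter_upwards [hTo.mem_nhds hT0] with t ht using hder L hL t ht
        rw [iteratedDeriv_succ', (h1.iteratedDeriv_eq n)]
        exact ih _ (hstep L hL)
    intro L hL
    have h1 : ∀ᶠ t in 𝓝 (0 : ℝ), L (y + t • v) (σ (y + t • v)) = 0 := by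
      rw [← analyticOrderAt_eq_top, ENat.eq_top_iff_forall_ge]
      intro n
      rw [natCast_le_analyticOrderAt_iff_iteratedDeriv_eq_zero (han L hL 0 hT0)]
      exact fun i _ => hiter i L hL
    have h2 := (han L hL).eqOn_zero_of_preconnected_of_eventuallyEq_zero hTc hT0 h1 hT1
    simpa [hv] using h2
  -- the section is parallel
  have hpar : ∀ z, dist z y < ε → ∀ u, covD Γ σ z u = 0 := by
    intro z hz u
    set v := z - y with hv
    -- Differentiating `∇_{z-y} σ = 0` in the direction `u` gives `t ∂_u(∇_v σ) = -∇_u σ`. As the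
    -- curvature kills `σ` and `∇_v σ = 0` on the ray, `∂_v(∇_u σ) = ∂_u(∇_v σ) - Γ_v ∇_u σ`. Hence
    -- `t ∇_u σ` solves a homogeneous linear ODE, and the factor `t` supplies the initial value `0`.
    have key : ∀ t ∈ Icc (0 : ℝ) 1, HasDerivAt (fun t : ℝ => t • covD Γ σ (y + t • v) u)
        (-(Γ (y + t • v) v) (t • covD Γ σ (y + t • v) u)) t := by
      intro t ht
      set x := y + t • v with hx
      have hxd : dist x y < ε := hmem z hz t ht
      have hΓx : DifferentiableAt ℝ Γ x := (h.analytic x (hball hxd).2).differentiableAt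
      have hσx : ContDiffAt ℝ 2 σ x := (hball hxd).1.2.contDiffAt
      have h1 := hasFDerivAt_covD hΓx hσx (differentiableAt_const u)
      have h2 := hasFDerivAt_covD hΓx hσx
        (X := fun z => z - y) (by fun_prop)
      have h3 : (fun z => covD Γ σ z (z - y)) =ᶠ[𝓝 x] fun _ => 0 := by
        have : Metric.ball y ε ∈ 𝓝 x := Metric.isOpen_ball.mem_nhds hxd
        filter_upwards [this] with z hz using (hball hz).1.1
      have h4 := h2.2 u
      rw [h3.fderiv_eq] at h4
      have h5 : fderiv ℝ (fun z : E => z - y) x u = u := by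
        rw [fderiv_sub_const]
        simp
      have h6 : x - y = t • v := by rw [hx, add_sub_cancel_left]
      rw [h5, h6] at h4
      have h7 := covD_comm hΓx hσx u v
      have h8 : σ x ∈ commonKer A x := limitKer_le Γ A x 0 (hlim x hxd)
      rw [h.curvature_eq_zero x (hball hxd).2 _ h8, hray v t hxd, map_zero, zero_add,
        zero_sub] at h7
      have h9 : fderiv ℝ (fun z => covD Γ σ z v) x u = fderiv ℝ (fderiv ℝ σ) x u v +
          fderiv ℝ Γ x u v (σ x) + Γ x v (fderiv ℝ σ x u) := by
        rw [(hasFDerivAt_covD hΓx hσx (differentiableAt_const v)).2]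
        simp [covD]
      have h10 : t • fderiv ℝ (fun z => covD Γ σ z v) x u = - covD Γ σ x u := by
        rw [h9, eq_neg_iff_add_eq_zero]
        simp only [map_smul, smul_apply, zero_apply, fderiv_fun_const, Pi.zero_apply] at h4
        rw [smul_add, smul_add]
        exact h4.symm
      have h11 := h1.1.hasFDerivAt.comp_hasDerivAt t (hline v t)
      have h12 := (hasDerivAt_id t).smul h11
      refine h12.congr_deriv ?_
      have h13 : fderiv ℝ (fun z => covD Γ σ z u) x v =
          fderiv ℝ (fun z => covD Γ σ z v) x u - Γ x v (covD Γ σ x u) := by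
        rw [sub_eq_iff_eq_add] at h7
        rw [h7]
        abel
      simp only [id, Function.comp_apply, one_smul, map_smul]
      rw [h13, smul_sub, h10]
      abel
    have h1 := eq_zero_of_hasDerivAt_linear (f := fun t : ℝ => t • covD Γ σ (y + t • v) u)
      (A := fun t : ℝ => -(Γ (y + t • v) v)) ?_ (fun t ht => key t ht) (by simp) 1
      ⟨zero_le_one, le_rfl⟩
    · simpa [hv] using h1
    · intro t ht
      have h2 : ContinuousAt (fun t : ℝ => Γ (y + t • v)) t :=
        ContinuousAt.comp' (h.analytic _ (hball (hmem z hz t ht)).2).continuousAt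
          (hline v t).continuousAt
      exact (h2.clm_apply continuousAt_const).neg.continuousWithinAt
  rw [Metric.eventually_nhds_iff]
  exact ⟨ε, hε, fun z hz => ⟨(hball hz).1.2, hpar z hz, hlim z hz⟩⟩

end LocalTheory

/-! ### Constant rank and local parallel frames. -/

section LocalFrame

variable {E : Type*} [NormedAddCommGroup E] [NormedSpace ℝ E]
  {F : Type*} [NormedAddCommGroup F] [NormedSpace ℝ F] [FiniteDimensional ℝ F]

/-- Each basis vector is extended separately; linear independence is an open condition, so it
survives near `y`. -/
theorem IsFlagSystem.exists_parallel_family {Γ : E → E →L[ℝ] F →L[ℝ] F}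
    {A : Set (E → F →L[ℝ] ℝ)} {B : Set E} (h : IsFlagSystem Γ A B) {y : E} (hy : y ∈ B)
    {r : ℕ} (b : Module.Basis (Fin r) ℝ (limitKer Γ A y)) :
    ∃ σ : Fin r → E → F, (∀ i, σ i y = b i) ∧ ∀ᶠ z in 𝓝 y, (∀ i, AnalyticAt ℝ (σ i) z ∧
      (∀ u, covD Γ (σ i) z u = 0) ∧ σ i z ∈ limitKer Γ A z) ∧
      LinearIndependent ℝ (fun i => σ i z) := by
  have : CompleteSpace F := FiniteDimensional.complete ℝ F
  choose σ h0 hσ using fun i => h.exists_parallel hy (b i).2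
  refine ⟨σ, h0, ?_⟩
  have hev := eventually_all.2 hσ
  refine hev.and ?_
  have hli : LinearIndependent ℝ (fun i => σ i y) := by
    have := b.linearIndependent.map' (limitKer Γ A y).subtype (Submodule.ker_subtype _)
    rwa [show (fun i => σ i y) = (limitKer Γ A y).subtype ∘ b from funext h0]
  have hc : ContinuousAt (fun z => fun i => σ i z) y :=
    continuousAt_pi.2 fun i => (hσ i).self_of_nhds.1.continuousAt
  exact hc.preimage_mem_nhds (isOpen_setOfPred_linearIndependent.mem_nhds hli)

/-- Every dimension equals the generic one, `d`. It is at least `d` by minimality. It is at most `d`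
because parallel extensions of a basis stay independent and remain in the limit kernel at nearby
points, among which there are generic ones. -/
theorem IsFlagSystem.finrank_limitKer_eq {Γ : E → E →L[ℝ] F →L[ℝ] F}
    {A : Set (E → F →L[ℝ] ℝ)} {B : Set E} (h : IsFlagSystem Γ A B) {y z : E} (hy : y ∈ B)
    (hz : z ∈ B) :
    Module.finrank ℝ (limitKer Γ A y) = Module.finrank ℝ (limitKer Γ A z) := by
  obtain ⟨d, m, L, u, U, hL, hU, hUB, hBU, hUd, hd⟩ :=
    exists_generic h.isOpen h.isPreconnected ⟨y, hy⟩ h.analytic_iUnion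
  suffices key : ∀ x ∈ B, Module.finrank ℝ (limitKer Γ A x) = d by rw [key y hy, key z hz]
  intro x hx
  refine le_antisymm ?_ (hd x hx)
  obtain ⟨σ, -, hσ⟩ := h.exists_parallel_family hx (Module.finBasis ℝ (limitKer Γ A x))
  obtain ⟨w, hw1, hw2⟩ := mem_closure_iff_nhds.1 (hBU hx) _ hσ
  rw [← (hUd w hw2).2.2]
  change _ ≤ Module.finrank ℝ (limitKer Γ A w)
  have hli : LinearIndependent ℝ (fun i => (⟨σ i w, (hw1.1 i).2.2⟩ : limitKer Γ A w)) :=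
    LinearIndependent.of_comp (limitKer Γ A w).subtype hw1.2
  simpa using hli.fintype_card_le_finrank

/-- A basis of the limit kernel at a point extends to a local frame of parallel sections. -/
theorem IsFlagSystem.exists_frame {Γ : E → E →L[ℝ] F →L[ℝ] F}
    {A : Set (E → F →L[ℝ] ℝ)} {B : Set E} (h : IsFlagSystem Γ A B) {y : E} (hy : y ∈ B)
    {r : ℕ} (b : Module.Basis (Fin r) ℝ (limitKer Γ A y)) :
    ∃ σ : Fin r → E → F, (∀ i, σ i y = b i) ∧ ∀ᶠ z in 𝓝 y,
      (∀ i, AnalyticAt ℝ (σ i) z ∧ ∀ u, covD Γ (σ i) z u = 0) ∧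
      LinearIndependent ℝ (fun i => σ i z) ∧
      Submodule.span ℝ (range fun i => σ i z) = limitKer Γ A z := by
  obtain ⟨σ, h0, hσ⟩ := h.exists_parallel_family hy b
  refine ⟨σ, h0, ?_⟩
  filter_upwards [hσ, h.isOpen.mem_nhds hy] with z hz hzB
  refine ⟨fun i => ⟨(hz.1 i).1, (hz.1 i).2.1⟩, hz.2, ?_⟩
  refine Submodule.eq_of_le_of_finrank_eq (Submodule.span_le.2 ?_) ?_
  · rintro _ ⟨i, rfl⟩
    exact (hz.1 i).2.2
  · rw [finrank_span_eq_card hz.2, ← h.finrank_limitKer_eq hy hzB,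
      Module.finrank_eq_card_basis b]

end LocalFrame

/-! ### Sections read in a chart and a trivialization. -/

section Reading

variable (E : Type*) [NormedAddCommGroup E] [NormedSpace ℝ E]
  {M : Type*} [TopologicalSpace M] [ChartedSpace E M]
  (F : Type*) [NormedAddCommGroup F] [NormedSpace ℝ F]
  (V : M → Type*) [TopologicalSpace (TotalSpace F V)]
  [∀ x, AddCommGroup (V x)] [∀ x, Module ℝ (V x)]
  [∀ x : M, TopologicalSpace (V x)] [FiberBundle F V] [VectorBundle ℝ F V]

/-- The coordinate of a vector in the preferred trivialization at `x₀`. -/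
noncomputable def toCoord (x₀ y : M) : V y →L[ℝ] F :=
  (trivializationAt F V x₀).continuousLinearMapAt ℝ y

/-- The vector with a given coordinate in the preferred trivialization at `x₀`. -/
noncomputable def ofCoord (x₀ y : M) : F →L[ℝ] V y :=
  (trivializationAt F V x₀).symmL ℝ y

/-- The points at which both the preferred chart and the preferred trivialization at `x₀` are
defined. -/
def coordSource (x₀ : M) : Set M :=
  (chartAt E x₀).source ∩ (trivializationAt F V x₀).baseSet

variable {E V}

/-- The expression of a section in the preferred chart and trivialization at `x₀`. -/
noncomputable def reading (x₀ : M) (X : Π y : M, V y) (z : E) : F :=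
  toCoord F V x₀ ((chartAt E x₀).symm z) (X ((chartAt E x₀).symm z))

variable {F}

variable (V) in
/-- The section with a given expression in the preferred chart and trivialization at `x₀`. -/
noncomputable def ofReading (x₀ : M) (σ : E → F) (y : M) : V y :=
  ofCoord F V x₀ y (σ (chartAt E x₀ y))

theorem isOpen_coordSource (x₀ : M) : IsOpen (coordSource E F V x₀) :=
  (chartAt E x₀).open_source.inter (trivializationAt F V x₀).open_baseSet

theorem mem_coordSource (x₀ : M) : x₀ ∈ coordSource E F V x₀ :=
  ⟨mem_chart_source E x₀, FiberBundle.mem_baseSet_trivializationAt F V x₀⟩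

theorem toCoord_eq {x₀ y : M} (hy : y ∈ coordSource E F V x₀) (w : V y) :
    toCoord F V x₀ y w = (trivializationAt F V x₀ ⟨y, w⟩).2 := by
  rw [toCoord, Trivialization.continuousLinearMapAt_apply,
    Trivialization.coe_linearMapAt_of_mem _ hy.2]

theorem toCoord_ofCoord {x₀ y : M} (hy : y ∈ coordSource E F V x₀) (w : F) :
    toCoord F V x₀ y (ofCoord F V x₀ y w) = w :=
  (trivializationAt F V x₀).continuousLinearMapAt_symmL hy.2 w

theorem ofCoord_toCoord {x₀ y : M} (hy : y ∈ coordSource E F V x₀) (w : V y) :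
    ofCoord F V x₀ y (toCoord F V x₀ y w) = w :=
  (trivializationAt F V x₀).symmL_continuousLinearMapAt hy.2 w

theorem toCoord_injective {x₀ y : M} (hy : y ∈ coordSource E F V x₀) :
    Function.Injective (toCoord F V x₀ y) :=
  Function.LeftInverse.injective (ofCoord_toCoord hy)

theorem reading_apply {x₀ y : M} (hy : y ∈ coordSource E F V x₀) (X : Π y : M, V y) :
    reading F x₀ X (chartAt E x₀ y) = toCoord F V x₀ y (X y) := by
  rw [reading, (chartAt E x₀).left_inv hy.1]

theorem reading_ofReading {x₀ : M} {z : E} (hz : z ∈ (chartAt E x₀).target)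
    (hz' : (chartAt E x₀).symm z ∈ coordSource E F V x₀) (σ : E → F) :
    reading F x₀ (ofReading V x₀ σ) z = σ z := by
  rw [reading, ofReading, toCoord_ofCoord hz', (chartAt E x₀).right_inv hz]

theorem eventually_chartAt {x₀ y : M} (hy : y ∈ coordSource E F V x₀) {p : E → Prop}
    (hp : ∀ᶠ z in 𝓝 (chartAt E x₀ y), p z) : ∀ᶠ y' in 𝓝 y, p (chartAt E x₀ y') :=
  ((chartAt E x₀).continuousAt hy.1).eventually hp

theorem eventually_chartAt_symm {x₀ y : M} (hy : y ∈ coordSource E F V x₀) {p : M → Prop}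
    (hp : ∀ᶠ y' in 𝓝 y, p y') : ∀ᶠ z in 𝓝 (chartAt E x₀ y), z ∈ (chartAt E x₀).target ∧
      (chartAt E x₀).symm z ∈ coordSource E F V x₀ ∧ p ((chartAt E x₀).symm z) := by
  have h1 : Tendsto (chartAt E x₀).symm (𝓝 (chartAt E x₀ y)) (𝓝 y) := by
    have := (chartAt E x₀).continuousAt_symm ((chartAt E x₀).map_source hy.1)
    rwa [ContinuousAt, (chartAt E x₀).left_inv hy.1] at this
  filter_upwards [(chartAt E x₀).open_target.mem_nhds ((chartAt E x₀).map_source hy.1),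
    h1.eventually hp, h1.eventually ((isOpen_coordSource x₀).mem_nhds hy)] with z h2 h3 h4
  exact ⟨h2, h4, h3⟩

theorem eventually_reading_ofReading {x₀ y : M} (hy : y ∈ coordSource E F V x₀) (σ : E → F) :
    reading F x₀ (ofReading V x₀ σ) =ᶠ[𝓝 (chartAt E x₀ y)] σ := by
  filter_upwards [eventually_chartAt_symm hy (p := fun _ => True) (by simp)] with z hz
  exact reading_ofReading hz.1 hz.2.1 σ

end Reading

/-! ### Regularity and derivatives in coordinates. -/

section Smooth

variable {E : Type*} [NormedAddCommGroup E] [NormedSpace ℝ E]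
  {M : Type*} [TopologicalSpace M] [ChartedSpace E M]
  {F : Type*} [NormedAddCommGroup F] [NormedSpace ℝ F]

theorem chartAt_mem_maximalAtlas {n : ℕ∞ω} [IsManifold 𝓘(ℝ, E) n M] (x₀ : M) :
    chartAt E x₀ ∈ IsManifold.maximalAtlas 𝓘(ℝ, E) n M :=
  IsManifold.chart_mem_maximalAtlas x₀

theorem contMDiffAt_comp_chartAt_symm_iff {n : ℕ∞ω} [IsManifold 𝓘(ℝ, E) n M] {x₀ y : M}
    (hy : y ∈ (chartAt E x₀).source) {f : M → F} :
    ContMDiffAt 𝓘(ℝ, E) 𝓘(ℝ, F) n f y ↔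
      ContDiffAt ℝ n (f ∘ (chartAt E x₀).symm) (chartAt E x₀ y) := by
  rw [← contMDiffAt_iff_contDiffAt]
  constructor
  · intro h
    refine ContMDiffAt.comp _ (I' := 𝓘(ℝ, E)) (by rwa [(chartAt E x₀).left_inv hy]) ?_
    exact contMDiffAt_symm_of_mem_maximalAtlas (chartAt_mem_maximalAtlas x₀)
      ((chartAt E x₀).map_source hy)
  · intro h
    have h1 : ContMDiffAt 𝓘(ℝ, E) 𝓘(ℝ, F) n ((f ∘ (chartAt E x₀).symm) ∘ chartAt E x₀) y :=
      h.comp y (contMDiffAt_of_mem_maximalAtlas (chartAt_mem_maximalAtlas x₀) hy)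
    refine h1.congr_of_eventuallyEq ?_
    filter_upwards [(chartAt E x₀).open_source.mem_nhds hy] with z hz
    simp [(chartAt E x₀).left_inv hz]

theorem mdifferentiableAt_comp_chartAt_symm_iff [IsManifold 𝓘(ℝ, E) 1 M] {x₀ y : M}
    (hy : y ∈ (chartAt E x₀).source) {f : M → F} :
    MDifferentiableAt 𝓘(ℝ, E) 𝓘(ℝ, F) f y ↔
      DifferentiableAt ℝ (f ∘ (chartAt E x₀).symm) (chartAt E x₀ y) := by
  rw [← mdifferentiableAt_iff_differentiableAt]
  constructor
  · intro h
    refine MDifferentiableAt.comp _ (I' := 𝓘(ℝ, E)) (by rwa [(chartAt E x₀).left_inv hy]) ?_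
    exact mdifferentiableAt_symm_of_mem_maximalAtlas (chartAt_mem_maximalAtlas x₀)
      ((chartAt E x₀).map_source hy)
  · intro h
    have h1 : MDifferentiableAt 𝓘(ℝ, E) 𝓘(ℝ, F) ((f ∘ (chartAt E x₀).symm) ∘ chartAt E x₀) y :=
      h.comp y (mdifferentiableAt_of_mem_maximalAtlas (chartAt_mem_maximalAtlas x₀) hy)
    refine h1.congr_of_eventuallyEq ?_
    filter_upwards [(chartAt E x₀).open_source.mem_nhds hy] with z hz
    simp [(chartAt E x₀).left_inv hz]

variable {V : M → Type*} [TopologicalSpace (TotalSpace F V)]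
  [∀ x, AddCommGroup (V x)] [∀ x, Module ℝ (V x)]
  [∀ x : M, TopologicalSpace (V x)] [FiberBundle F V] [VectorBundle ℝ F V]

theorem reading_eventuallyEq {x₀ y : M} (hy : y ∈ coordSource E F V x₀) (X : Π y : M, V y) :
    reading F x₀ X =ᶠ[𝓝 (chartAt E x₀ y)]
      (fun y => (trivializationAt F V x₀ ⟨y, X y⟩).2) ∘ (chartAt E x₀).symm := by
  filter_upwards [eventually_chartAt_symm hy (p := fun _ => True) (by simp)] with z hz
  rw [reading, toCoord_eq hz.2.1, Function.comp_apply]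

theorem contMDiffAt_iff_reading {n : ℕ∞ω} [IsManifold 𝓘(ℝ, E) n M]
    [ContMDiffVectorBundle n F V 𝓘(ℝ, E)] {x₀ y : M} (hy : y ∈ coordSource E F V x₀)
    {X : Π y : M, V y} :
    ContMDiffAt 𝓘(ℝ, E) (𝓘(ℝ, E).prod 𝓘(ℝ, F)) n (fun y => TotalSpace.mk' F y (X y)) y ↔
      ContDiffAt ℝ n (reading F x₀ X) (chartAt E x₀ y) := by
  rw [(trivializationAt F V x₀).contMDiffAt_section_iff hy.2,
    contMDiffAt_comp_chartAt_symm_iff hy.1]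
  have h := reading_eventuallyEq hy X
  exact ⟨fun h' => h'.congr_of_eventuallyEq h, fun h' => h'.congr_of_eventuallyEq h.symm⟩

theorem mdifferentiableAt_iff_reading [IsManifold 𝓘(ℝ, E) 1 M]
    [ContMDiffVectorBundle 1 F V 𝓘(ℝ, E)] {x₀ y : M} (hy : y ∈ coordSource E F V x₀)
    {X : Π y : M, V y} :
    MDifferentiableAt 𝓘(ℝ, E) (𝓘(ℝ, E).prod 𝓘(ℝ, F)) (fun y => TotalSpace.mk' F y (X y)) y ↔
      DifferentiableAt ℝ (reading F x₀ X) (chartAt E x₀ y) := by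
  rw [(trivializationAt F V x₀).mdifferentiableAt_section_iff _ _ hy.2,
    mdifferentiableAt_comp_chartAt_symm_iff hy.1]
  have h := reading_eventuallyEq hy X
  exact ⟨fun h' => h'.congr_of_eventuallyEq h, fun h' => h'.congr_of_eventuallyEq h.symm⟩

variable [IsManifold 𝓘(ℝ, E) 1 M]

theorem toCoord_tangentSpace {x₀ y : M} (hy : y ∈ (chartAt E x₀).source) :
    toCoord E (TangentSpace 𝓘(ℝ, E) : M → Type _) x₀ y =
      mfderiv 𝓘(ℝ, E) 𝓘(ℝ, E) (chartAt E x₀) y := by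
  rw [toCoord, TangentBundle.continuousLinearMapAt_trivializationAt hy]
  rfl

theorem coordSource_tangentSpace (x₀ : M) :
    coordSource E E (TangentSpace 𝓘(ℝ, E) : M → Type _) x₀ = (chartAt E x₀).source := by
  simp [coordSource]

theorem mvfderiv_eq {x₀ y : M} (hy : y ∈ (chartAt E x₀).source) {f : M → F}
    (hf : MDifferentiableAt 𝓘(ℝ, E) 𝓘(ℝ, F) f y) (v : TangentSpace 𝓘(ℝ, E) y) :
    mvfderiv 𝓘(ℝ, E) f y v = fderiv ℝ (f ∘ (chartAt E x₀).symm) (chartAt E x₀ y)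
      (toCoord E (TangentSpace 𝓘(ℝ, E) : M → Type _) x₀ y v) := by
  have h1 := (mdifferentiableAt_comp_chartAt_symm_iff hy).1 hf
  have h2 : mfderiv 𝓘(ℝ, E) 𝓘(ℝ, F) f y =
      mfderiv 𝓘(ℝ, E) 𝓘(ℝ, F) ((f ∘ (chartAt E x₀).symm) ∘ chartAt E x₀) y := by
    refine Filter.EventuallyEq.mfderiv_eq ?_
    filter_upwards [(chartAt E x₀).open_source.mem_nhds hy] with z hz
    simp [(chartAt E x₀).left_inv hz]
  rw [toCoord_tangentSpace hy, ← mfderiv_eq_fderiv]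
  rw [mfderiv_comp y h1.mdifferentiableAt (mdifferentiableAt_of_mem_maximalAtlas (chartAt_mem_maximalAtlas x₀) hy)] at h2
  rw [mvfderiv, h2]
  rfl

end Smooth

/-! ### The connection form in a trivialization. -/

section LocalForm

variable {E : Type*} [NormedAddCommGroup E] [NormedSpace ℝ E]
  {M : Type*} [TopologicalSpace M] [ChartedSpace E M]
  {F : Type*} [NormedAddCommGroup F] [NormedSpace ℝ F]
  {V : M → Type*} [TopologicalSpace (TotalSpace F V)]
  [∀ x, AddCommGroup (V x)] [∀ x, Module ℝ (V x)]
  [∀ x : M, TopologicalSpace (V x)]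
  [∀ x, IsTopologicalAddGroup (V x)] [∀ x, ContinuousSMul ℝ (V x)]
  [FiberBundle F V] [VectorBundle ℝ F V]

section

variable [IsManifold 𝓘(ℝ, E) 1 M]

/-- `Γ` is the connection form of `D` in the preferred chart and trivialization at `x₀`. -/
def IsLocalForm (D : CovariantDerivative 𝓘(ℝ, E) F V) (x₀ : M) (Γ : E → E →L[ℝ] F →L[ℝ] F) :
    Prop :=
  ∀ y ∈ coordSource E F V x₀, ∀ X : Π y : M, V y,
    MDifferentiableAt 𝓘(ℝ, E) (𝓘(ℝ, E).prod 𝓘(ℝ, F)) (fun y => TotalSpace.mk' F y (X y)) y →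
    ∀ v : TangentSpace 𝓘(ℝ, E) y, toCoord F V x₀ y (D X y v) =
      covD Γ (reading F x₀ X) (chartAt E x₀ y)
        (toCoord E (TangentSpace 𝓘(ℝ, E) : M → Type _) x₀ y v)

variable [ContMDiffVectorBundle 1 F V 𝓘(ℝ, E)]

theorem covariantDerivative_sum (D : CovariantDerivative 𝓘(ℝ, E) F V) {ι : Type*}
    (s : Finset ι) (X : ι → Π y : M, V y) {y : M}
    (hX : ∀ i, MDifferentiableAt 𝓘(ℝ, E) (𝓘(ℝ, E).prod 𝓘(ℝ, F))
      (fun y => TotalSpace.mk' F y (X i y)) y) :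
    D (fun y => ∑ i ∈ s, X i y) y = ∑ i ∈ s, D (X i) y := by
  classical
  induction s using Finset.induction_on with
  | empty =>
    simp only [Finset.sum_empty]
    exact congrFun D.zero y
  | insert a s ha ih =>
    rw [Finset.sum_insert ha, ← ih, ← D.isCovariantDerivativeOn.add (hX a)
      (MDifferentiableAt.sum_section fun i _ => hX i) (mem_univ y)]
    congr 1
    funext z
    simp [Finset.sum_insert ha]

theorem mdifferentiableAt_ofReading {x₀ y : M} (hy : y ∈ coordSource E F V x₀) {σ : E → F}
    (hσ : DifferentiableAt ℝ σ (chartAt E x₀ y)) :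
    MDifferentiableAt 𝓘(ℝ, E) (𝓘(ℝ, E).prod 𝓘(ℝ, F))
      (fun y => TotalSpace.mk' F y (ofReading V x₀ σ y)) y :=
  (mdifferentiableAt_iff_reading hy).2
    (hσ.congr_of_eventuallyEq (eventually_reading_ofReading hy σ))

/-- Near `y` the section is a combination of the constant frame with its coordinates as
coefficients. The Leibniz rule gives the ordinary derivative from the coefficients and a
zeroth-order term from the derivatives of the frame. -/
theorem toCoord_covariantDerivative [FiniteDimensional ℝ F] (D : CovariantDerivative 𝓘(ℝ, E) F V)
    {ι : Type*} [Fintype ι] (b : Module.Basis ι ℝ F) {x₀ y : M} (hy : y ∈ coordSource E F V x₀)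
    {X : Π y : M, V y}
    (hX : MDifferentiableAt 𝓘(ℝ, E) (𝓘(ℝ, E).prod 𝓘(ℝ, F)) (fun y => TotalSpace.mk' F y (X y)) y)
    (v : TangentSpace 𝓘(ℝ, E) y) :
    toCoord F V x₀ y (D X y v) = fderiv ℝ (reading F x₀ X) (chartAt E x₀ y)
        (toCoord E (TangentSpace 𝓘(ℝ, E) : M → Type _) x₀ y v) +
      ∑ j, b.coord j (toCoord F V x₀ y (X y)) •
        toCoord F V x₀ y (D (ofReading V x₀ fun _ : E => b j) y v) := by
  let s : ι → Π y : M, V y := fun j => ofReading V x₀ fun _ : E => b j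
  have hs : ∀ j, MDifferentiableAt 𝓘(ℝ, E) (𝓘(ℝ, E).prod 𝓘(ℝ, F))
      (fun y => TotalSpace.mk' F y (s j y)) y := fun j =>
    mdifferentiableAt_ofReading hy (differentiableAt_const _)
  let c : ι → M → ℝ := fun j y => (b.coord j).toContinuousLinearMap
    (reading F x₀ X (chartAt E x₀ y))
  have hr := (mdifferentiableAt_iff_reading hy).1 hX
  have hcr : ∀ j, c j ∘ (chartAt E x₀).symm =ᶠ[𝓝 (chartAt E x₀ y)]
      fun z => (b.coord j).toContinuousLinearMap (reading F x₀ X z) := by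
    intro j
    filter_upwards [(chartAt E x₀).open_target.mem_nhds ((chartAt E x₀).map_source hy.1)] with z hz
    simp only [c, Function.comp_apply, (chartAt E x₀).right_inv hz]
  have hc : ∀ j, MDifferentiableAt 𝓘(ℝ, E) 𝓘(ℝ) (c j) y := by
    intro j
    rw [mdifferentiableAt_comp_chartAt_symm_iff hy.1]
    exact ((ContinuousLinearMap.differentiableAt _).comp _ hr).congr_of_eventuallyEq (hcr j)
  have hdc : ∀ j, mvfderiv 𝓘(ℝ, E) (c j) y v = b.coord j (fderiv ℝ (reading F x₀ X)
      (chartAt E x₀ y) (toCoord E (TangentSpace 𝓘(ℝ, E) : M → Type _) x₀ y v)) := by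
    intro j
    rw [mvfderiv_eq hy.1 (hc j), (hcr j).fderiv_eq]
    have := ((b.coord j).toContinuousLinearMap.hasFDerivAt.comp _ hr.hasFDerivAt).fderiv
    change fderiv ℝ ((b.coord j).toContinuousLinearMap ∘ reading F x₀ X) _ _ = _
    rw [this]
    rfl
  have hcs : ∀ j, MDifferentiableAt 𝓘(ℝ, E) (𝓘(ℝ, E).prod 𝓘(ℝ, F))
      (fun y => TotalSpace.mk' F y ((c j • s j) y)) y := fun j => (hc j).smul_section (hs j)
  have hXs : ∀ᶠ y' in 𝓝 y, X y' = ∑ j, (c j • s j) y' := by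
    filter_upwards [(isOpen_coordSource x₀).mem_nhds hy] with y' hy'
    apply toCoord_injective hy'
    rw [map_sum]
    simp only [c, s, Pi.smul_apply', map_smul, reading_apply hy', ofReading, toCoord_ofCoord hy']
    exact (b.sum_repr _).symm
  rw [D.isCovariantDerivativeOn.congr_of_eventuallyEq hX (MDifferentiableAt.sum_section
    fun j _ => hcs j) univ_mem hXs, covariantDerivative_sum D _ _ hcs]
  simp only [D.isCovariantDerivativeOn.leibniz (hs _) (hc _) (mem_univ y),
    sum_apply, map_sum, add_apply,
    smul_apply, ContinuousLinearMap.smulRight_apply, map_add, map_smul, hdc]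
  rw [Finset.sum_add_distrib, add_comm]
  congr 1
  · simp only [s, ofReading, toCoord_ofCoord hy]
    exact b.sum_repr _
  · simp only [c, reading_apply hy]
    rfl

end

variable [IsManifold 𝓘(ℝ, E) ω M] [ContMDiffVectorBundle ω F V 𝓘(ℝ, E)]
  [FiniteDimensional ℝ E] [FiniteDimensional ℝ F]

/-- The columns of `Γ` are the covariant derivatives of the constant frame fields, read in the
bundle of homomorphisms. They are analytic because the frame is and the connection preserves
analyticity. -/
theorem exists_isLocalForm (D : CovariantDerivative 𝓘(ℝ, E) F V) (hD : IsAnalytic D) (x₀ : M) :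
    ∃ Γ : E → E →L[ℝ] F →L[ℝ] F, IsLocalForm D x₀ Γ ∧
      ∀ y ∈ coordSource E F V x₀, AnalyticAt ℝ Γ (chartAt E x₀ y) := by
  have : CompleteSpace F := FiniteDimensional.complete ℝ F
  have : CompleteSpace E := FiniteDimensional.complete ℝ E
  let b := Module.finBasis ℝ F
  let s : Fin (Module.finrank ℝ F) → Π y : M, V y := fun j => ofReading V x₀ fun _ : E => b j
  let G : Fin (Module.finrank ℝ F) → E → E →L[ℝ] F := fun j =>
    reading (V := fun y => TangentSpace 𝓘(ℝ, E) y →L[ℝ] V y) (E →L[ℝ] F) x₀ (fun y => D (s j) y)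
  have hcs : coordSource E (E →L[ℝ] F) (fun y => TangentSpace 𝓘(ℝ, E) y →L[ℝ] V y) x₀ =
      coordSource E F V x₀ := by
    simp [coordSource, ← inter_assoc]
  -- The connection takes class `ω + 1` to class `ω`; since `ω + 1 = ω`, no derivative is lost.
  have hs : ∀ j, ContMDiffOn 𝓘(ℝ, E) (𝓘(ℝ, E).prod 𝓘(ℝ, F)) (ω + 1)
      (fun y => TotalSpace.mk' F y (s j y)) (coordSource E F V x₀) := by
    intro j y hy
    refine ContMDiffAt.contMDiffWithinAt ?_
    change ContMDiffAt 𝓘(ℝ, E) (𝓘(ℝ, E).prod 𝓘(ℝ, F)) ω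
      (fun y => TotalSpace.mk' F y (s j y)) y
    rw [contMDiffAt_iff_reading hy]
    exact contDiffAt_const.congr_of_eventuallyEq (eventually_reading_ofReading hy _)
  have hG : ∀ j, ∀ y ∈ coordSource E F V x₀, AnalyticAt ℝ (G j) (chartAt E x₀ y) := by
    intro j y hy
    refine ContDiffAt.analyticAt ((contMDiffAt_iff_reading (V := fun y => TangentSpace 𝓘(ℝ, E) y →L[ℝ] V y)
      (by rwa [hcs])).1 ?_)
    exact ((hD _ (isOpen_coordSource x₀)).contMDiff (hs j)).contMDiffAt
      ((isOpen_coordSource x₀).mem_nhds hy)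
  have hGa : ∀ j, ∀ y ∈ coordSource E F V x₀, ∀ v : TangentSpace 𝓘(ℝ, E) y,
      G j (chartAt E x₀ y) (toCoord E (TangentSpace 𝓘(ℝ, E) : M → Type _) x₀ y v) =
        toCoord F V x₀ y (D (s j) y v) := by
    intro j y hy v
    have hy' : y ∈ coordSource E (E →L[ℝ] F) (fun y => TangentSpace 𝓘(ℝ, E) y →L[ℝ] V y) x₀ := by
      rwa [hcs]
    have hyT : y ∈ coordSource E E (TangentSpace 𝓘(ℝ, E) : M → Type _) x₀ := by
      rw [coordSource_tangentSpace]; exact hy.1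
    simp only [G]
    rw [reading_apply hy', toCoord_eq hy', hom_trivializationAt_apply]
    change toCoord F V x₀ y (D (s j) y (ofCoord E (TangentSpace 𝓘(ℝ, E) : M → Type _) x₀ y
      (toCoord E (TangentSpace 𝓘(ℝ, E) : M → Type _) x₀ y v))) = _
    rw [ofCoord_toCoord hyT]
  refine ⟨fun z => ∑ j, (ContinuousLinearMap.smulRightL ℝ F F (b.coord j).toContinuousLinearMap).comp
    (G j z), ?_, ?_⟩
  · intro y hy X hX v
    rw [toCoord_covariantDerivative D b hy hX, covD, reading_apply hy]
    congr 1
    simp only [sum_apply, ContinuousLinearMap.comp_apply, hGa _ y hy v]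
    rfl
  · intro y hy
    refine Finset.analyticAt_fun_sum _ fun j _ => ?_
    exact analyticAt_clm_comp analyticAt_const (hG j y hy)

end LocalForm

/-! ### The Lie bracket in a chart. -/

section Bracket

variable {E : Type*} [NormedAddCommGroup E] [NormedSpace ℝ E]
  {M : Type*} [TopologicalSpace M] [ChartedSpace E M] [IsManifold 𝓘(ℝ, E) ω M]

theorem inverse_mfderiv_chartAt_symm {x₀ : M} {z : E} (hz : z ∈ (chartAt E x₀).target)
    (w : TangentSpace 𝓘(ℝ, E) ((chartAt E x₀).symm z)) :
    (mfderiv 𝓘(ℝ, E) 𝓘(ℝ, E) (chartAt E x₀).symm z).inverse w =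
      toCoord E (TangentSpace 𝓘(ℝ, E) : M → Type _) x₀ ((chartAt E x₀).symm z) w := by
  have hy := (chartAt E x₀).map_target hz
  have hy' : (chartAt E x₀).symm z ∈ coordSource E E (TangentSpace 𝓘(ℝ, E) : M → Type _) x₀ := by
    rwa [coordSource_tangentSpace]
  have h1 : (mfderiv 𝓘(ℝ, E) 𝓘(ℝ, E) (chartAt E x₀) ((chartAt E x₀).symm z)).comp
      (mfderiv 𝓘(ℝ, E) 𝓘(ℝ, E) (chartAt E x₀).symm z) = ContinuousLinearMap.id ℝ _ :=
    (mdifferentiable_chart (I := 𝓘(ℝ, E)) x₀).comp_symm_deriv hz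
  rw [← toCoord_tangentSpace hy] at h1
  have h2 : (mfderiv 𝓘(ℝ, E) 𝓘(ℝ, E) (chartAt E x₀).symm z).comp
      (toCoord E (TangentSpace 𝓘(ℝ, E) : M → Type _) x₀ ((chartAt E x₀).symm z)) =
      ContinuousLinearMap.id ℝ _ := by
    ext w
    apply toCoord_injective hy'
    exact DFunLike.congr_fun h1 (toCoord E (TangentSpace 𝓘(ℝ, E) : M → Type _) x₀ _ w)
  rw [ContinuousLinearMap.inverse_eq h2 h1]
  rfl

theorem mlieBracket_vectorSpace (X Y : E → E) (z : E) :
    VectorField.mlieBracket 𝓘(ℝ, E) X Y z = fderiv ℝ Y z (X z) - fderiv ℝ X z (Y z) := by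
  have h1 : VectorField.lieBracketWithin ℝ X Y univ z =
      fderiv ℝ Y z (X z) - fderiv ℝ X z (Y z) := by
    rw [VectorField.lieBracketWithin_univ]
    rfl
  exact (congrFun (VectorField.mlieBracketWithin_eq_lieBracketWithin (s := univ)) z).trans h1

/-- The bracket is natural under pullback by the inverse chart, and that pullback is exactly the
coordinate reading of a vector field. -/
theorem toCoord_mlieBracket [FiniteDimensional ℝ E] {x₀ y : M} (hy : y ∈ (chartAt E x₀).source)
    {X Y : Π y : M, TangentSpace 𝓘(ℝ, E) y}
    (hX : MDifferentiableAt 𝓘(ℝ, E) (𝓘(ℝ, E).prod 𝓘(ℝ, E)) (fun y => TotalSpace.mk' E y (X y)) y)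
    (hY : MDifferentiableAt 𝓘(ℝ, E) (𝓘(ℝ, E).prod 𝓘(ℝ, E)) (fun y => TotalSpace.mk' E y (Y y)) y) :
    toCoord E (TangentSpace 𝓘(ℝ, E) : M → Type _) x₀ y (VectorField.mlieBracket 𝓘(ℝ, E) X Y y) =
      fderiv ℝ (reading E x₀ Y) (chartAt E x₀ y) (reading E x₀ X (chartAt E x₀ y)) -
      fderiv ℝ (reading E x₀ X) (chartAt E x₀ y) (reading E x₀ Y (chartAt E x₀ y)) := by
  have : CompleteSpace E := FiniteDimensional.complete ℝ E
  have : IsManifold 𝓘(ℝ, E) (minSmoothness ℝ 2) M := IsManifold.of_le (n := ω) le_top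
  have : IsManifold 𝓘(ℝ, E) (minSmoothness ℝ 2) E := IsManifold.of_le (n := ω) le_top
  have hz := (chartAt E x₀).map_source hy
  obtain ⟨z, hzz⟩ : ∃ z, z = chartAt E x₀ y := ⟨_, rfl⟩
  have hyz : y = (chartAt E x₀).symm z := by rw [hzz, (chartAt E x₀).left_inv hy]
  rw [← hzz] at hz ⊢
  clear hzz
  subst hyz
  have hread : ∀ X : Π y : M, TangentSpace 𝓘(ℝ, E) y,
      VectorField.mpullback 𝓘(ℝ, E) 𝓘(ℝ, E) (chartAt E x₀).symm X =ᶠ[𝓝 z] reading E x₀ X := by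
    intro X
    filter_upwards [(chartAt E x₀).open_target.mem_nhds hz] with z' hz'
    rw [VectorField.mpullback_apply, inverse_mfderiv_chartAt_symm hz']
    rfl
  have h1 := VectorField.mpullback_mlieBracket (I := 𝓘(ℝ, E)) (I' := 𝓘(ℝ, E))
    (f := (chartAt E x₀).symm) (x₀ := z) hX hY (n := ω)
    (contMDiffAt_symm_of_mem_maximalAtlas (chartAt_mem_maximalAtlas x₀) hz) le_top
  rw [VectorField.mpullback_apply, inverse_mfderiv_chartAt_symm hz,
    Filter.EventuallyEq.mlieBracket_vectorField_eq (hread X) (hread Y)] at h1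
  exact h1.trans (mlieBracket_vectorSpace _ _ z)

end Bracket

/-! ### The curvature in a chart. -/

section Curvature

variable {E : Type*} [NormedAddCommGroup E] [NormedSpace ℝ E] [FiniteDimensional ℝ E]
  {M : Type*} [TopologicalSpace M] [ChartedSpace E M] [IsManifold 𝓘(ℝ, E) ω M]
  {F : Type*} [NormedAddCommGroup F] [NormedSpace ℝ F]
  {V : M → Type*} [TopologicalSpace (TotalSpace F V)]
  [∀ x, AddCommGroup (V x)] [∀ x, Module ℝ (V x)]
  [∀ x : M, TopologicalSpace (V x)]
  [∀ x, IsTopologicalAddGroup (V x)] [∀ x, ContinuousSMul ℝ (V x)]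
  [FiberBundle F V] [VectorBundle ℝ F V] [ContMDiffVectorBundle ω F V 𝓘(ℝ, E)]

/-- The curvature in a chart. -/
theorem IsLocalForm.toCoord_curvature {D : CovariantDerivative 𝓘(ℝ, E) F V} {x₀ : M}
    {Γ : E → E →L[ℝ] F →L[ℝ] F} (h : IsLocalForm D x₀ Γ) {y : M}
    (hy : y ∈ coordSource E F V x₀) (hΓ : DifferentiableAt ℝ Γ (chartAt E x₀ y))
    (u v : TangentSpace 𝓘(ℝ, E) y) (w : V y) :
    toCoord F V x₀ y (curvature D y u v w) = coordCurvature Γ (chartAt E x₀ y)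
      (toCoord E (TangentSpace 𝓘(ℝ, E) : M → Type _) x₀ y u)
      (toCoord E (TangentSpace 𝓘(ℝ, E) : M → Type _) x₀ y v) (toCoord F V x₀ y w) := by
  have hyT : y ∈ coordSource E E (TangentSpace 𝓘(ℝ, E) : M → Type _) x₀ := by
    rw [coordSource_tangentSpace]; exact hy.1
  have hsm : ∀ u : TangentSpace 𝓘(ℝ, E) y, ContMDiffAt 𝓘(ℝ, E) (𝓘(ℝ, E).prod 𝓘(ℝ, E)) ∞
      (fun y' => TotalSpace.mk' E y' (FiberBundle.extend E u y')) y :=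
    fun u => FiberBundle.contMDiffAt_extend ..
  have hsd : ∀ u : TangentSpace 𝓘(ℝ, E) y, MDifferentiableAt 𝓘(ℝ, E) (𝓘(ℝ, E).prod 𝓘(ℝ, E))
      (fun y' => TotalSpace.mk' E y' (FiberBundle.extend E u y')) y :=
    fun u => (hsm u).mdifferentiableAt (by simp)
  have hσ : ContMDiffAt 𝓘(ℝ, E) (𝓘(ℝ, E).prod 𝓘(ℝ, F)) ∞
      (fun y' => TotalSpace.mk' F y' (FiberBundle.extend F w y')) y :=
    FiberBundle.contMDiffAt_extend ..
  have hσ2 : ContDiffAt ℝ 2 (reading F x₀ (FiberBundle.extend F w)) (chartAt E x₀ y) :=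
    ((contMDiffAt_iff_reading hy).1 hσ).of_le (by norm_cast)
  have hX : ∀ u : TangentSpace 𝓘(ℝ, E) y,
      DifferentiableAt ℝ (reading E x₀ (FiberBundle.extend E u)) (chartAt E x₀ y) :=
    fun u => (mdifferentiableAt_iff_reading hyT).1 (hsd u)
  have hσev : ∀ᶠ y' in 𝓝 y, MDifferentiableAt 𝓘(ℝ, E) (𝓘(ℝ, E).prod 𝓘(ℝ, F))
      (fun y' => TotalSpace.mk' F y' (FiberBundle.extend F w y')) y' := by
    have h1 : ContMDiffAt 𝓘(ℝ, E) (𝓘(ℝ, E).prod 𝓘(ℝ, F)) 1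
      (fun y' => TotalSpace.mk' F y' (FiberBundle.extend F w y')) y := hσ.of_le (by norm_cast)
    filter_upwards [(contMDiffAt_iff_contMDiffAt_nhds (by simp)).1 h1] with y' hy'
    exact hy'.mdifferentiableAt one_ne_zero
  have hread : ∀ u : TangentSpace 𝓘(ℝ, E) y,
      reading F x₀ (fun y' => D (FiberBundle.extend F w) y' (FiberBundle.extend E u y'))
        =ᶠ[𝓝 (chartAt E x₀ y)] fun z => covD Γ (reading F x₀ (FiberBundle.extend F w)) z
          (reading E x₀ (FiberBundle.extend E u) z) := by
    intro u
    filter_upwards [eventually_chartAt_symm hy hσev] with z hz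
    have h1 := h _ hz.2.1 _ hz.2.2 (FiberBundle.extend E u ((chartAt E x₀).symm z))
    rw [(chartAt E x₀).right_inv hz.1] at h1
    exact h1
  have hd : ∀ u : TangentSpace 𝓘(ℝ, E) y, MDifferentiableAt 𝓘(ℝ, E) (𝓘(ℝ, E).prod 𝓘(ℝ, F))
      (fun y' => TotalSpace.mk' F y'
        (D (FiberBundle.extend F w) y' (FiberBundle.extend E u y'))) y := by
    intro u
    rw [mdifferentiableAt_iff_reading hy]
    exact (hasFDerivAt_covD hΓ hσ2 (hX u)).1.congr_of_eventuallyEq (hread u)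
  have hval : ∀ u : TangentSpace 𝓘(ℝ, E) y, reading E x₀ (FiberBundle.extend E u)
      (chartAt E x₀ y) = toCoord E (TangentSpace 𝓘(ℝ, E) : M → Type _) x₀ y u := by
    intro u
    rw [reading_apply hyT, FiberBundle.extend_apply_self]
  have hvalw : reading F x₀ (FiberBundle.extend F w) (chartAt E x₀ y) = toCoord F V x₀ y w := by
    rw [reading_apply hy, FiberBundle.extend_apply_self]
  have hsymm := (hσ2.isSymmSndFDerivAt (by simp))
    (toCoord E (TangentSpace 𝓘(ℝ, E) : M → Type _) x₀ y u)
    (toCoord E (TangentSpace 𝓘(ℝ, E) : M → Type _) x₀ y v)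
  -- After expansion, the second derivatives of the section cancel by symmetry, and the derivatives
  -- of the extending vector fields cancel against the bracket term. Only the curvature of `d + Γ`
  -- is left.
  rw [curvature, curvatureAux, map_sub, map_sub, h y hy _ (hd v), h y hy _ (hd u),
    h y hy _ (hσ.mdifferentiableAt (by simp)), toCoord_mlieBracket hy.1 (hsd u) (hsd v)]
  simp only [FiberBundle.extend_apply_self]
  rw [covD, covD, (hread v).fderiv_eq, (hread u).fderiv_eq, (hread v).eq_of_nhds,
    (hread u).eq_of_nhds, (hasFDerivAt_covD hΓ hσ2 (hX v)).2, (hasFDerivAt_covD hΓ hσ2 (hX u)).2]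
  simp only [covD, hval, hvalw, map_add, map_sub, sub_apply, hsymm, coordCurvature]
  abel

end Curvature

/-! ### The derived representation on bilinear forms. -/

section FormAction

set_option maxSynthPendingDepth 3

variable (E : Type*) [NormedAddCommGroup E] [NormedSpace ℝ E]

/-- The action of endomorphisms on bilinear forms by derivations. -/
noncomputable def formAction : (E →L[ℝ] E) →L[ℝ] (E →L[ℝ] E →L[ℝ] ℝ) →L[ℝ] (E →L[ℝ] E →L[ℝ] ℝ) :=
  -(ContinuousLinearMap.compL ℝ E E (E →L[ℝ] ℝ)).flip -
    (ContinuousLinearMap.compL ℝ E (E →L[ℝ] ℝ) (E →L[ℝ] ℝ)).comp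
      (ContinuousLinearMap.compL ℝ E E ℝ).flip

variable {E}

theorem formAction_apply (L : E →L[ℝ] E) (h : E →L[ℝ] E →L[ℝ] ℝ) (a b : E) :
    formAction E L h a b = -h (L a) b - h a (L b) :=
  rfl

end FormAction

/-! ### The induced connection in a chart. -/

section TwoTensor

set_option maxSynthPendingDepth 3

variable {E : Type*} [NormedAddCommGroup E] [NormedSpace ℝ E]
  {M : Type*} [TopologicalSpace M] [ChartedSpace E M]

theorem coordSource_twoTensor [IsManifold 𝓘(ℝ, E) 1 M] (x₀ : M) :
    coordSource E (E →L[ℝ] E →L[ℝ] ℝ) (fun x : M => TwoTensor 𝓘(ℝ, E) x) x₀ =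
      (chartAt E x₀).source := by
  have h : (trivializationAt (E →L[ℝ] E →L[ℝ] ℝ) (fun x : M => TwoTensor 𝓘(ℝ, E) x) x₀).baseSet =
      (trivializationAt E (TangentSpace 𝓘(ℝ, E) : M → Type _) x₀).baseSet ∩
      ((trivializationAt E (TangentSpace 𝓘(ℝ, E) : M → Type _) x₀).baseSet ∩ univ) := rfl
  rw [coordSource, h]
  simp

theorem toCoord_twoTensor [IsManifold 𝓘(ℝ, E) 1 M] {x₀ y : M} (hy : y ∈ (chartAt E x₀).source)
    (h : TwoTensor 𝓘(ℝ, E) y) (a b : E) :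
    toCoord (E →L[ℝ] E →L[ℝ] ℝ) (fun x : M => TwoTensor 𝓘(ℝ, E) x) x₀ y h a b =
      h (ofCoord E (TangentSpace 𝓘(ℝ, E) : M → Type _) x₀ y a)
        (ofCoord E (TangentSpace 𝓘(ℝ, E) : M → Type _) x₀ y b) := by
  have hy' : y ∈ coordSource E (E →L[ℝ] E →L[ℝ] ℝ) (fun x : M => TwoTensor 𝓘(ℝ, E) x) x₀ := by
    rwa [coordSource_twoTensor]
  rw [toCoord_eq hy', hom_trivializationAt_apply]
  simp only [ContinuousLinearMap.inCoordinates, ContinuousLinearMap.comp_apply]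
  have h' : y ∈ coordSource E (E →L[ℝ] ℝ) (fun x : M => (TangentSpace 𝓘(ℝ, E) x →L[ℝ] ℝ)) x₀ := by
    exact ⟨hy, hy, trivial⟩
  have := toCoord_eq h' (h (ofCoord E (TangentSpace 𝓘(ℝ, E) : M → Type _) x₀ y a))
  refine (DFunLike.congr_fun this b).trans ?_
  change (Bundle.Trivial.trivialization M ℝ).continuousLinearMapAt ℝ y
    (h (ofCoord E (TangentSpace 𝓘(ℝ, E) : M → Type _) x₀ y a)
      (ofCoord E (TangentSpace 𝓘(ℝ, E) : M → Type _) x₀ y b)) = _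
  rw [Bundle.Trivial.continuousLinearMapAt_trivialization ℝ]
  rfl

variable [IsManifold 𝓘(ℝ, E) ω M] [FiniteDimensional ℝ E]

/-- Evaluate on constant frame fields: their covariant derivatives are given by `Γ` alone, so the
two correction terms of the induced connection become the derivation action of `Γ`. -/
theorem IsLocalForm.inducedConnection
    {D : CovariantDerivative 𝓘(ℝ, E) E (TangentSpace 𝓘(ℝ, E) : M → Type _)} {x₀ : M}
    {Γ : E → E →L[ℝ] E →L[ℝ] E} (hΓ : IsLocalForm D x₀ Γ) :
    IsLocalForm (inducedConnection D) x₀ (fun z => (formAction E).comp (Γ z)) := by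
  intro y hy h hh v
  have hy' : y ∈ (chartAt E x₀).source := hy.1
  have hyT : y ∈ coordSource E E (TangentSpace 𝓘(ℝ, E) : M → Type _) x₀ := by
    rw [coordSource_tangentSpace]; exact hy.1
  ext a b
  let s : E → Π y : M, TangentSpace 𝓘(ℝ, E) y := fun a =>
    ofReading (TangentSpace 𝓘(ℝ, E) : M → Type _) x₀ fun _ : E => a
  have hs : ∀ a, MDifferentiableAt 𝓘(ℝ, E) (𝓘(ℝ, E).prod 𝓘(ℝ, E))
      (fun y => TotalSpace.mk' E y (s a y)) y := fun a =>
    mdifferentiableAt_ofReading hyT (differentiableAt_const _)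
  have hDs : ∀ a, D (s a) y v = ofCoord E (TangentSpace 𝓘(ℝ, E) : M → Type _) x₀ y
      (Γ (chartAt E x₀ y) (toCoord E (TangentSpace 𝓘(ℝ, E) : M → Type _) x₀ y v) a) := by
    intro a
    apply toCoord_injective hyT
    rw [toCoord_ofCoord hyT, hΓ y hyT _ (hs a) v, covD,
      (eventually_reading_ofReading hyT fun _ => a).fderiv_eq,
      (eventually_reading_ofReading hyT fun _ => a).eq_of_nhds]
    simp
  have h1 := covDeriv_apply D hh (hs a) (hs b) v
  have h2 : (fun y => h y (s a y) (s b y)) ∘ (chartAt E x₀).symm =ᶠ[𝓝 (chartAt E x₀ y)]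
      fun z => reading (E →L[ℝ] E →L[ℝ] ℝ) x₀ h z a b := by
    filter_upwards [eventually_chartAt_symm hyT (p := fun _ => True) (by simp)] with z hz
    rw [reading, toCoord_twoTensor (hz.2.1).1]
    simp only [Function.comp_apply, s, ofReading]
  have hr := (mdifferentiableAt_iff_reading hy).1 hh
  have h3 : fderiv ℝ (fun z => reading (E →L[ℝ] E →L[ℝ] ℝ) x₀ h z a b) (chartAt E x₀ y)
      (toCoord E (TangentSpace 𝓘(ℝ, E) : M → Type _) x₀ y v) =
      fderiv ℝ (reading (E →L[ℝ] E →L[ℝ] ℝ) x₀ h) (chartAt E x₀ y)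
        (toCoord E (TangentSpace 𝓘(ℝ, E) : M → Type _) x₀ y v) a b := by
    have h4 := (hr.hasFDerivAt.clm_apply (hasFDerivAt_const a _)).clm_apply (hasFDerivAt_const b _)
    rw [h4.fderiv]
    simp
  rw [toCoord_twoTensor hy']
  rw [mvfderiv_eq hy' (mdifferentiableAt_eval hh (hs a) (hs b)), h2.fderiv_eq, h3, hDs, hDs] at h1
  rw [covD, reading_apply hy, add_apply, add_apply]
  change _ = _ + formAction E _ _ a b
  rw [formAction_apply, toCoord_twoTensor hy', toCoord_twoTensor hy']
  simp only [s, ofReading] at h1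
  have h4 : ∀ p q r : ℝ, p - q - r = p + (-q - r) := fun p q r => by ring
  exact h1.trans (h4 _ _ _)

end TwoTensor

/-! ### The derived flag compared with the prolonged linear conditions. -/

section FlagChart

variable {E : Type*} [NormedAddCommGroup E] [NormedSpace ℝ E] [FiniteDimensional ℝ E]
  {M : Type*} [TopologicalSpace M] [ChartedSpace E M] [IsManifold 𝓘(ℝ, E) ω M]
  {F : Type*} [NormedAddCommGroup F] [NormedSpace ℝ F] [FiniteDimensional ℝ F]
  {V : M → Type*} [TopologicalSpace (TotalSpace F V)]
  [∀ x, AddCommGroup (V x)] [∀ x, Module ℝ (V x)]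
  [∀ x : M, TopologicalSpace (V x)]
  [∀ x, IsTopologicalAddGroup (V x)] [∀ x, ContinuousSMul ℝ (V x)]
  [FiberBundle F V] [VectorBundle ℝ F V] [ContMDiffVectorBundle ω F V 𝓘(ℝ, E)]

/-- In the chart at `x₀`, over the set `B`, the first step of the derived flag is given by the
analytic flag system `(Γ, A)`. -/
structure IsFlagChart (D : CovariantDerivative 𝓘(ℝ, E) F V) (W : Π y : M, Set (V y)) (x₀ : M)
    (Γ : E → E →L[ℝ] F →L[ℝ] F) (A : Set (E → F →L[ℝ] ℝ)) (B : Set E) : Prop where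
  localForm : IsLocalForm D x₀ Γ
  flagSystem : IsFlagSystem Γ A B
  mem_preFlag_zero : ∀ y ∈ coordSource E F V x₀, chartAt E x₀ y ∈ B → ∀ w : V y,
    w ∈ preFlag D W 0 y ↔ toCoord F V x₀ y w ∈ commonKer A (chartAt E x₀ y)

variable {D : CovariantDerivative 𝓘(ℝ, E) F V} {W : Π y : M, Set (V y)} {x₀ : M}
  {Γ : E → E →L[ℝ] F →L[ℝ] F} {A : Set (E → F →L[ℝ] ℝ)} {B : Set E}

theorem sectionPart_subset (A : Π y : M, Set (V y)) (y : M) :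
    sectionPart 𝓘(ℝ, E) F A y ⊆ A y := by
  rintro w ⟨U, X, hX, rfl⟩
  exact hX.mapsTo y hX.mem

theorem IsLocalSection.contMDiffAt {A : Π y : M, Set (V y)} {U : Set M} {y : M}
    {X : Π y : M, V y} (h : IsLocalSection 𝓘(ℝ, E) F A U y X) :
    ContMDiffAt 𝓘(ℝ, E) (𝓘(ℝ, E).prod 𝓘(ℝ, F)) ∞ (fun y => TotalSpace.mk' F y (X y)) y :=
  h.contMDiffOn.contMDiffAt (h.isOpen.mem_nhds h.mem)

theorem toCoord_zero_iff (y : M) (hy : y ∈ coordSource E F V x₀) (w : V y) :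
    toCoord F V x₀ y w = 0 ↔ w = 0 :=
  ⟨fun h => toCoord_injective hy (by rw [h, map_zero]), fun h => by rw [h, map_zero]⟩

/-- A property of the values of a section, valid near a point, holds in the chart. -/
theorem IsFlagChart.eventually_reading (h : IsFlagChart D W x₀ Γ A B) {y : M}
    (hy : y ∈ coordSource E F V x₀) (hyB : chartAt E x₀ y ∈ B) {X : Π y : M, V y}
    {P : E → F → Prop} {Q : Π y : M, Set (V y)} (hX : ∀ᶠ y' in 𝓝 y, X y' ∈ Q y')
    (hPQ : ∀ y' ∈ coordSource E F V x₀, chartAt E x₀ y' ∈ B → ∀ w ∈ Q y',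
      P (chartAt E x₀ y') (toCoord F V x₀ y' w)) :
    ∀ᶠ z in 𝓝 (chartAt E x₀ y), P z (reading F x₀ X z) := by
  filter_upwards [eventually_chartAt_symm hy hX, h.flagSystem.isOpen.mem_nhds hyB] with z hz hzB
  have h1 := hPQ _ hz.2.1 (by rwa [(chartAt E x₀).right_inv hz.1]) _ hz.2.2
  rwa [(chartAt E x₀).right_inv hz.1] at h1

/-- Each step of the flag forces one further order of differentiated conditions: a witnessing
section and its covariant derivatives at the point both lie in the previous stage, and the product
rule does the rest. -/
theorem IsFlagChart.toCoord_mem_commonKer (h : IsFlagChart D W x₀ Γ A B) (i : ℕ) :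
    ∀ y ∈ coordSource E F V x₀, chartAt E x₀ y ∈ B → ∀ w ∈ preFlag D W i y,
      toCoord F V x₀ y w ∈ commonKer (derivLevel Γ A i) (chartAt E x₀ y) := by
  induction i with
  | zero => exact fun y hy hyB w hw => (h.mem_preFlag_zero y hy hyB w).1 hw
  | succ i ih =>
    rintro y hy hyB _ ⟨U, X, hX, rfl, hd⟩
    have hyT : y ∈ coordSource E E (TangentSpace 𝓘(ℝ, E) : M → Type _) x₀ := by
      rw [coordSource_tangentSpace]; exact hy.1
    have hXd := hX.contMDiffAt.mdifferentiableAt (by simp)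
    rw [← reading_apply hy]
    refine h.flagSystem.mem_succ hyB ((mdifferentiableAt_iff_reading hy).1 hXd) ?_ ?_
    · refine h.eventually_reading (P := fun z w => w ∈ commonKer (derivLevel Γ A i) z)
        (Q := preFlag D W i) hy hyB ?_ ih
      filter_upwards [hX.isOpen.mem_nhds hX.mem] with y' hy'
      exact sectionPart_subset _ _ (hX.mapsTo y' hy')
    · intro v
      have h1 := ih y hy hyB _ (sectionPart_subset _ _
        (hd (ofCoord E (TangentSpace 𝓘(ℝ, E) : M → Type _) x₀ y v)))
      rwa [h.localForm y hy X hXd, toCoord_ofCoord hyT] at h1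

theorem IsFlagChart.toCoord_mem_limitKer (h : IsFlagChart D W x₀ Γ A B) {i : ℕ}
    (hi : Module.finrank ℝ F ≤ i) {y : M} (hy : y ∈ coordSource E F V x₀)
    (hyB : chartAt E x₀ y ∈ B) {w : V y} (hw : w ∈ derivedFlag D W i y) :
    toCoord F V x₀ y w ∈ limitKer Γ A (chartAt E x₀ y) := by
  obtain ⟨U, X, hX, rfl⟩ := hw
  rw [← reading_apply hy]
  refine h.flagSystem.mem_limitKer_of_continuousAt hyB
    ((mdifferentiableAt_iff_reading hy).1
      (hX.contMDiffAt.mdifferentiableAt (by simp))).continuousAt ?_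
  refine h.eventually_reading (P := fun z w => w ∈ commonKer (derivLevel Γ A _) z)
    (Q := preFlag D W i) hy hyB ?_ fun y' hy' hyB' w hw =>
      commonKer_anti (derivLevel_mono Γ A hi) _ (h.toCoord_mem_commonKer i y' hy' hyB' w hw)
  filter_upwards [hX.isOpen.mem_nhds hX.mem] with y' hy'
  exact hX.mapsTo y' hy'

/-- Parallel sections in the chart give parallel sections of the bundle. -/
theorem IsLocalForm.exists_isOpen_parallel (h : IsLocalForm D x₀ Γ) {y : M}
    (hy : y ∈ coordSource E F V x₀) {σ : E → F} {p : E → Prop}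
    (hσ : ∀ᶠ z in 𝓝 (chartAt E x₀ y), AnalyticAt ℝ σ z ∧ (∀ u, covD Γ σ z u = 0) ∧ p z) :
    ∃ U : Set M, IsOpen U ∧ y ∈ U ∧ ∀ y' ∈ U, y' ∈ coordSource E F V x₀ ∧ p (chartAt E x₀ y') ∧
      ContMDiffAt 𝓘(ℝ, E) (𝓘(ℝ, E).prod 𝓘(ℝ, F)) ω
        (fun y => TotalSpace.mk' F y (ofReading V x₀ σ y)) y' ∧ D (ofReading V x₀ σ) y' = 0 := by
  have : CompleteSpace F := FiniteDimensional.complete ℝ F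
  obtain ⟨U, hU, hUo, hyU⟩ := eventually_nhds_iff.1
    ((eventually_chartAt hy hσ).and ((isOpen_coordSource x₀).mem_nhds hy))
  refine ⟨U, hUo, hyU, fun y' hy' => ⟨(hU y' hy').2, (hU y' hy').1.2.2, ?_⟩⟩
  obtain ⟨⟨h1, h2, -⟩, h3⟩ := hU y' hy'
  have hr := eventually_reading_ofReading h3 σ
  have hs : ContMDiffAt 𝓘(ℝ, E) (𝓘(ℝ, E).prod 𝓘(ℝ, F)) ω
      (fun y => TotalSpace.mk' F y (ofReading V x₀ σ y)) y' :=
    (contMDiffAt_iff_reading h3).2 (h1.contDiffAt.congr_of_eventuallyEq hr)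
  refine ⟨hs, ?_⟩
  ext v
  apply toCoord_injective h3
  rw [h y' h3 _ (hs.mdifferentiableAt (by simp)), covD, hr.fderiv_eq, hr.eq_of_nhds]
  rw [zero_apply, map_zero]
  exact h2 _

/-- The single kind of witness used for all stages of the flag: a parallel section that never leaves
the limit kernel. -/
theorem IsFlagChart.exists_section (h : IsFlagChart D W x₀ Γ A B) {y : M}
    (hy : y ∈ coordSource E F V x₀) (hyB : chartAt E x₀ y ∈ B) {w : V y}
    (hw : toCoord F V x₀ y w ∈ limitKer Γ A (chartAt E x₀ y)) :
    ∃ (U : Set M) (X : Π y : M, V y), IsOpen U ∧ y ∈ U ∧ X y = w ∧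
      ∀ y' ∈ U, y' ∈ coordSource E F V x₀ ∧ chartAt E x₀ y' ∈ B ∧
      toCoord F V x₀ y' (X y') ∈ limitKer Γ A (chartAt E x₀ y') ∧
      ContMDiffAt 𝓘(ℝ, E) (𝓘(ℝ, E).prod 𝓘(ℝ, F)) ω
        (fun y => TotalSpace.mk' F y (X y)) y' ∧ D X y' = 0 := by
  have : CompleteSpace F := FiniteDimensional.complete ℝ F
  obtain ⟨σ, h0, hσ⟩ := h.flagSystem.exists_parallel hyB hw
  obtain ⟨U, hU, hyU, hUp⟩ := h.localForm.exists_isOpen_parallel hy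
    (p := fun z => z ∈ B ∧ σ z ∈ limitKer Γ A z) (σ := σ) (by
      filter_upwards [hσ, h.flagSystem.isOpen.mem_nhds hyB] with z hz hzB
      exact ⟨hz.1, hz.2.1, hzB, hz.2.2⟩)
  refine ⟨U, ofReading V x₀ σ, hU, hyU, ?_, fun y' hy' => ?_⟩
  · rw [ofReading, h0, ofCoord_toCoord hy]
  · obtain ⟨h1, h2, h3, h4⟩ := hUp y' hy'
    exact ⟨h1, h2.1, by rw [ofReading, toCoord_ofCoord h1]; exact h2.2, h3, h4⟩

/-- A parallel section in the limit kernel passes every stage: by induction its values lie in the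
previous stage, and its covariant derivative is zero. Applying this at all points of its domain also
gives membership in the section part, as the next stage requires. -/
theorem IsFlagChart.mem_preFlag (h : IsFlagChart D W x₀ Γ A B) (i : ℕ) :
    ∀ y ∈ coordSource E F V x₀, chartAt E x₀ y ∈ B → ∀ w : V y,
      toCoord F V x₀ y w ∈ limitKer Γ A (chartAt E x₀ y) → w ∈ preFlag D W i y := by
  induction i with
  | zero =>
    exact fun y hy hyB w hw => (h.mem_preFlag_zero y hy hyB w).2 (limitKer_le Γ A _ 0 hw)
  | succ i ih =>
    have key : ∀ y ∈ coordSource E F V x₀, chartAt E x₀ y ∈ B → ∀ w : V y,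
        toCoord F V x₀ y w ∈ limitKer Γ A (chartAt E x₀ y) → w ∈ derivedFlag D W i y := by
      intro y hy hyB w hw
      obtain ⟨U, X, hU, hyU, hXy, hX⟩ := h.exists_section hy hyB hw
      exact ⟨U, X, ⟨hU, hyU, fun y' hy' =>
        ((hX y' hy').2.2.2.1.of_le le_top).contMDiffWithinAt, fun y' hy' =>
        ih y' (hX y' hy').1 (hX y' hy').2.1 _ (hX y' hy').2.2.1⟩, hXy⟩
    intro y hy hyB w hw
    obtain ⟨U, X, hU, hyU, hXy, hX⟩ := h.exists_section hy hyB hw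
    refine ⟨U, X, ⟨hU, hyU, fun y' hy' =>
        ((hX y' hy').2.2.2.1.of_le le_top).contMDiffWithinAt, fun y' hy' =>
        key y' (hX y' hy').1 (hX y' hy').2.1 _ (hX y' hy').2.2.1⟩, hXy, fun v => ?_⟩
    rw [(hX y hyU).2.2.2.2]
    -- The stages are mere sets, so that they contain `0` has to be deduced: it lies in the limit
    -- kernel.
    exact key y hy hyB _ (by simp)

theorem IsFlagChart.mem_derivedFlag (h : IsFlagChart D W x₀ Γ A B) (i : ℕ) {y : M}
    (hy : y ∈ coordSource E F V x₀) (hyB : chartAt E x₀ y ∈ B) {w : V y}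
    (hw : toCoord F V x₀ y w ∈ limitKer Γ A (chartAt E x₀ y)) : w ∈ derivedFlag D W i y := by
  obtain ⟨U, X, hU, hyU, hXy, hX⟩ := h.exists_section hy hyB hw
  exact ⟨U, X, ⟨hU, hyU, fun y' hy' =>
    ((hX y' hy').2.2.2.1.of_le le_top).contMDiffWithinAt, fun y' hy' =>
    h.mem_preFlag i y' (hX y' hy').1 (hX y' hy').2.1 _ (hX y' hy').2.2.1⟩, hXy⟩

/-- Stage `dim F` alone already forces membership in the limit kernel, while the limit kernel lies
in every stage. -/
theorem IsFlagChart.mem_flagTerminal_iff (h : IsFlagChart D W x₀ Γ A B) {y : M}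
    (hy : y ∈ coordSource E F V x₀) (hyB : chartAt E x₀ y ∈ B) {w : V y} :
    w ∈ flagTerminal D W y ↔ toCoord F V x₀ y w ∈ limitKer Γ A (chartAt E x₀ y) :=
  ⟨fun hw => h.toCoord_mem_limitKer le_rfl hy hyB (mem_iInter.1 hw _),
    fun hw => mem_iInter.2 fun i => h.mem_derivedFlag i hy hyB hw⟩

theorem IsFlagChart.derivedFlag_eq (h : IsFlagChart D W x₀ Γ A B) {i : ℕ}
    (hi : Module.finrank ℝ F ≤ i) {y : M} (hy : y ∈ coordSource E F V x₀)
    (hyB : chartAt E x₀ y ∈ B) : derivedFlag D W i y = flagTerminal D W y := by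
  refine Subset.antisymm (fun w hw => ?_) (iInter_subset _ i)
  exact (h.mem_flagTerminal_iff hy hyB).2 (h.toCoord_mem_limitKer hi hy hyB hw)

variable (D) in
/-- Over `U`, the sections `s` are an analytic parallel frame of the subset `A` of the bundle. -/
structure IsParallelFrame (A : Π y : M, Set (V y)) {r : ℕ} (s : Fin r → Π y : M, V y)
    (U : Set M) : Prop where
  contMDiffAt : ∀ y ∈ U, ∀ i, ContMDiffAt 𝓘(ℝ, E) (𝓘(ℝ, E).prod 𝓘(ℝ, F)) ω
    (fun y => TotalSpace.mk' F y (s i y)) y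
  parallel : ∀ y ∈ U, ∀ i, D (s i) y = 0
  linearIndependent : ∀ y ∈ U, LinearIndependent ℝ (fun i => s i y)
  span_eq : ∀ y ∈ U, (Submodule.span ℝ (range fun i => s i y) : Set (V y)) = A y

theorem IsFlagChart.exists_isParallelFrame (h : IsFlagChart D W x₀ Γ A B) {y : M}
    (hy : y ∈ coordSource E F V x₀) (hyB : chartAt E x₀ y ∈ B) :
    ∃ (r : ℕ) (U : Set M) (s : Fin r → Π y : M, V y), IsOpen U ∧ y ∈ U ∧
      IsParallelFrame D (flagTerminal D W) s U := by
  obtain ⟨σ, -, hσ⟩ := h.flagSystem.exists_frame hyB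
    (Module.finBasis ℝ (limitKer Γ A (chartAt E x₀ y)))
  have h1 : ∀ i, ∃ U : Set M, IsOpen U ∧ y ∈ U ∧ ∀ y' ∈ U, y' ∈ coordSource E F V x₀ ∧ True ∧
      ContMDiffAt 𝓘(ℝ, E) (𝓘(ℝ, E).prod 𝓘(ℝ, F)) ω
        (fun y => TotalSpace.mk' F y (ofReading V x₀ (σ i) y)) y' ∧
      D (ofReading V x₀ (σ i)) y' = 0 := fun i =>
    h.localForm.exists_isOpen_parallel hy (p := fun _ => True) (by
      filter_upwards [hσ] with z hz
      exact ⟨(hz.1 i).1, (hz.1 i).2, trivial⟩)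
  obtain ⟨U', hUp', hU', hyU'⟩ := eventually_nhds_iff.1
    ((eventually_chartAt hy (hσ.and (h.flagSystem.isOpen.mem_nhds hyB))).and
      ((isOpen_coordSource x₀).mem_nhds hy))
  choose U hU hyU hUp using h1
  refine ⟨_, U' ∩ ⋂ i, U i, fun i => ofReading V x₀ (σ i),
    hU'.inter (isOpen_iInter_of_finite hU), ⟨hyU', mem_iInter.2 hyU⟩, ?_, ?_, ?_, ?_⟩
  · exact fun y' hy' i => (hUp i y' (mem_iInter.1 hy'.2 i)).2.2.1
  · exact fun y' hy' i => (hUp i y' (mem_iInter.1 hy'.2 i)).2.2.2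
  · intro y' hy'
    obtain ⟨⟨⟨-, h1, -⟩, -⟩, h2⟩ := hUp' y' hy'.1
    exact h1.map' (ofCoord F V x₀ y').toLinearMap
      (LinearMap.ker_eq_bot.2 (Function.LeftInverse.injective (toCoord_ofCoord h2)))
  · intro y' hy'
    obtain ⟨⟨⟨-, -, h1⟩, hB⟩, h2⟩ := hUp' y' hy'.1
    ext w
    rw [SetLike.mem_coe, h.mem_flagTerminal_iff h2 hB, ← h1,
      show (range fun i => ofReading V x₀ (σ i) y') = (ofCoord F V x₀ y').toLinearMap ''
        (range fun i => σ i (chartAt E x₀ y')) by rw [← range_comp]; rfl, Submodule.span_image]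
    constructor
    · rintro ⟨f, hf, rfl⟩
      rw [ContinuousLinearMap.coe_coe, toCoord_ofCoord h2]
      exact hf
    · exact fun hw => ⟨_, hw, ofCoord_toCoord h2 w⟩

end FlagChart

/-! ### Sections of covering spaces over simply connected bases. -/

section Gluing

/-- On a simply connected space, locally constant transition data admit compatible global families
of values. -/
theorem exists_compatible_family {M C : Type*} [TopologicalSpace M] [SimplyConnectedSpace M]
    [LocallyPathConnectedSpace M] (U : M → Set M) (hU : ∀ x, IsOpen (U x)) (hmem : ∀ x, x ∈ U x)
    (g : M → M → M → C → C) (hself : ∀ i, ∀ y ∈ U i, ∀ v, g i i y v = v)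
    (hcomp : ∀ i j k, ∀ y ∈ U i ∩ U j ∩ U k, ∀ v, g j k y (g i j y v) = g i k y v)
    (hloc : ∀ i j, ∀ y ∈ U i ∩ U j, ∀ v, ∀ᶠ y' in 𝓝 y, g i j y' v = g i j y v)
    (x₀ : M) (v₀ : C) :
    ∃ f : M → C, f x₀ = v₀ ∧ ∀ y, ∀ᶠ y' in 𝓝 y, g y' y y' (f y') = f y := by
  -- With discrete values, the transition data glue to a covering space of `M`. The identity of the
  -- simply connected base lifts through `(x₀, v₀)`, and continuity of the lift in a discrete fibre
  -- is the asserted compatibility.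
  let _ : TopologicalSpace C := ⊥
  have : DiscreteTopology C := ⟨rfl⟩
  let Z : FiberBundleCore M M C :=
    { baseSet := U
      isOpen_baseSet := hU
      indexAt := id
      mem_baseSet_at := hmem
      coordChange := g
      coordChange_self := hself
      continuousOn_coordChange := by
        rintro i j ⟨y, v⟩ ⟨hy, -⟩
        refine ContinuousAt.continuousWithinAt ?_
        rw [ContinuousAt, nhds_discrete C]
        refine tendsto_pure.2 ?_
        rw [nhds_prod_eq, nhds_discrete C, prod_pure, eventually_map]
        exact hloc i j y hy v
      coordChange_comp := hcomp }
  have hcov : IsCoveringMap Z.proj := FiberBundle.isCoveringMap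
  obtain ⟨f, ⟨hf0, hf⟩, -⟩ := hcov.existsUnique_continuousMap_lifts (ContinuousMap.id M) x₀
    (⟨x₀, v₀⟩ : Z.TotalSpace) rfl
  have hf' : ∀ y, (f y).1 = y := fun y => congrFun hf y
  refine ⟨fun y => (f y).2, ?_, fun y => ?_⟩
  · have : f x₀ = (⟨x₀, v₀⟩ : Z.TotalSpace) := hf0
    change (f x₀).2 = v₀
    rw [this]
  · have h1 : ContinuousAt (fun y' => (Z.localTriv y (f y')).2) y := by
      refine continuousAt_snd.comp (ContinuousAt.comp (g := Z.localTriv y) ?_ f.continuous.continuousAt)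
      refine (Z.localTriv y).continuousAt ?_
      rw [Z.mem_localTriv_source]
      change (f y).1 ∈ U y
      rw [hf']
      exact hmem y
    rw [ContinuousAt, nhds_discrete C, tendsto_pure] at h1
    filter_upwards [h1] with y' hy'
    rw [Z.localTriv_apply, Z.localTriv_apply] at hy'
    change g (f y').1 y (f y').1 (f y').2 = g (f y).1 y (f y).1 (f y).2 at hy'
    have h2 : g (f y).1 y (f y).1 (f y).2 = (f y).2 := by
      have : ∀ z, z = y → ∀ v, g z y z v = v := by
        rintro z rfl v
        exact hself z z (hmem z) v
      exact this _ (hf' y) _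
    rw [h2, hf' y'] at hy'
    exact hy'

end Gluing

/-! ### Local parallel frames and global parallel sections. -/

section ParallelFrame

variable {E : Type*} [NormedAddCommGroup E] [NormedSpace ℝ E] [FiniteDimensional ℝ E]
  {M : Type*} [TopologicalSpace M] [ChartedSpace E M] [IsManifold 𝓘(ℝ, E) ω M]
  {F : Type*} [NormedAddCommGroup F] [NormedSpace ℝ F] [FiniteDimensional ℝ F]
  {V : M → Type*} [TopologicalSpace (TotalSpace F V)]
  [∀ x, AddCommGroup (V x)] [∀ x, Module ℝ (V x)]
  [∀ x : M, TopologicalSpace (V x)]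
  [∀ x, IsTopologicalAddGroup (V x)] [∀ x, ContinuousSMul ℝ (V x)]
  [FiberBundle F V] [VectorBundle ℝ F V] [ContMDiffVectorBundle ω F V 𝓘(ℝ, E)]
  {D : CovariantDerivative 𝓘(ℝ, E) F V} {A : Π y : M, Set (V y)} {r : ℕ}
  {s : Fin r → Π y : M, V y} {U : Set M}

/-- The length of a frame depends only on the set `A y`, through the dimension of its span. This
makes lengths of unrelated local frames comparable. -/
theorem IsParallelFrame.finrank_span (h : IsParallelFrame D A s U) {y : M} (hy : y ∈ U) :
    Module.finrank ℝ (Submodule.span ℝ (A y)) = r := by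
  rw [← h.span_eq y hy, Submodule.span_coe_eq_restrictScalars, Submodule.restrictScalars_self,
    finrank_span_eq_card (h.linearIndependent y hy), Fintype.card_fin]

/-- Over a connected base, the local parallel frames have the same length. -/
theorem exists_isParallelFrame_of_connected [ConnectedSpace M]
    (h : ∀ x : M, ∃ (r : ℕ) (U : Set M) (s : Fin r → Π y : M, V y), IsOpen U ∧ x ∈ U ∧
      IsParallelFrame D A s U) :
    ∃ r : ℕ, ∀ x : M, ∃ (U : Set M) (s : Fin r → Π y : M, V y), IsOpen U ∧ x ∈ U ∧
      IsParallelFrame D A s U := by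
  obtain ⟨x₀⟩ := (inferInstance : Nonempty M)
  have hl : IsLocallyConstant fun x : M => Module.finrank ℝ (Submodule.span ℝ (A x)) := by
    rw [IsLocallyConstant.iff_eventually_eq]
    intro x
    obtain ⟨r, U, s, hU, hx, hs⟩ := h x
    filter_upwards [hU.mem_nhds hx] with y hy
    rw [hs.finrank_span hy, hs.finrank_span hx]
  refine ⟨Module.finrank ℝ (Submodule.span ℝ (A x₀)), fun x => ?_⟩
  obtain ⟨r, U, s, hU, hx, hs⟩ := h x
  obtain rfl : r = Module.finrank ℝ (Submodule.span ℝ (A x₀)) := by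
    rw [← hs.finrank_span hx]
    exact hl.apply_eq_of_preconnectedSpace x x₀
  exact ⟨U, s, hU, hx, hs⟩

theorem isVectorSubbundle_of_isParallelFrame
    (h : ∀ x : M, ∃ (U : Set M) (s : Fin r → Π y : M, V y), IsOpen U ∧ x ∈ U ∧
      IsParallelFrame D A s U) : IsVectorSubbundle 𝓘(ℝ, E) F ω A r := by
  intro x
  obtain ⟨U, s, hU, hx, hs⟩ := h x
  exact ⟨U, hU, hx, s, fun i y hy => (hs.contMDiffAt y hy i).contMDiffWithinAt,
    fun y hy => ⟨hs.linearIndependent y hy, hs.span_eq y hy⟩⟩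

/-- The combination of the members of a frame with constant coefficients. -/
def frameComb (s : Fin r → Π y : M, V y) (c : Fin r → ℝ) (y : M) : V y :=
  ∑ i, c i • s i y

theorem IsParallelFrame.contMDiffAt_frameComb (h : IsParallelFrame D A s U) (c : Fin r → ℝ)
    {y : M} (hy : y ∈ U) : ContMDiffAt 𝓘(ℝ, E) (𝓘(ℝ, E).prod 𝓘(ℝ, F)) ω
      (fun y => TotalSpace.mk' F y (frameComb s c y)) y :=
  ContMDiffAt.sum_section fun i _ => (h.contMDiffAt y hy i).const_smul_section

theorem IsParallelFrame.frameComb_parallel (h : IsParallelFrame D A s U) (c : Fin r → ℝ)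
    {y : M} (hy : y ∈ U) : D (frameComb s c) y = 0 := by
  have hd : ∀ i, MDifferentiableAt 𝓘(ℝ, E) (𝓘(ℝ, E).prod 𝓘(ℝ, F))
      (fun y => TotalSpace.mk' F y (s i y)) y := fun i =>
    (h.contMDiffAt y hy i).mdifferentiableAt (by simp)
  have h1 := covariantDerivative_sum D Finset.univ (fun i => c i • s i) (y := y)
    fun i => (hd i).smul_const_section
  refine h1.trans (Finset.sum_eq_zero fun i _ => ?_)
  rw [D.isCovariantDerivativeOn.smul_const _ (hd i) (mem_univ y), h.parallel y hy, smul_zero]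

theorem IsParallelFrame.frameComb_mem (h : IsParallelFrame D A s U) (c : Fin r → ℝ)
    {y : M} (hy : y ∈ U) : frameComb s c y ∈ A y := by
  rw [← h.span_eq y hy]
  exact Submodule.sum_mem _ fun i _ => Submodule.smul_mem _ _ (Submodule.subset_span ⟨i, rfl⟩)

theorem IsParallelFrame.exists_frameComb (h : IsParallelFrame D A s U)
    {y : M} (hy : y ∈ U) {w : V y} (hw : w ∈ A y) : ∃ c, frameComb s c y = w := by
  rw [← h.span_eq y hy] at hw
  exact (Submodule.mem_span_range_iff_exists_fun ℝ).1 hw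

theorem IsParallelFrame.frameComb_injective (h : IsParallelFrame D A s U)
    {y : M} (hy : y ∈ U) : Function.Injective fun c => frameComb s c y := by
  intro c c' hc
  funext i
  refine sub_eq_zero.1 (Fintype.linearIndependent_iff.1 (h.linearIndependent y hy)
    (fun i => c i - c' i) ?_ i)
  simp only [sub_smul, Finset.sum_sub_distrib]
  exact sub_eq_zero.2 hc

variable (D) in
/-- Near every point, parallel sections which agree at the point agree near the point. -/
def HasUniqueParallel : Prop :=
  ∀ (X X' : Π y : M, V y) (y : M),
    (∀ᶠ y' in 𝓝 y, MDifferentiableAt 𝓘(ℝ, E) (𝓘(ℝ, E).prod 𝓘(ℝ, F))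
      (fun y => TotalSpace.mk' F y (X y)) y' ∧ D X y' = 0) →
    (∀ᶠ y' in 𝓝 y, MDifferentiableAt 𝓘(ℝ, E) (𝓘(ℝ, E).prod 𝓘(ℝ, F))
      (fun y => TotalSpace.mk' F y (X' y)) y' ∧ D X' y' = 0) →
    X y = X' y → ∀ᶠ y' in 𝓝 y, X y' = X' y'

/-- The difference of the two coordinate expressions solves the linear equation of parallel sections
and vanishes at the centre, hence along all short rays. -/
theorem hasUniqueParallel_of_isLocalForm (h : ∀ x₀ : M, ∃ Γ : E → E →L[ℝ] F →L[ℝ] F,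
    IsLocalForm D x₀ Γ ∧ ∀ y ∈ coordSource E F V x₀, AnalyticAt ℝ Γ (chartAt E x₀ y)) :
    HasUniqueParallel D := by
  intro X X' y hX hX' hy
  obtain ⟨Γ, hΓ, hΓa⟩ := h y
  have hyy := mem_coordSource (E := E) (F := F) (V := V) y
  have h1 : ∀ᶠ z in 𝓝 (chartAt E y y),
      DifferentiableAt ℝ (fun z => reading F y X z - reading F y X' z) z ∧
      ∀ u, covD Γ (fun z => reading F y X z - reading F y X' z) z u = 0 := by
    filter_upwards [eventually_chartAt_symm hyy (hX.and hX')] with z hz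
    obtain ⟨hzt, hzs, ⟨hXd, hXp⟩, hXd', hXp'⟩ := hz
    have hzT : (chartAt E y).symm z ∈ coordSource E E (TangentSpace 𝓘(ℝ, E) : M → Type _) y := by
      rw [coordSource_tangentSpace]; exact hzs.1
    have d1 := (mdifferentiableAt_iff_reading hzs).1 hXd
    have d2 := (mdifferentiableAt_iff_reading hzs).1 hXd'
    have c1 := hΓ _ hzs X hXd
    have c2 := hΓ _ hzs X' hXd'
    rw [(chartAt E y).right_inv hzt] at d1 d2 c1 c2
    refine ⟨d1.sub d2, fun u => ?_⟩
    have e1 := c1 (ofCoord E (TangentSpace 𝓘(ℝ, E) : M → Type _) y _ u)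
    have e2 := c2 (ofCoord E (TangentSpace 𝓘(ℝ, E) : M → Type _) y _ u)
    rw [toCoord_ofCoord hzT, hXp, zero_apply, map_zero] at e1
    rw [toCoord_ofCoord hzT, hXp', zero_apply, map_zero] at e2
    rw [covD] at e1 e2 ⊢
    rw [fderiv_fun_sub d1 d2, sub_apply, map_sub]
    calc _ = (fderiv ℝ (reading F y X) z u + Γ z u (reading F y X z)) -
        (fderiv ℝ (reading F y X') z u + Γ z u (reading F y X' z)) := by abel
      _ = 0 := by rw [← e1, ← e2, sub_zero]
  have h2 : ∀ᶠ z in 𝓝 (chartAt E y y), ContinuousAt Γ z :=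
    (hΓa y hyy).eventually_analyticAt.mono fun z hz => hz.continuousAt
  have h3 := eventually_eq_zero_of_parallel h2 (h1.mono fun z hz => hz.1)
    (h1.mono fun z hz => hz.2) (by rw [reading_apply hyy, reading_apply hyy, hy, sub_self])
  filter_upwards [eventually_chartAt hyy h3, (isOpen_coordSource y).mem_nhds hyy] with y' h4 h5
  rw [reading_apply h5, reading_apply h5, sub_eq_zero] at h4
  exact toCoord_injective h5 h4

/-- On a simply connected manifold, every element of a set with local parallel frames extends to a
global analytic parallel section. -/
theorem exists_global_parallel [SimplyConnectedSpace M] (hD : HasUniqueParallel D)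
    (h : ∀ x : M, ∃ (U : Set M) (s : Fin r → Π y : M, V y), IsOpen U ∧ x ∈ U ∧
      IsParallelFrame D A s U) (x₀ : M) {w : V x₀} (hw : w ∈ A x₀) :
    ∃ X : Π y : M, V y, X x₀ = w ∧
      ContMDiff 𝓘(ℝ, E) (𝓘(ℝ, E).prod 𝓘(ℝ, F)) ω (fun y => TotalSpace.mk' F y (X y)) ∧
      ∀ y, D X y = 0 ∧ X y ∈ A y := by
  have : LocallyPathConnectedSpace M := ChartedSpace.locallyPathConnectedSpace E M
  choose U s hU hmem hs using h
  -- Change of frame on coefficient vectors. Off the overlap the value is arbitrary, and the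
  -- identity is taken.
  have hex : ∀ i j y, ∃ g : (Fin r → ℝ) → (Fin r → ℝ), y ∈ U i ∩ U j →
      ∀ c, frameComb (s j) (g c) y = frameComb (s i) c y := by
    intro i j y
    by_cases hy : y ∈ U i ∩ U j
    · choose g hg using fun c => (hs j).exists_frameComb hy.2 ((hs i).frameComb_mem c hy.1)
      exact ⟨g, fun _ => hg⟩
    · exact ⟨id, fun h => absurd h hy⟩
  choose g hg using hex
  have hev : ∀ i c, ∀ y ∈ U i, ∀ᶠ y' in 𝓝 y,
      MDifferentiableAt 𝓘(ℝ, E) (𝓘(ℝ, E).prod 𝓘(ℝ, F))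
        (fun y => TotalSpace.mk' F y (frameComb (s i) c y)) y' ∧ D (frameComb (s i) c) y' = 0 := by
    intro i c y hy
    filter_upwards [(hU i).mem_nhds hy] with y' hy'
    exact ⟨((hs i).contMDiffAt_frameComb c hy').mdifferentiableAt (by simp),
      (hs i).frameComb_parallel c hy'⟩
  obtain ⟨c₀, hc₀⟩ := (hs x₀).exists_frameComb (hmem x₀) hw
  obtain ⟨f, hf0, hf⟩ := exists_compatible_family U hU hmem g
    (fun i y hy v => (hs i).frameComb_injective hy (hg i i y ⟨hy, hy⟩ v))
    (fun i j k y hy v => (hs k).frameComb_injective hy.2 (by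
      change frameComb (s k) _ y = frameComb (s k) _ y
      rw [hg j k y ⟨hy.1.2, hy.2⟩, hg i j y hy.1, hg i k y ⟨hy.1.1, hy.2⟩]))
    (fun i j y hy v => by
      -- Two constant-coefficient combinations are parallel, so agreement at `y` spreads to nearby
      -- points: transition maps are locally constant.
      have h1 := hD _ _ y (hev i v y hy.1) (hev j (g i j y v) y hy.2) (hg i j y hy v).symm
      filter_upwards [h1, ((hU i).inter (hU j)).mem_nhds hy] with y' h2 h3
      refine (hs j).frameComb_injective h3.2 ?_
      change frameComb (s j) _ y' = frameComb (s j) _ y'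
      rw [hg i j y' h3, h2]) x₀ c₀
  have hX : ∀ y, ∀ᶠ y' in 𝓝 y, frameComb (s y') (f y') y' = frameComb (s y) (f y) y' := by
    intro y
    filter_upwards [hf y, (hU y).mem_nhds (hmem y)] with y' h1 h2
    rw [← h1, hg y' y y' ⟨hmem y', h2⟩]
  have hsm : ∀ y, ContMDiffAt 𝓘(ℝ, E) (𝓘(ℝ, E).prod 𝓘(ℝ, F)) ω
      (fun y => TotalSpace.mk' F y (frameComb (s y) (f y) y)) y := fun y =>
    ((hs y).contMDiffAt_frameComb (f y) (hmem y)).congr_of_eventuallyEq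
      ((hX y).mono fun y' hy' => congrArg (TotalSpace.mk' F y') hy')
  refine ⟨fun y => frameComb (s y) (f y) y, ?_, hsm, fun y => ⟨?_, ?_⟩⟩
  · change frameComb (s x₀) (f x₀) x₀ = w
    rw [hf0, hc₀]
  · rw [D.isCovariantDerivativeOn.congr_of_eventuallyEq ((hsm y).mdifferentiableAt (by simp))
      (((hs y).contMDiffAt_frameComb (f y) (hmem y)).mdifferentiableAt (by simp)) univ_mem (hX y)]
    exact (hs y).frameComb_parallel _ (hmem y)
  · exact (hs y).frameComb_mem _ (hmem y)

end ParallelFrame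

/-! ### Curvature conditions as analytic fields of linear forms. -/

section CurvatureForm

variable {E : Type*} [NormedAddCommGroup E] [NormedSpace ℝ E]
  {F : Type*} [NormedAddCommGroup F] [NormedSpace ℝ F]

/-- The curvature of `d + Γ` as a field of endomorphisms. -/
noncomputable def curvatureForm (Γ : E → E →L[ℝ] F →L[ℝ] F) (a b : E) (z : E) : F →L[ℝ] F :=
  fderiv ℝ Γ z a b - fderiv ℝ Γ z b a + ((Γ z a).comp (Γ z b) - (Γ z b).comp (Γ z a))

theorem curvatureForm_apply (Γ : E → E →L[ℝ] F →L[ℝ] F) (a b z : E) (w : F) :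
    curvatureForm Γ a b z w = coordCurvature Γ z a b w :=
  rfl

theorem analyticAt_curvatureForm [CompleteSpace F] {Γ : E → E →L[ℝ] F →L[ℝ] F} {z : E}
    (h : AnalyticAt ℝ Γ z) (a b : E) : AnalyticAt ℝ (curvatureForm Γ a b) z := by
  have h1 : ∀ a b, AnalyticAt ℝ (fun z => fderiv ℝ Γ z a b) z := fun a b =>
    analyticAt_clm_apply (analyticAt_clm_apply h.fderiv analyticAt_const) analyticAt_const
  have h2 : ∀ a, AnalyticAt ℝ (fun z => Γ z a) z := fun a =>
    analyticAt_clm_apply h analyticAt_const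
  exact ((h1 a b).sub (h1 b a)).add
    ((analyticAt_clm_comp (h2 a) (h2 b)).sub (analyticAt_clm_comp (h2 b) (h2 a)))

/-- The fields of linear forms cutting out the common kernel of the constant forms `A₁` and of the
curvature of `d + Γ`. -/
def curvatureForms (Γ : E → E →L[ℝ] F →L[ℝ] F) (A₁ : Set (F →L[ℝ] ℝ)) : Set (E → F →L[ℝ] ℝ) :=
  {L | ∃ l ∈ A₁, L = fun _ => l} ∪
    {L | ∃ (a b : E) (l : F →L[ℝ] ℝ), L = fun z => l.comp (curvatureForm Γ a b z)}

theorem mem_commonKer_curvatureForms {Γ : E → E →L[ℝ] F →L[ℝ] F} {A₁ : Set (F →L[ℝ] ℝ)} {z : E}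
    {w : F} : w ∈ commonKer (curvatureForms Γ A₁) z ↔
      (∀ l ∈ A₁, l w = 0) ∧ ∀ a b, coordCurvature Γ z a b w = 0 := by
  constructor
  · refine fun h => ⟨fun l hl => h (fun _ => l) (Or.inl ⟨l, hl, rfl⟩), fun a b => ?_⟩
    exact (SeparatingDual.eq_zero_iff_forall_dual_eq_zero (R := ℝ) _).2 fun l => h _ (Or.inr ⟨a, b, l, rfl⟩)
  · rintro ⟨h1, h2⟩ L (⟨l, hl, rfl⟩ | ⟨a, b, l, rfl⟩)
    · exact h1 l hl
    · rw [ContinuousLinearMap.comp_apply, curvatureForm_apply, h2, map_zero]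

end CurvatureForm

/-! ### Existence of flag charts, and parallel sections inside the terminal set. -/

section FlagChart

variable {E : Type*} [NormedAddCommGroup E] [NormedSpace ℝ E] [FiniteDimensional ℝ E]
  {M : Type*} [TopologicalSpace M] [ChartedSpace E M] [IsManifold 𝓘(ℝ, E) ω M]
  {F : Type*} [NormedAddCommGroup F] [NormedSpace ℝ F] [FiniteDimensional ℝ F]
  {V : M → Type*} [TopologicalSpace (TotalSpace F V)]
  [∀ x, AddCommGroup (V x)] [∀ x, Module ℝ (V x)]
  [∀ x : M, TopologicalSpace (V x)]
  [∀ x, IsTopologicalAddGroup (V x)] [∀ x, ContinuousSMul ℝ (V x)]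
  [FiberBundle F V] [VectorBundle ℝ F V] [ContMDiffVectorBundle ω F V 𝓘(ℝ, E)]
  {D : CovariantDerivative 𝓘(ℝ, E) F V} {W : Π y : M, Set (V y)} {x₀ : M}
  {Γ : E → E →L[ℝ] F →L[ℝ] F}

/-- The set `B` is a coordinate ball, so that it is connected and the identity theorem applies on
it. The forms `A₁` are constant because `W` is assumed to be cut out by the same forms at all points
of the trivialization. -/
theorem IsLocalForm.exists_isFlagChart (h : IsLocalForm D x₀ Γ)
    (hΓ : ∀ y ∈ coordSource E F V x₀, AnalyticAt ℝ Γ (chartAt E x₀ y)) (A₁ : Set (F →L[ℝ] ℝ))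
    (hW : ∀ y ∈ coordSource E F V x₀, ∀ w : V y,
      w ∈ W y ↔ ∀ l ∈ A₁, l (toCoord F V x₀ y w) = 0) :
    ∃ B, IsFlagChart D W x₀ Γ (curvatureForms Γ A₁) B ∧ chartAt E x₀ x₀ ∈ B := by
  have : CompleteSpace F := FiniteDimensional.complete ℝ F
  obtain ⟨ε, hε, hball⟩ := Metric.eventually_nhds_iff_ball.1
    (eventually_chartAt_symm (p := fun _ => True) (mem_coordSource (E := E) (F := F) (V := V) x₀)
      (by simp))
  have hΓz : ∀ z ∈ Metric.ball (chartAt E x₀ x₀) ε, AnalyticAt ℝ Γ z := by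
    intro z hz
    have h1 := hΓ _ (hball z hz).2.1
    rwa [(chartAt E x₀).right_inv (hball z hz).1] at h1
  refine ⟨Metric.ball (chartAt E x₀ x₀) ε, ⟨h, ⟨Metric.isOpen_ball,
    (convex_ball _ _).isPreconnected, hΓz, ?_, ?_⟩, ?_⟩, Metric.mem_ball_self hε⟩
  · rintro L (⟨l, hl, rfl⟩ | ⟨a, b, l, rfl⟩) z hz
    · exact analyticAt_const
    · exact analyticAt_clm_comp analyticAt_const (analyticAt_curvatureForm (hΓz z hz) a b)
  · exact fun y _ w hw => (mem_commonKer_curvatureForms.1 hw).2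
  · intro y hy hyB w
    have hyT : y ∈ coordSource E E (TangentSpace 𝓘(ℝ, E) : M → Type _) x₀ := by
      rw [coordSource_tangentSpace]; exact hy.1
    rw [mem_commonKer_curvatureForms, ← hW y hy w]
    refine and_congr_right fun _ => ⟨fun hc a b => ?_, fun hc u v => ?_⟩
    · have h1 := h.toCoord_curvature hy (hΓ y hy).differentiableAt
        (ofCoord E (TangentSpace 𝓘(ℝ, E) : M → Type _) x₀ y a)
        (ofCoord E (TangentSpace 𝓘(ℝ, E) : M → Type _) x₀ y b) w
      rwa [hc, map_zero, toCoord_ofCoord hyT, toCoord_ofCoord hyT, eq_comm] at h1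
    · rw [← toCoord_zero_iff (x₀ := x₀) y hy,
        h.toCoord_curvature hy (hΓ y hy).differentiableAt]
      exact hc _ _

/-- A parallel section is killed by the curvature, so it lies in `V⁽⁰⁾` throughout a neighbourhood;
differentiating those conditions along a parallel section yields all the higher ones. -/
theorem IsFlagChart.mem_flagTerminal_of_parallel {A : Set (E → F →L[ℝ] ℝ)} {B : Set E}
    (h : IsFlagChart D W x₀ Γ A B) {y : M}
    (hy : y ∈ coordSource E F V x₀) (hyB : chartAt E x₀ y ∈ B) {X : Π y : M, V y}
    (hX : ∀ᶠ y' in 𝓝 y, ContMDiffAt 𝓘(ℝ, E) (𝓘(ℝ, E).prod 𝓘(ℝ, F)) ∞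
      (fun y => TotalSpace.mk' F y (X y)) y')
    (hp : ∀ᶠ y' in 𝓝 y, D X y' = 0) (hW : ∀ᶠ y' in 𝓝 y, X y' ∈ W y') :
    X y ∈ flagTerminal D W y := by
  have h1 : ∀ᶠ z in 𝓝 (chartAt E x₀ y), ContDiffAt ℝ 2 (reading F x₀ X) z ∧
      (∀ u, covD Γ (reading F x₀ X) z u = 0) ∧ z ∈ (chartAt E x₀).target ∧
      (chartAt E x₀).symm z ∈ coordSource E F V x₀ ∧ X ((chartAt E x₀).symm z) ∈ W _ := by
    filter_upwards [eventually_chartAt_symm hy (hX.and (hp.and hW))] with z hz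
    obtain ⟨hzt, hzs, hXz, hpz, hWz⟩ := hz
    have hzT : (chartAt E x₀).symm z ∈ coordSource E E (TangentSpace 𝓘(ℝ, E) : M → Type _) x₀ := by
      rw [coordSource_tangentSpace]; exact hzs.1
    have c1 := (contMDiffAt_iff_reading hzs).1 hXz
    rw [(chartAt E x₀).right_inv hzt] at c1
    refine ⟨c1.of_le (by norm_cast), fun u => ?_, hzt, hzs, hWz⟩
    have c2 := h.localForm _ hzs X (hXz.mdifferentiableAt (by simp))
      (ofCoord E (TangentSpace 𝓘(ℝ, E) : M → Type _) x₀ _ u)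
    rwa [toCoord_ofCoord hzT, hpz, zero_apply, map_zero, (chartAt E x₀).right_inv hzt,
      eq_comm] at c2
  rw [h.mem_flagTerminal_iff hy hyB, ← reading_apply hy]
  refine h.flagSystem.mem_limitKer_of_parallel hyB
    (h1.mono fun z hz => hz.1.differentiableAt (by simp)) (h1.mono fun z hz => hz.2.1) ?_
  filter_upwards [eventually_eventually_nhds.2 h1, h.flagSystem.isOpen.mem_nhds hyB] with z hz hzB
  obtain ⟨hz1, -, hzt, hzs, hzW⟩ := hz.self_of_nhds
  have hr := (chartAt E x₀).right_inv hzt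
  have h2 := h.mem_preFlag_zero _ hzs (by rwa [hr]) (X _)
  rw [hr] at h2
  refine h2.1 ⟨hzW, fun u v => ?_⟩
  have hΓz := (h.flagSystem.analytic z hzB).differentiableAt
  rw [← toCoord_zero_iff (x₀ := x₀) _ hzs, h.localForm.toCoord_curvature hzs (by rwa [hr]), hr]
  exact coordCurvature_eq_zero hΓz hz1 (hz.mono fun z' hz' => hz'.2.1) _ _

end FlagChart

/-! ### The flag chart of the bundle of symmetric two-tensors. -/

section TwoTensor

set_option maxSynthPendingDepth 3

variable {E : Type*} [NormedAddCommGroup E] [NormedSpace ℝ E] [FiniteDimensional ℝ E]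
  {M : Type*} [TopologicalSpace M] [ChartedSpace E M] [IsManifold 𝓘(ℝ, E) ω M]
  {D : CovariantDerivative 𝓘(ℝ, E) E (TangentSpace 𝓘(ℝ, E) : M → Type _)}

theorem exists_isLocalForm_inducedConnection (hD : IsAnalytic D) (x₀ : M) :
    ∃ Γ : E → E →L[ℝ] (E →L[ℝ] E →L[ℝ] ℝ) →L[ℝ] (E →L[ℝ] E →L[ℝ] ℝ),
      IsLocalForm (inducedConnection D) x₀ Γ ∧
      ∀ y ∈ coordSource E (E →L[ℝ] E →L[ℝ] ℝ) (fun x : M => TwoTensor 𝓘(ℝ, E) x) x₀,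
        AnalyticAt ℝ Γ (chartAt E x₀ y) := by
  obtain ⟨Γ, hΓ, hΓa⟩ := exists_isLocalForm D hD x₀
  refine ⟨_, hΓ.inducedConnection, fun y hy => ?_⟩
  have hyT : y ∈ coordSource E E (TangentSpace 𝓘(ℝ, E) : M → Type _) x₀ := by
    rw [coordSource_tangentSpace]; exact hy.1
  exact analyticAt_clm_comp analyticAt_const (hΓa y hyT)

theorem mem_symTwoTensors_iff {x₀ y : M} (hy : y ∈ (chartAt E x₀).source)
    (h : TwoTensor 𝓘(ℝ, E) y) :
    h ∈ symTwoTensors 𝓘(ℝ, E) y ↔ ∀ a b : E,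
      toCoord (E →L[ℝ] E →L[ℝ] ℝ) (fun x : M => TwoTensor 𝓘(ℝ, E) x) x₀ y h a b =
      toCoord (E →L[ℝ] E →L[ℝ] ℝ) (fun x : M => TwoTensor 𝓘(ℝ, E) x) x₀ y h b a := by
  have hyT : y ∈ coordSource E E (TangentSpace 𝓘(ℝ, E) : M → Type _) x₀ := by
    rwa [coordSource_tangentSpace]
  simp only [toCoord_twoTensor hy]
  refine ⟨fun hs a b => hs _ _, fun hs a b => ?_⟩
  have h1 := hs (toCoord E (TangentSpace 𝓘(ℝ, E) : M → Type _) x₀ y a)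
    (toCoord E (TangentSpace 𝓘(ℝ, E) : M → Type _) x₀ y b)
  rwa [ofCoord_toCoord hyT, ofCoord_toCoord hyT] at h1

/-- The linear form `h ↦ h(a, b) - h(b, a)`. -/
noncomputable def antisymForm (a b : E) : (E →L[ℝ] E →L[ℝ] ℝ) →L[ℝ] ℝ :=
  (ContinuousLinearMap.apply ℝ ℝ b).comp (ContinuousLinearMap.apply ℝ (E →L[ℝ] ℝ) a) -
    (ContinuousLinearMap.apply ℝ ℝ a).comp (ContinuousLinearMap.apply ℝ (E →L[ℝ] ℝ) b)

theorem antisymForm_apply (a b : E) (h : E →L[ℝ] E →L[ℝ] ℝ) :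
    antisymForm a b h = h a b - h b a :=
  rfl

theorem exists_isFlagChart_inducedConnection (hD : IsAnalytic D) (x₀ : M) :
    ∃ Γ A B, IsFlagChart (inducedConnection D) (symTwoTensors 𝓘(ℝ, E)) x₀ Γ A B ∧
      chartAt E x₀ x₀ ∈ B := by
  obtain ⟨Γ, hΓ, hΓa⟩ := exists_isLocalForm_inducedConnection hD x₀
  obtain ⟨B, hB, hx⟩ := hΓ.exists_isFlagChart (W := symTwoTensors 𝓘(ℝ, E)) hΓa
    {l | ∃ a b : E, l = antisymForm a b} (by
      intro y hy h
      rw [mem_symTwoTensors_iff hy.1]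
      constructor
      · rintro hs _ ⟨a, b, rfl⟩
        rw [antisymForm_apply, hs, sub_self]
      · intro hs a b
        exact sub_eq_zero.1 (hs _ ⟨a, b, rfl⟩))
  exact ⟨_, _, _, hB, hx⟩

end TwoTensor

/-! ### Positivity of parallel bilinear forms. -/

section Positivity

set_option maxSynthPendingDepth 3

variable {E : Type*} [NormedAddCommGroup E] [NormedSpace ℝ E]

/-- Mean value theorem along the ray: at the intermediate point `c • v` the hypothesis gives `c`
times the slope, and `c > 0`. -/
theorem eq_of_fderiv_radial_eq_zero {f : E → ℝ} {ε : ℝ}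
    (hf : ∀ v ∈ Metric.ball (0 : E) ε, DifferentiableAt ℝ f v ∧ fderiv ℝ f v v = 0) {v : E}
    (hv : v ∈ Metric.ball (0 : E) ε) : f v = f 0 := by
  have hmem : ∀ t ∈ Icc (0 : ℝ) 1, t • v ∈ Metric.ball (0 : E) ε := by
    intro t ht
    rw [mem_ball_zero_iff] at hv ⊢
    rw [norm_smul, Real.norm_of_nonneg ht.1]
    exact (mul_le_of_le_one_left (norm_nonneg v) ht.2).trans_lt hv
  have hd : ∀ t ∈ Icc (0 : ℝ) 1, HasDerivAt (fun t : ℝ => f (t • v)) (fderiv ℝ f (t • v) v) t := by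
    intro t ht
    have h1 : HasDerivAt (fun t : ℝ => t • v) v t := by
      simpa using (hasDerivAt_id t).smul_const v
    exact (hf _ (hmem t ht)).1.hasFDerivAt.comp_hasDerivAt t h1
  obtain ⟨c, hc, hc'⟩ := exists_hasDerivAt_eq_slope (fun t : ℝ => f (t • v)) _ zero_lt_one
    (fun t ht => (hd t ht).continuousAt.continuousWithinAt)
    (fun t ht => hd t (Ioo_subset_Icc_self ht))
  have h2 := (hf _ (hmem c (Ioo_subset_Icc_self hc))).2
  rw [map_smul, smul_eq_mul] at h2
  rw [(mul_eq_zero.1 h2).resolve_left hc.1.ne'] at hc'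
  simp only [one_smul, zero_smul, sub_zero, div_one] at hc'
  exact sub_eq_zero.1 hc'.symm

/-- Parallel bilinear forms at nearby points are related by linear automorphisms. -/
theorem exists_isUnit_parallel [FiniteDimensional ℝ E] {Γ : E → E →L[ℝ] E →L[ℝ] E}
    {g : E → E →L[ℝ] E →L[ℝ] ℝ} {x : E} (hΓ : AnalyticAt ℝ Γ x)
    (hg : ∀ᶠ z in 𝓝 x, DifferentiableAt ℝ g z ∧
      ∀ u, covD (fun z => (formAction E).comp (Γ z)) g z u = 0) :
    ∀ᶠ z in 𝓝 x, ∃ T : E →L[ℝ] E, IsUnit T ∧ ∀ a b, g z (T a) (T b) = g x a b := by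
  have : CompleteSpace E := FiniteDimensional.complete ℝ E
  -- Left composition with `Γ` is the connection on endomorphisms whose radial solution from the
  -- identity is parallel transport `S`. It is invertible near the centre, and the parallel form
  -- pulled back by `S` has zero radial derivative.
  have hΓ' : AnalyticAt ℝ (fun z => (ContinuousLinearMap.compL ℝ E E E).comp (Γ z)) x :=
    analyticAt_clm_comp analyticAt_const hΓ
  obtain ⟨S, hS, hS0, hSd⟩ := exists_analyticAt_radial hΓ' (ContinuousLinearMap.id ℝ E)
  have hxv : Tendsto (fun v => x + v) (𝓝 0) (𝓝 x) := by
    have : Continuous fun v : E => x + v := by fun_prop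
    simpa using this.tendsto 0
  have hunit : ∀ᶠ v in 𝓝 (0 : E), IsUnit (S v) :=
    hS.continuousAt.eventually (Units.isOpen.mem_nhds (by rw [hS0]; exact isUnit_one))
  obtain ⟨ε, hε, hball⟩ := Metric.eventually_nhds_iff_ball.1
    (hunit.and (hSd.and (hS.eventually_analyticAt.and (hxv.eventually hg))))
  have key : ∀ v ∈ Metric.ball (0 : E) ε, ∀ a b, g (x + v) (S v a) (S v b) = g x a b := by
    intro v hv a b
    have h1 := eq_of_fderiv_radial_eq_zero (f := fun v => g (x + v) (S v a) (S v b)) (ε := ε) ?_ hv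
    · simpa [hS0] using h1
    · intro v hv
      obtain ⟨-, hSv, hSa, hgd, hgp⟩ := hball v hv
      have e1 : HasFDerivAt (fun v => g (x + v)) (fderiv ℝ g (x + v)) v := by
        have := hgd.hasFDerivAt.comp v ((hasFDerivAt_id v).const_add x)
        rwa [ContinuousLinearMap.comp_id] at this
      have e2 : ∀ a, HasFDerivAt (fun v => S v a) ((fderiv ℝ S v).flip a) v := by
        intro a
        have := hSa.differentiableAt.hasFDerivAt.clm_apply (hasFDerivAt_const a v)
        simpa using this
      have e3 := (e1.clm_apply (e2 a)).clm_apply (e2 b)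
      refine ⟨e3.differentiableAt, ?_⟩
      rw [e3.fderiv]
      have e4 : ∀ a, fderiv ℝ S v v a = -Γ (x + v) v (S v a) := by
        intro a
        exact eq_neg_of_add_eq_zero_left (DFunLike.congr_fun hSv a)
      have e5 : fderiv ℝ g (x + v) v (S v a) (S v b) +
          (-g (x + v) (Γ (x + v) v (S v a)) (S v b) - g (x + v) (S v a) (Γ (x + v) v (S v b))) = 0 :=
        DFunLike.congr_fun (DFunLike.congr_fun (hgp v) (S v a)) (S v b)
      simp only [add_apply, ContinuousLinearMap.comp_apply, ContinuousLinearMap.flip_apply, e4,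
        map_neg, neg_apply]
      linarith
  have hz : Tendsto (fun z => z - x) (𝓝 x) (𝓝 0) := by
    have : Continuous fun z : E => z - x := by fun_prop
    simpa using this.tendsto x
  filter_upwards [hz.eventually (Metric.ball_mem_nhds 0 hε)] with z hz
  refine ⟨S (z - x), (hball _ hz).1, fun a b => ?_⟩
  simpa using key _ hz a b

theorem pos_iff_of_isUnit {g h : E →L[ℝ] E →L[ℝ] ℝ} {T : E →L[ℝ] E} (hT : IsUnit T)
    (hgh : ∀ a b, g (T a) (T b) = h a b) :
    (∀ a, a ≠ 0 → 0 < g a a) ↔ ∀ a, a ≠ 0 → 0 < h a a := by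
  obtain ⟨u, rfl⟩ := hT
  have h1 : ∀ a, (u : E →L[ℝ] E) ((↑u⁻¹ : E →L[ℝ] E) a) = a := fun a =>
    DFunLike.congr_fun (Units.mul_inv u) a
  have h2 : ∀ a, (↑u⁻¹ : E →L[ℝ] E) ((u : E →L[ℝ] E) a) = a := fun a =>
    DFunLike.congr_fun (Units.inv_mul u) a
  constructor
  · intro hg a ha
    rw [← hgh]
    refine hg _ fun h0 => ha ?_
    rw [← h2 a, h0, map_zero]
  · intro hh a ha
    rw [← h1 a, hgh]
    refine hh _ fun h0 => ha ?_
    rw [← h1 a, h0, map_zero]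

/-- By homogeneity positivity needs checking only on the unit sphere, which is compact in finite
dimension. -/
theorem isOpen_setOf_pos [FiniteDimensional ℝ E] :
    IsOpen {h : E →L[ℝ] E →L[ℝ] ℝ | ∀ a, a ≠ 0 → 0 < h a a} := by
  rw [isOpen_iff_eventually]
  intro h hh
  have h1 : ∀ᶠ h' in 𝓝 h, ∀ a ∈ Metric.sphere (0 : E) 1, 0 < h' a a := by
    refine (isCompact_sphere (0 : E) 1).eventually_forall_of_forall_eventually fun a ha => ?_
    have hc : Continuous fun p : (E →L[ℝ] E →L[ℝ] ℝ) × E => p.1 p.2 p.2 := by fun_prop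
    refine hc.continuousAt.eventually (lt_mem_nhds (hh a ?_))
    exact ne_zero_of_mem_unit_sphere ⟨a, ha⟩
  filter_upwards [h1] with h' hh' a ha
  have hn : ‖a‖ ≠ 0 := norm_ne_zero_iff.2 ha
  have h2 := hh' (‖a‖⁻¹ • a) (by simp [norm_smul, hn])
  simp only [map_smul, smul_apply, smul_eq_mul] at h2
  have h3 : 0 < ‖a‖⁻¹ := inv_pos.2 (norm_pos_iff.2 ha)
  exact (pos_iff_pos_of_mul_pos ((mul_pos_iff_of_pos_left h3).1 h2)).1 h3

end Positivity

/-! ### Bases inside open sets. -/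

section OpenSpan

/-- A nonempty open subset of `ℝ^r` contains a basis. -/
theorem exists_linearIndependent_of_isOpen {r : ℕ} {O : Set (Fin r → ℝ)} (hO : IsOpen O)
    (hne : O.Nonempty) : ∃ c : Fin r → Fin r → ℝ, (∀ i, c i ∈ O) ∧ LinearIndependent ℝ c := by
  have hspan : ⊤ ≤ Submodule.span ℝ O := by
    rw [Submodule.eq_top_of_nonempty_interior' (Submodule.span ℝ O)
      (hne.mono (interior_maximal Submodule.subset_span hO))]
  let b := Module.Basis.ofSpan hspan
  let e := (Pi.basisFun ℝ (Fin r)).indexEquiv b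
  refine ⟨fun i => b (e i), fun i => Module.Basis.ofSpan_subset hspan ⟨e i, rfl⟩, ?_⟩
  exact b.linearIndependent.comp e e.injective

end OpenSpan

/-! ### Parallel sections over a connected base. -/

section ParallelFrame

variable {E : Type*} [NormedAddCommGroup E] [NormedSpace ℝ E] [FiniteDimensional ℝ E]
  {M : Type*} [TopologicalSpace M] [ChartedSpace E M] [IsManifold 𝓘(ℝ, E) ω M]
  {F : Type*} [NormedAddCommGroup F] [NormedSpace ℝ F] [FiniteDimensional ℝ F]
  {V : M → Type*} [TopologicalSpace (TotalSpace F V)]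
  [∀ x, AddCommGroup (V x)] [∀ x, Module ℝ (V x)]
  [∀ x : M, TopologicalSpace (V x)]
  [∀ x, IsTopologicalAddGroup (V x)] [∀ x, ContinuousSMul ℝ (V x)]
  [FiberBundle F V] [VectorBundle ℝ F V] [ContMDiffVectorBundle ω F V 𝓘(ℝ, E)]
  {D : CovariantDerivative 𝓘(ℝ, E) F V} {A : Π y : M, Set (V y)} {r : ℕ}

/-- Vanishing is locally constant: near any point the section has constant coefficients in a
parallel frame, so it vanishes at one point there exactly when the coefficients do. -/
theorem eq_zero_of_parallel [ConnectedSpace M] (hD : HasUniqueParallel D)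
    (h : ∀ x : M, ∃ (U : Set M) (s : Fin r → Π y : M, V y), IsOpen U ∧ x ∈ U ∧
      IsParallelFrame D A s U) {X : Π y : M, V y}
    (hX : ∀ y, MDifferentiableAt 𝓘(ℝ, E) (𝓘(ℝ, E).prod 𝓘(ℝ, F))
      (fun y => TotalSpace.mk' F y (X y)) y) (hp : ∀ y, D X y = 0) (hA : ∀ y, X y ∈ A y)
    {y₀ : M} (h0 : X y₀ = 0) (y : M) : X y = 0 := by
  have hl : IsLocallyConstant fun y => X y = 0 := by
    rw [IsLocallyConstant.iff_eventually_eq]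
    intro y
    obtain ⟨U, s, hU, hy, hs⟩ := h y
    obtain ⟨c, hc⟩ := hs.exists_frameComb hy (hA y)
    have h1 := hD (frameComb s c) X y (by
      filter_upwards [hU.mem_nhds hy] with y' hy'
      exact ⟨(hs.contMDiffAt_frameComb c hy').mdifferentiableAt (by simp),
        hs.frameComb_parallel c hy'⟩) (.of_forall fun y => ⟨hX y, hp y⟩) hc
    have h2 : ∀ y' ∈ U, frameComb s c y' = 0 ↔ c = 0 := by
      intro y' hy'
      have h3 : frameComb s (0 : Fin r → ℝ) y' = 0 := by simp [frameComb]
      exact ⟨fun h4 => hs.frameComb_injective hy' (h4.trans h3.symm), fun h4 => by rw [h4, h3]⟩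
    filter_upwards [h1, hU.mem_nhds hy] with y' h3 h4
    rw [← h3, ← hc, h2 y' h4, h2 y hy]
  exact (hl.apply_eq_of_preconnectedSpace y y₀).mpr h0

/-- A linear relation at `y` is a parallel section vanishing at `y`; it therefore vanishes at `y₀`
too, where independence is known. -/
theorem linearIndependent_of_parallel [ConnectedSpace M] (hD : HasUniqueParallel D)
    (h : ∀ x : M, ∃ (U : Set M) (s : Fin r → Π y : M, V y), IsOpen U ∧ x ∈ U ∧
      IsParallelFrame D A s U) {ι : Type*} [Fintype ι] {X : ι → Π y : M, V y}
    (hX : ∀ i y, MDifferentiableAt 𝓘(ℝ, E) (𝓘(ℝ, E).prod 𝓘(ℝ, F))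
      (fun y => TotalSpace.mk' F y (X i y)) y) (hp : ∀ i y, D (X i) y = 0)
    (hA : ∀ i y, X i y ∈ A y) {y₀ : M} (h0 : LinearIndependent ℝ fun i => X i y₀) (y : M) :
    LinearIndependent ℝ fun i => X i y := by
  rw [Fintype.linearIndependent_iff] at h0 ⊢
  intro c hc
  refine h0 c ?_
  have hX' : ∀ i y, MDifferentiableAt 𝓘(ℝ, E) (𝓘(ℝ, E).prod 𝓘(ℝ, F))
      (fun y => TotalSpace.mk' F y ((c i • X i) y)) y := fun i y => (hX i y).smul_const_section
  refine eq_zero_of_parallel hD h (X := fun y => ∑ i, c i • X i y) ?_ ?_ ?_ hc y₀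
  · exact fun y => MDifferentiableAt.sum_section fun i _ => hX' i y
  · intro y
    refine (covariantDerivative_sum D Finset.univ (fun i => c i • X i) fun i => hX' i y).trans
      (Finset.sum_eq_zero fun i _ => ?_)
    rw [D.isCovariantDerivativeOn.smul_const _ (hX i y) (mem_univ y), hp, smul_zero]
  · intro y
    obtain ⟨U, s, hU, hy, hs⟩ := h y
    have hA' := fun i => hA i y
    rw [← hs.span_eq y hy] at hA' ⊢
    exact Submodule.sum_mem _ fun i _ => Submodule.smul_mem _ _ (hA' i)

theorem flagTerminal_subset (W : Π y : M, Set (V y)) (y : M) : flagTerminal D W y ⊆ W y :=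
  fun _ hw => (sectionPart_subset (preFlag D W 0) y (mem_iInter.1 hw 0)).1

end ParallelFrame

/-! ### Global parallel metrics. -/

section GlobalMetric

set_option maxSynthPendingDepth 3

variable {E : Type*} [NormedAddCommGroup E] [NormedSpace ℝ E] [FiniteDimensional ℝ E]
  {M : Type*} [TopologicalSpace M] [ChartedSpace E M] [IsManifold 𝓘(ℝ, E) ω M]
  {D : CovariantDerivative 𝓘(ℝ, E) E (TangentSpace 𝓘(ℝ, E) : M → Type _)}

theorem pos_iff_toCoord {x₀ y : M} (hy : y ∈ (chartAt E x₀).source) (h : TwoTensor 𝓘(ℝ, E) y) :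
    (∀ a : TangentSpace 𝓘(ℝ, E) y, a ≠ 0 → 0 < h a a) ↔ ∀ a : E, a ≠ 0 →
      0 < toCoord (E →L[ℝ] E →L[ℝ] ℝ) (fun x : M => TwoTensor 𝓘(ℝ, E) x) x₀ y h a a := by
  have hyT : y ∈ coordSource E E (TangentSpace 𝓘(ℝ, E) : M → Type _) x₀ := by
    rwa [coordSource_tangentSpace]
  simp only [toCoord_twoTensor hy]
  constructor
  · intro hp a ha
    refine hp _ fun h0 => ha ?_
    rw [← toCoord_ofCoord hyT a, h0, map_zero]
  · intro hp a ha
    have h1 := hp (toCoord E (TangentSpace 𝓘(ℝ, E) : M → Type _) x₀ y a) fun h0 => ha <| by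
      rw [← ofCoord_toCoord hyT a, h0, map_zero]
    rwa [ofCoord_toCoord hyT] at h1

theorem eventually_pos_iff_of_parallel (hD : IsAnalytic D) {g : Π y : M, TwoTensor 𝓘(ℝ, E) y}
    (hg : ∀ y, MDifferentiableAt 𝓘(ℝ, E) (𝓘(ℝ, E).prod 𝓘(ℝ, E →L[ℝ] E →L[ℝ] ℝ))
      (fun y => TotalSpace.mk' (E →L[ℝ] E →L[ℝ] ℝ) y (g y)) y)
    (hp : ∀ y, inducedConnection D g y = 0) (x₀ : M) :
    ∀ᶠ y in 𝓝 x₀, (∀ a : TangentSpace 𝓘(ℝ, E) y, a ≠ 0 → 0 < g y a a) ↔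
      ∀ a : TangentSpace 𝓘(ℝ, E) x₀, a ≠ 0 → 0 < g x₀ a a := by
  obtain ⟨Γ, hΓ, hΓa⟩ := exists_isLocalForm D hD x₀
  have hx := mem_coordSource (E := E) (F := E →L[ℝ] E →L[ℝ] ℝ)
    (V := fun x : M => TwoTensor 𝓘(ℝ, E) x) x₀
  have h1 : ∀ᶠ z in 𝓝 (chartAt E x₀ x₀),
      DifferentiableAt ℝ (reading (E →L[ℝ] E →L[ℝ] ℝ) x₀ g) z ∧
      ∀ u, covD (fun z => (formAction E).comp (Γ z)) (reading (E →L[ℝ] E →L[ℝ] ℝ) x₀ g) z u = 0 := by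
    filter_upwards [eventually_chartAt_symm (p := fun _ => True) hx (by simp)] with z hz
    obtain ⟨hzt, hzs, -⟩ := hz
    have hzT : (chartAt E x₀).symm z ∈ coordSource E E (TangentSpace 𝓘(ℝ, E) : M → Type _) x₀ := by
      rw [coordSource_tangentSpace]; exact hzs.1
    have d1 := (mdifferentiableAt_iff_reading hzs).1 (hg _)
    have c1 := hΓ.inducedConnection _ hzs g (hg _)
    rw [(chartAt E x₀).right_inv hzt] at d1 c1
    refine ⟨d1, fun u => ?_⟩
    have e1 := c1 (ofCoord E (TangentSpace 𝓘(ℝ, E) : M → Type _) x₀ _ u)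
    rwa [toCoord_ofCoord hzT, hp, zero_apply, map_zero, eq_comm] at e1
  have h2 := exists_isUnit_parallel
    (hΓa x₀ (mem_coordSource (E := E) (F := E) (V := (TangentSpace 𝓘(ℝ, E) : M → Type _)) x₀)) h1
  filter_upwards [eventually_chartAt hx h2, (isOpen_coordSource x₀).mem_nhds hx] with y h3 h4
  obtain ⟨T, hT, hgT⟩ := h3
  rw [reading_apply h4, reading_apply hx] at hgT
  rw [pos_iff_toCoord h4.1, pos_iff_toCoord hx.1]
  exact pos_iff_of_isUnit hT hgT

/-- Nearby values of a parallel form are congruent, so positive definiteness is a locally constant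
property, and the base is connected. -/
theorem pos_of_parallel [ConnectedSpace M] (hD : IsAnalytic D)
    {g : Π y : M, TwoTensor 𝓘(ℝ, E) y}
    (hg : ∀ y, MDifferentiableAt 𝓘(ℝ, E) (𝓘(ℝ, E).prod 𝓘(ℝ, E →L[ℝ] E →L[ℝ] ℝ))
      (fun y => TotalSpace.mk' (E →L[ℝ] E →L[ℝ] ℝ) y (g y)) y)
    (hp : ∀ y, inducedConnection D g y = 0) {x₀ : M}
    (h0 : ∀ a : TangentSpace 𝓘(ℝ, E) x₀, a ≠ 0 → 0 < g x₀ a a) (y : M) :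
    ∀ a : TangentSpace 𝓘(ℝ, E) y, a ≠ 0 → 0 < g y a a := by
  have hl : IsLocallyConstant fun y => ∀ a : TangentSpace 𝓘(ℝ, E) y, a ≠ 0 → 0 < g y a a := by
    rw [IsLocallyConstant.iff_eventually_eq]
    exact fun y => (eventually_pos_iff_of_parallel hD hg hp y).mono fun y' hy' => propext hy'
  exact (hl.apply_eq_of_preconnectedSpace y x₀).mpr h0

theorem exists_isParallelFrame_Wtilde [ConnectedSpace M] (hD : IsAnalytic D) :
    ∃ r : ℕ, ∀ x : M, ∃ (U : Set M) (s : Fin r → Π y : M, TwoTensor 𝓘(ℝ, E) y), IsOpen U ∧ x ∈ U ∧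
      IsParallelFrame (inducedConnection D) (Wtilde D) s U := by
  refine exists_isParallelFrame_of_connected fun x => ?_
  obtain ⟨Γ, A, B, h, hB⟩ := exists_isFlagChart_inducedConnection hD x
  obtain ⟨r, U, s, hU, hx, hs⟩ := h.exists_isParallelFrame (mem_coordSource x) hB
  exact ⟨r, U, s, hU, hx, hs⟩

/-- The stabilization index is the dimension of the fibre model, the same in every chart, so no
compactness of `M` is needed to make it uniform. -/
theorem exists_derivedFlag_eq_Wtilde (hD : IsAnalytic D) :
    ∃ k : ℕ, ∀ l ≥ k,
      derivedFlag (inducedConnection D) (symTwoTensors 𝓘(ℝ, E)) l = Wtilde D := by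
  refine ⟨Module.finrank ℝ (E →L[ℝ] E →L[ℝ] ℝ), fun l hl => funext fun y => ?_⟩
  obtain ⟨Γ, A, B, h, hB⟩ := exists_isFlagChart_inducedConnection hD y
  exact h.derivedFlag_eq hl (mem_coordSource y) hB

theorem IsParallelMetricOn.mem_Wtilde (hD : IsAnalytic D) {U : Set M} (hU : IsOpen U)
    {g : Π y : M, TwoTensor 𝓘(ℝ, E) y} (hg : IsParallelMetricOn ∞ D U g) {x : M} (hx : x ∈ U) :
    g x ∈ Wtilde D x := by
  obtain ⟨Γ, A, B, h, hB⟩ := exists_isFlagChart_inducedConnection hD x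
  refine h.mem_flagTerminal_of_parallel (mem_coordSource x) hB ?_ ?_ ?_
  · filter_upwards [hU.mem_nhds hx] with y hy
    exact hg.contMDiffOn.contMDiffAt (hU.mem_nhds hy)
  · filter_upwards [hU.mem_nhds hx] with y hy using hg.parallel y hy
  · filter_upwards [hU.mem_nhds hx] with y hy using hg.symm y hy

/-- On a simply connected manifold, a positive definite element of `W̃` extends to a global
parallel metric. -/
theorem exists_isParallelMetricOn_univ [ConnectedSpace M] [SimplyConnectedSpace M]
    (hD : IsAnalytic D) {x₀ : M} {w : TwoTensor 𝓘(ℝ, E) x₀} (hw : w ∈ Wtilde D x₀)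
    (hpos : ∀ a : TangentSpace 𝓘(ℝ, E) x₀, a ≠ 0 → 0 < w a a) :
    ∃ g : Π y : M, TwoTensor 𝓘(ℝ, E) y, g x₀ = w ∧ (∀ y, g y ∈ Wtilde D y) ∧
      IsParallelMetricOn ω D univ g := by
  obtain ⟨r, hframe⟩ := exists_isParallelFrame_Wtilde hD
  obtain ⟨g, rfl, hg, hp⟩ := exists_global_parallel
    (hasUniqueParallel_of_isLocalForm (exists_isLocalForm_inducedConnection hD)) hframe x₀ hw
  refine ⟨g, rfl, fun y => (hp y).2, hg.contMDiffOn, fun y _ => flagTerminal_subset _ y (hp y).2,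
    fun y _ => ?_, fun y _ => (hp y).1⟩
  exact pos_of_parallel hD (fun y => (hg y).mdifferentiableAt (by simp)) (fun y => (hp y).1) hpos y

/-- In frame coefficients at `x`, the positive definite elements of `W̃` form an open subset of
`ℝ^r`, nonempty because of `w`; such a subset contains a basis. -/
theorem exists_linearIndependent_pos {U : Set M} {r : ℕ}
    {s : Fin r → Π y : M, TwoTensor 𝓘(ℝ, E) y}
    (hs : IsParallelFrame (inducedConnection D) (Wtilde D) s U) {x : M} (hx : x ∈ U)
    {w : TwoTensor 𝓘(ℝ, E) x} (hw : w ∈ Wtilde D x)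
    (hpos : ∀ a : TangentSpace 𝓘(ℝ, E) x, a ≠ 0 → 0 < w a a) :
    ∃ v : Fin r → TwoTensor 𝓘(ℝ, E) x, (∀ i, v i ∈ Wtilde D x) ∧
      (∀ i, ∀ a : TangentSpace 𝓘(ℝ, E) x, a ≠ 0 → 0 < v i a a) ∧ LinearIndependent ℝ v := by
  have hxs := (mem_coordSource (E := E) (F := E →L[ℝ] E →L[ℝ] ℝ)
    (V := fun x : M => TwoTensor 𝓘(ℝ, E) x) x).1
  have hc : Continuous fun c : Fin r → ℝ =>
      toCoord (E →L[ℝ] E →L[ℝ] ℝ) (fun x : M => TwoTensor 𝓘(ℝ, E) x) x x (frameComb s c x) := by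
    simp only [frameComb, map_sum, map_smul]
    fun_prop
  have hO : IsOpen {c : Fin r → ℝ | ∀ a : TangentSpace 𝓘(ℝ, E) x, a ≠ 0 →
      0 < frameComb s c x a a} := by
    simp only [pos_iff_toCoord hxs]
    exact isOpen_setOf_pos.preimage hc
  obtain ⟨c₀, rfl⟩ := hs.exists_frameComb hx hw
  obtain ⟨c, hcO, hci⟩ := exists_linearIndependent_of_isOpen hO ⟨c₀, hpos⟩
  refine ⟨fun i => frameComb s (c i) x, fun i => hs.frameComb_mem _ hx, hcO, ?_⟩
  exact hci.map' (Fintype.linearCombination ℝ fun i => s i x)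
    (LinearMap.ker_eq_bot.2 (hs.frameComb_injective hx))

theorem linearIndependent_of_isParallelMetricOn [ConnectedSpace M] (hD : IsAnalytic D) {r : ℕ}
    {g : Fin r → Π y : M, TwoTensor 𝓘(ℝ, E) y} (hg : ∀ i, IsParallelMetricOn ω D univ (g i))
    (hgW : ∀ i y, g i y ∈ Wtilde D y) {x₀ : M} (h0 : LinearIndependent ℝ fun i => g i x₀) (y : M) :
    LinearIndependent ℝ fun i => g i y := by
  obtain ⟨_, hframe⟩ := exists_isParallelFrame_Wtilde hD
  exact linearIndependent_of_parallel
    (hasUniqueParallel_of_isLocalForm (exists_isLocalForm_inducedConnection hD)) hframe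
    (fun i y => ((hg i).contMDiffOn.contMDiffAt univ_mem).mdifferentiableAt (by simp))
    (fun i y => (hg i).parallel y trivial) hgW h0 y

end GlobalMetric

end MetricConnection

open MetricConnection

theorem lemma5 {E : Type*} [NormedAddCommGroup E] [NormedSpace ℝ E] [FiniteDimensional ℝ E]
    {M : Type*} [TopologicalSpace M] [T2Space M] [SecondCountableTopology M]
    [ChartedSpace E M] [IsManifold 𝓘(ℝ, E) ω M] [ConnectedSpace M]
    (D : CovariantDerivative 𝓘(ℝ, E) E (TangentSpace 𝓘(ℝ, E) : M → Type _))
    (hD : IsAnalytic D) :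
    (∃ k : ℕ, ∀ l ≥ k,
      derivedFlag (inducedConnection D) (symTwoTensors 𝓘(ℝ, E)) l = Wtilde D) ∧
    ∃ r : ℕ, IsVectorSubbundle 𝓘(ℝ, E) (E →L[ℝ] E →L[ℝ] ℝ) ω (Wtilde D) r ∧
      (SimplyConnectedSpace M → IsLocallyMetric ∞ D →
        IsMetric ω D ∧
        ∃ g : Fin r → Π y : M, TwoTensor 𝓘(ℝ, E) y,
          (∀ i, IsParallelMetricOn ω D Set.univ (g i)) ∧
          ∀ y : M, LinearIndependent ℝ (fun i => g i y)) := by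
  refine ⟨exists_derivedFlag_eq_Wtilde hD, ?_⟩
  obtain ⟨r, hframe⟩ := exists_isParallelFrame_Wtilde hD
  refine ⟨r, isVectorSubbundle_of_isParallelFrame hframe, fun _ hloc => ?_⟩
  obtain ⟨x₀⟩ := (inferInstance : Nonempty M)
  -- A parallel metric near one point suffices: parallel extension and propagation of positivity
  -- take care of the rest of `M`.
  obtain ⟨U, hU, hx, g₀, hg₀⟩ := hloc x₀
  have hw := hg₀.mem_Wtilde hD hU hx
  obtain ⟨U', s, -, hx', hs⟩ := hframe x₀
  obtain ⟨v, hvW, hvpos, hv⟩ := exists_linearIndependent_pos hs hx' hw (hg₀.pos x₀ hx)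
  obtain ⟨g, -, -, hg⟩ := exists_isParallelMetricOn_univ hD hw (hg₀.pos x₀ hx)
  choose G hG0 hGW hG using fun i => exists_isParallelMetricOn_univ hD (hvW i) (hvpos i)
  refine ⟨⟨g, hg⟩, G, hG, fun y => ?_⟩
  exact linearIndependent_of_isParallelMetricOn hD hG hGW (x₀ := x₀) (by simpa only [hG0] using hv) y
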